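/- Let $\mathcal X\subseteq\mathbb R^d$ be nonempty, convex and compact, with Euclidean diameter $D$. Let $F:\mathcal X\to\mathbb R^d$ be $L$-Lipschitz and $\sigma$-hypomonotone with $\sigma\ge 0$, i.e. $\langle F(x)-F(x'),x-x'\rangle\ge-\sigma\|x-x'\|_2^2$ for all $x,x'\in\mathcal X$. Let $\epsilon>0$. A point $x^*\in\mathcal X$ is an $\eta$-approximate Minty VI (MVI) solution if $\langle F(x),x-x^*\rangle\ge-\eta$ for all $x\in\mathcal X$, and an $\eta$-approximate (Stampacchia) VI solution if $\langle F(x^*),x-x^*\rangle\ge-\eta$ for all $x\in\mathcal X$. A probability distribution $\mu$ on $\mathcal X$ is an $\epsilon$-EVI solution if $\mathbb E_{x\sim\mu}\langle F(x),x-x'\rangle\le\epsilon$ for all $x'\in\mathcal X$. 1. The mean of every $\epsilon$-EVI solution is an $(\epsilon+\sigma D^2)$-approximate MVI solution. If moreover $\epsilon\le LD^2$, this mean is a $2D\sqrt{L(\epsilon+\sigma D^2)}$-approximate VI solution. 2. If $\epsilon+\sigma D^2\le LD^2$, then every $(\epsilon+\sigma D^2)$-approximate MVI solution is a $2D\sqrt{L(\epsilon+\sigma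 D^2)}$-approximate VI solution. 3. There is a single algorithm with the following property. Suppose in addition that $B_r(c)\subseteq\mathcal X\subseteq B_R(c)$ (closed Euclidean balls) for some $c\in\mathbb R^d$ and $r>0$. Given $d,\epsilon,r,R,L,c$, a separation oracle for $\mathcal X$ and an evaluation oracle for $F$ on $\mathcal X$, the algorithm outputs the mean of some $\epsilon$-EVI solution. By part 1 this is an $(\epsilon+\sigma D^2)$-approximate MVI solution, and it is a $2D\sqrt{L(\epsilon+\sigma D^2)}$-approximate VI solution if $\epsilon\le LD^2$. The algorithm runs in time polynomial in $d$, $\log(1+1/\epsilon)$, $\log(1+R)$, $\log(1+1/r)$, $\log(1+L)$ and $\log(1+\|F(c)\|_2)$; thus, for bounded $R,1/r,L,\|F(c)\|_2$, in time $\mathrm{poly}(d,\log(1/\epsilon))$ for $\epsilon\le 1/2$. Time is counted in the real-number model: a random access machine with unit-cost exact operations $+,-,\times,/,\sqrt{\cdot}$ and comparisons on real numbers, addition, subtraction and comparison on natural-number registers, and $d+1$ steps per oracle query. The algorithm does not know $\sigma$. -/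

import Mathlib

open scoped NNReal RealInnerProductSpace
open MeasureTheory

/-- Euclidean space of dimension `d`. -/
abbrev Euc (d : ℕ) : Type := EuclideanSpace ℝ (Fin d)

/-! ### Variational inequalities -/

/-- `F` is `σ`-hypomonotone on `X`. -/
def Hypomonotone {d : ℕ} (σ : ℝ) (F : Euc d → Euc d) (X : Set (Euc d)) : Prop :=
  ∀ x ∈ X, ∀ x' ∈ X, -σ * ‖x - x'‖ ^ 2 ≤ ⟪F x - F x', x - x'⟫

/-- `x` is an `ε`-approximate (Stampacchia) VI solution. -/
def IsVISol {d : ℕ} (F : Euc d → Euc d) (X : Set (Euc d)) (ε : ℝ) (x : Euc d) : Prop :=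
  x ∈ X ∧ ∀ x' ∈ X, -ε ≤ ⟪F x, x' - x⟫

/-- `x` is an `ε`-approximate Minty VI solution. -/
def IsMVISol {d : ℕ} (F : Euc d → Euc d) (X : Set (Euc d)) (ε : ℝ) (x : Euc d) : Prop :=
  x ∈ X ∧ ∀ x' ∈ X, -ε ≤ ⟪F x', x' - x⟫

/-- `μ` is an `ε`-EVI solution: a probability distribution on `X` whose expected regret against
every fixed point of `X` is at most `ε`. -/
structure IsEVISol {d : ℕ} (F : Euc d → Euc d) (X : Set (Euc d)) (ε : ℝ)
    (μ : Measure (Euc d)) : Prop where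
  prob : IsProbabilityMeasure μ
  supp : ∀ᵐ x ∂μ, x ∈ X
  integrable : ∀ x' ∈ X, Integrable (fun x => ⟪F x, x - x'⟫) μ
  le : ∀ x' ∈ X, ∫ x, ⟪F x, x - x'⟫ ∂μ ≤ ε

/-- The mean of a distribution. -/
noncomputable def distMean {d : ℕ} (μ : Measure (Euc d)) : Euc d := ∫ x, x ∂μ

/-! ### Oracle access

`sep` answers a query point either by `none` (the point belongs to the set) or by `some g`, where
`g` is a nonzero normal of a halfspace that contains the set and has the query point outside its
interior. -/

/-- `sep` is a separation oracle for `X`. -/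
def IsSeparationOracle {d : ℕ} (X : Set (Euc d)) (sep : Euc d → Option (Euc d)) : Prop :=
  ∀ x, (x ∈ X → sep x = none) ∧
    (x ∉ X → ∃ g, sep x = some g ∧ g ≠ 0 ∧ ∀ y ∈ X, ⟪g, y⟫ ≤ ⟪g, x⟫)

/-- What a program may query: a separation oracle of the domain and the values of the operator. -/
structure Oracles (d : ℕ) where
  sep : Euc d → Option (Euc d)
  map : Euc d → Euc d

/-! ### Oracle real RAM

A random access machine with exact real arithmetic (the real-number model). The memory has
cells for real numbers and, for counting and addressing, registers for natural numbers. On natural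
numbers only addition and subtraction are available, constants in programs are rational, and no
rounding of real numbers to integers is available. A program is a fixed finite text, independent
of the dimension and of all other data. -/

/-- The memory of the machine. -/
structure Store where
  nat : ℕ → ℕ
  real : ℕ → ℝ

/-- Address of a real cell: a fixed number, or the content of a register. -/
inductive Addr where
  | dir (n : ℕ)
  | ind (n : ℕ)

/-- The number of the real cell that an address denotes. -/
def Store.loc (s : Store) : Addr → ℕ
  | .dir n => n
  | .ind n => s.nat n

/-- The content of the real cell at an address. -/
def Store.val (s : Store) (a : Addr) : ℝ := s.real (s.loc a)

/-- Write a natural number into register `a`. -/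
def Store.setNat (s : Store) (a n : ℕ) : Store :=
  { s with nat := Function.update s.nat a n }

/-- Write a real number into the cell at address `a`. -/
def Store.setReal (s : Store) (a : Addr) (x : ℝ) : Store :=
  { s with real := Function.update s.real (s.loc a) x }

/-- The vector in the `d` consecutive cells that begin with cell number `p`. -/
def Store.readVec (s : Store) (d p : ℕ) : Euc d :=
  WithLp.toLp 2 (fun i : Fin d => s.real (p + i))

/-- Write a vector into the `d` consecutive cells that begin with cell number `p`. -/
def Store.writeVec (s : Store) {d : ℕ} (p : ℕ) (v : Euc d) : Store :=
  { s with real := fun q => if h : p ≤ q ∧ q < p + d then v ⟨q - p, by omega⟩ else s.real q }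

/-- Basic instructions; the first argument is the destination. -/
inductive Instr where
  | natConst (a n : ℕ)
  | natAdd (a b c : ℕ)
  | natSub (a b c : ℕ)
  | realConst (a : Addr) (q : ℚ)
  | realAdd (a b c : Addr)
  | realSub (a b c : Addr)
  | realMul (a b c : Addr)
  | realDiv (a b c : Addr)
  | realSqrt (a b : Addr)
  /-- Ask the separation oracle about the vector stored at `src`. If it belongs to the domain, set
  register `flag` to `1`; otherwise set it to `0` and store the separating normal at `dst`. -/
  | querySep (flag : ℕ) (dst src : Addr)
  /-- Evaluate the operator at the vector stored at `src` and store the value at `dst`. -/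
  | queryMap (dst src : Addr)

/-- Effect of a basic instruction. Subtraction of natural numbers is truncated; division by zero
and square roots of negative numbers give zero. -/
noncomputable def Instr.apply {d : ℕ} (O : Oracles d) (s : Store) : Instr → Store
  | .natConst a n => s.setNat a n
  | .natAdd a b c => s.setNat a (s.nat b + s.nat c)
  | .natSub a b c => s.setNat a (s.nat b - s.nat c)
  | .realConst a q => s.setReal a (q : ℝ)
  | .realAdd a b c => s.setReal a (s.val b + s.val c)
  | .realSub a b c => s.setReal a (s.val b - s.val c)
  | .realMul a b c => s.setReal a (s.val b * s.val c)
  | .realDiv a b c => s.setReal a (s.val b / s.val c)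
  | .realSqrt a b => s.setReal a (Real.sqrt (s.val b))
  | .querySep flag dst src =>
      match O.sep (s.readVec d (s.loc src)) with
      | none => s.setNat flag 1
      | some g => (s.writeVec (s.loc dst) g).setNat flag 0
  | .queryMap dst src => s.writeVec (s.loc dst) (O.map (s.readVec d (s.loc src)))

/-- Number of steps of a basic instruction: an oracle query in dimension `d` takes `d + 1` steps,
every other instruction takes one. -/
def Instr.cost (d : ℕ) : Instr → ℕ
  | .querySep _ _ _ => d + 1
  | .queryMap _ _ => d + 1
  | _ => 1

/-- Tests: exact comparison of two registers or of two real cells. -/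
inductive Test where
  | natLe (a b : ℕ)
  | realLe (a b : Addr)

/-- The truth value of a test. -/
def Test.holds (s : Store) : Test → Prop
  | .natLe a b => s.nat a ≤ s.nat b
  | .realLe a b => s.val a ≤ s.val b

/-- Programs. -/
inductive Prog where
  | skip
  | instr (i : Instr)
  | seq (p q : Prog)
  | ite (b : Test) (p q : Prog)
  | loop (b : Test) (p : Prog)

/-- `Exec O p s t s'`: with oracles `O`, program `p` started in memory `s` halts after exactly `t`
steps with memory `s'`. The program `loop b p` repeats `p` as long as `b` holds. -/
inductive Exec {d : ℕ} (O : Oracles d) : Prog → Store → ℕ → Store → Prop where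
  | skip (s : Store) : Exec O .skip s 1 s
  | instr (i : Instr) (s : Store) : Exec O (.instr i) s (i.cost d) (i.apply O s)
  | seq {p q : Prog} {s s₁ s₂ : Store} {m n : ℕ} :
      Exec O p s m s₁ → Exec O q s₁ n s₂ → Exec O (.seq p q) s (m + n) s₂
  | iteTrue {b : Test} {p q : Prog} {s s₁ : Store} {n : ℕ} :
      b.holds s → Exec O p s n s₁ → Exec O (.ite b p q) s (n + 1) s₁
  | iteFalse {b : Test} {p q : Prog} {s s₁ : Store} {n : ℕ} :
      ¬ b.holds s → Exec O q s n s₁ → Exec O (.ite b p q) s (n + 1) s₁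
  | loopTrue {b : Test} {p : Prog} {s s₁ s₂ : Store} {m n : ℕ} :
      b.holds s → Exec O p s m s₁ → Exec O (.loop b p) s₁ n s₂ →
        Exec O (.loop b p) s (m + n + 1) s₂
  | loopFalse {b : Test} {p : Prog} {s : Store} :
      ¬ b.holds s → Exec O (.loop b p) s 1 s

/-- The machine is deterministic: a program has at most one halting run from a given memory. -/
theorem Exec.deterministic {d : ℕ} {O : Oracles d} {p : Prog} {s s₁ s₂ : Store} {m n : ℕ}
    (h₁ : Exec O p s m s₁) (h₂ : Exec O p s n s₂) : m = n ∧ s₁ = s₂ := by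
  induction h₁ generalizing n s₂ with
  | skip s => cases h₂; exact ⟨rfl, rfl⟩
  | instr i s => cases h₂; exact ⟨rfl, rfl⟩
  | seq _ _ ih ih' =>
    cases h₂ with
    | seq k k' =>
      obtain ⟨rfl, rfl⟩ := ih k
      obtain ⟨rfl, rfl⟩ := ih' k'
      exact ⟨rfl, rfl⟩
  | iteTrue hb _ ih =>
    cases h₂ with
    | iteTrue _ k => obtain ⟨rfl, rfl⟩ := ih k; exact ⟨rfl, rfl⟩
    | iteFalse hn _ => exact absurd hb hn
  | iteFalse hb _ ih =>
    cases h₂ with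
    | iteTrue hn _ => exact absurd hn hb
    | iteFalse _ k => obtain ⟨rfl, rfl⟩ := ih k; exact ⟨rfl, rfl⟩
  | loopTrue hb _ _ ih ih' =>
    cases h₂ with
    | loopTrue _ k k' =>
      obtain ⟨rfl, rfl⟩ := ih k
      obtain ⟨rfl, rfl⟩ := ih' k'
      exact ⟨rfl, rfl⟩
    | loopFalse hn => exact absurd hb hn
  | loopFalse hb =>
    cases h₂ with
    | loopTrue hn _ _ => exact absurd hn hb
    | loopFalse _ => exact ⟨rfl, rfl⟩

/-- The initial memory: register `0` holds the dimension, real cells `0, 1, 2, 3` hold the accuracy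
`ε`, the inner radius `r`, the outer radius `R` and the Lipschitz constant `L`, and the next `d`
real cells hold the common centre `c` of the two balls; everything else is zero. -/
noncomputable def initialStore {d : ℕ} (ε r R L : ℝ) (c : Euc d) : Store where
  nat := fun n => if n = 0 then d else 0
  real := fun q =>
    if q = 0 then ε else if q = 1 then r else if q = 2 then R else if q = 3 then L
    else if h : 4 ≤ q ∧ q < 4 + d then c ⟨q - 4, by omega⟩ else 0

/-- The output vector, in the first `d` real cells. -/
def Store.output (s : Store) (d : ℕ) : Euc d := s.readVec d 0

/-! ### Expected, Minty and Stampacchia variational inequalities -/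

section VI

variable {d : ℕ} {X : Set (Euc d)} {F : Euc d → Euc d} {σ ε : ℝ} {L : ℝ≥0}

/-! Averaging. For fixed `w` and `y`, the function `x ↦ ⟪w, x - y⟫` is affine. If it lies below `⟪F
x, x - y⟫ + b` on `X`, then it is at most `ε + b` at the mean of an ε-EVI solution
(`IsEVISol.inner_distMean_le`). With `w = F y`, hypomonotonicity supplies `b = σD²`, which is the
Minty inequality. From Minty to Stampacchia, test the Minty inequality at a point at distance
fraction `t` on the way from `x` to `y`, divide by `t`, and return to `x` by the Lipschitz bound.
The error `η/t + LtD²` is balanced by the choice of `t`. If this `t` would exceed `1`, the averaging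
argument with `w = F (distMean μ)` takes over.

The algorithm is the ellipsoid method. It cuts with `F x` at query points in `X` and with a
separating normal elsewhere. As `F` is not monotone, the cuts localize no solution. What counts is
an accuracy certificate: nonnegative weights on the steps for which the weighted sum of `⟪g k, x k -
y⟫` is small for all `y` in the initial ball (`EllipsoidMethod.certificate`). On `X` the terms of
the outer query points are nonnegative. Dropping them leaves the regret of a finitely supported
distribution (`EllipsoidMethod.weights_solve`, `isEVISol_of_weights`).

The weights are Lagrange multipliers. Each ellipsoid contains the half of its predecessor that the
cut keeps. Dually, a bound for a functional on the new ellipsoid gives a bound for that functional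
minus a nonnegative multiple of the cut on the old one (`sqrt_inner_Q_sub_smul_le`). Carrying the
last cut, with opposite sign, back to the initial ball in this way yields the weights. The bound
obtained is the half-width of the last ellipsoid along the last cut, times the norm of that cut, so
the method stops once this half-width is small.

The number of steps is bounded by comparing determinant and trace of the inverse matrix: the
determinant grows by a fixed factor at every cut, while the trace stays controlled as long as the
ellipsoid is wide along the cuts (`iterations_le`).

The machine never stores a matrix. It records the vectors of all cuts and replays them to apply the
matrix, so the running time is quadratic in the number of steps and linear in `d`. -/

theorem IsCompact.norm_sub_le_diam (hX : IsCompact X) {x y : Euc d} (hx : x ∈ X) (hy : y ∈ X) :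
    ‖x - y‖ ≤ Metric.diam X := by
  rw [← dist_eq_norm]
  exact Metric.dist_le_diam_of_mem hX.isBounded hx hy

theorem integrable_id_of_ae_mem (hX : IsCompact X) {μ : Measure (Euc d)} [IsProbabilityMeasure μ]
    (h : ∀ᵐ x ∂μ, x ∈ X) : Integrable (fun x : Euc d => x) μ := by
  obtain ⟨C, hC⟩ := hX.isBounded.exists_norm_le
  exact Integrable.of_bound aestronglyMeasurable_id C (h.mono fun x hx => hC x hx)

theorem IsEVISol.distMean_mem (hc : Convex ℝ X) (hX : IsCompact X) {μ : Measure (Euc d)}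
    (hμ : IsEVISol F X ε μ) : distMean μ ∈ X := by
  have := hμ.prob
  exact hc.integral_mem hX.isClosed hμ.supp (integrable_id_of_ae_mem hX hμ.supp)

/-- An affine lower bound on the regret of an EVI solution passes to its mean. -/
theorem IsEVISol.inner_distMean_le (hX : IsCompact X) {μ : Measure (Euc d)}
    (hμ : IsEVISol F X ε μ) {y : Euc d} (hy : y ∈ X) (w : Euc d) (b : ℝ)
    (h : ∀ x ∈ X, ⟪w, x - y⟫ ≤ ⟪F x, x - y⟫ + b) : ⟪w, distMean μ - y⟫ ≤ ε + b := by
  have := hμ.prob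
  have hid := integrable_id_of_ae_mem hX hμ.supp
  have hsub : Integrable (fun x : Euc d => x - y) μ := hid.sub (integrable_const y)
  have h1 : ⟪w, distMean μ - y⟫ = ∫ x, ⟪w, x - y⟫ ∂μ := by
    rw [integral_inner hsub, integral_sub hid (integrable_const y)]
    simp [distMean]
  rw [h1]
  calc ∫ x, ⟪w, x - y⟫ ∂μ ≤ ∫ x, (⟪F x, x - y⟫ + b) ∂μ :=
        integral_mono_ae (hsub.const_inner w) ((hμ.integrable y hy).add (integrable_const b))
          (hμ.supp.mono fun x hx => h x hx)
    _ = ∫ x, ⟪F x, x - y⟫ ∂μ + b := by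
        rw [integral_add (hμ.integrable y hy) (integrable_const b)]; simp
    _ ≤ ε + b := by linarith [hμ.le y hy]

/-- Hypomonotonicity allows `F x` to be replaced by `F y` in the regret at a cost of at most `σD²`.
The result is affine in `x` and can be averaged. -/
theorem IsEVISol.isMVISol_distMean (hc : Convex ℝ X) (hX : IsCompact X) (hσ : 0 ≤ σ)
    (hF : Hypomonotone σ F X) {μ : Measure (Euc d)} (hμ : IsEVISol F X ε μ) :
    IsMVISol F X (ε + σ * Metric.diam X ^ 2) (distMean μ) := by
  refine ⟨hμ.distMean_mem hc hX, fun y hy => ?_⟩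
  have := hμ.inner_distMean_le hX hy (F y) (σ * Metric.diam X ^ 2) fun x hx => by
    have h1 := hF x hx y hy
    have h2 : σ * ‖x - y‖ ^ 2 ≤ σ * Metric.diam X ^ 2 := by
      gcongr; exact hX.norm_sub_le_diam hx hy
    rw [inner_sub_left] at h1
    linarith
  rw [← neg_sub (distMean μ) y, inner_neg_right]
  linarith

theorem LipschitzOnWith.abs_inner_sub_le (hF : LipschitzOnWith L F X)
    {x y : Euc d} (hx : x ∈ X) (hy : y ∈ X) (z : Euc d) :
    |⟪F x - F y, z⟫| ≤ L * ‖x - y‖ * ‖z‖ := by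
  refine (abs_real_inner_le_norm _ _).trans ?_
  gcongr
  simpa [dist_eq_norm] using hF.dist_le_mul x hx y hy

/-- Minty's inequality at `x + t(y - x)`, divided by `t`, loses `η/t`. Moving the argument of `F`
back to `x` loses at most `LtD²`. -/
theorem IsMVISol.isVISol (hc : Convex ℝ X) (hX : IsCompact X) (hF : LipschitzOnWith L F X)
    {η : ℝ} (hη : 0 < η) (hle : η ≤ L * Metric.diam X ^ 2) {x : Euc d} (hx : IsMVISol F X η x) :
    IsVISol F X (2 * Metric.diam X * Real.sqrt (L * η)) x := by
  refine ⟨hx.1, fun y hy => ?_⟩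
  set D := Metric.diam X
  have hD0 : 0 ≤ D := Metric.diam_nonneg
  have hpos : 0 < (L : ℝ) * D ^ 2 := hη.trans_le hle
  have hD : 0 < D := lt_of_le_of_ne hD0 fun h => by simp [← h] at hpos
  have hL : 0 < (L : ℝ) := lt_of_le_of_ne L.2 fun h => by
    have h' : (L : ℝ) = 0 := h.symm
    simp [h'] at hpos
  set w := Real.sqrt (L * η) with hw
  have hw2 : w ^ 2 = L * η := Real.sq_sqrt (by positivity)
  have hw0 : 0 < w := Real.sqrt_pos.2 (by positivity)
  -- This `t` makes both losses `η/t` and `LtD²` equal to `D√(Lη)`. It is at most `1` exactly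
  -- because `η ≤ LD²`.
  set t := w / (L * D) with ht
  have ht0 : 0 < t := by positivity
  have ht1 : t ≤ 1 := by
    rw [ht, div_le_one (by positivity)]
    refine (abs_le_of_sq_le_sq' ?_ (by positivity)).2
    rw [hw2]; nlinarith
  have hz : x + t • (y - x) ∈ X := hc.add_smul_sub_mem hx.1 hy ⟨ht0.le, ht1⟩
  have h1 := hx.2 _ hz
  have h2 := (abs_le.1 (hF.abs_inner_sub_le hz hx.1 (y - x))).2
  have hxy : ‖y - x‖ ≤ D := hX.norm_sub_le_diam hy hx.1
  rw [add_sub_cancel_left, inner_smul_right] at h1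
  rw [add_sub_cancel_left, norm_smul, Real.norm_of_nonneg ht0.le, inner_sub_left] at h2
  have h3 : L * (t * ‖y - x‖) * ‖y - x‖ ≤ L * (t * D) * D := by gcongr
  have h4 : L * (t * D) * D = D * w := by rw [ht]; field_simp
  have h5 : t * (D * w) = η := by
    rw [ht]; field_simp; rw [hw2]
  have h6 : -(D * w) ≤ ⟪F (x + t • (y - x)), y - x⟫ := by
    by_contra hcon
    push Not at hcon
    have := mul_lt_mul_of_pos_left hcon ht0
    linarith
  linarith

/-- For `ε + σD² ≤ LD²` the passage through Minty applies. Otherwise the bound claimed is at least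
`2LD²`. Replacing `F x` by `F (distMean μ)` in the regret costs only `LD²`, and `ε ≤ LD²` covers the
rest. -/
theorem IsEVISol.isVISol_distMean (hc : Convex ℝ X) (hX : IsCompact X)
    (hL : LipschitzOnWith L F X) (hσ : 0 ≤ σ) (hF : Hypomonotone σ F X) (hε : 0 < ε)
    (hle : ε ≤ L * Metric.diam X ^ 2) {μ : Measure (Euc d)} (hμ : IsEVISol F X ε μ) :
    IsVISol F X (2 * Metric.diam X * Real.sqrt (L * (ε + σ * Metric.diam X ^ 2)))
      (distMean μ) := by
  have hM := hμ.isMVISol_distMean hc hX hσ hF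
  rcases le_total (ε + σ * Metric.diam X ^ 2) (L * Metric.diam X ^ 2) with h | h
  · exact hM.isVISol hc hX hL (by positivity) h
  refine ⟨hM.1, fun y hy => ?_⟩
  have h1 := hμ.inner_distMean_le hX hy (F (distMean μ)) (L * Metric.diam X ^ 2) fun x hx => by
    have h2 := (abs_le.1 (hL.abs_inner_sub_le hM.1 hx (x - y))).2
    have h3 : L * ‖distMean μ - x‖ * ‖x - y‖ ≤ L * Metric.diam X * Metric.diam X := by
      have := hX.norm_sub_le_diam hM.1 hx
      have := hX.norm_sub_le_diam hx hy
      gcongr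
    rw [inner_sub_left] at h2
    linarith
  have h4 : L * Metric.diam X ≤ Real.sqrt (L * (ε + σ * Metric.diam X ^ 2)) := by
    apply Real.le_sqrt_of_sq_le
    have := mul_le_mul_of_nonneg_left h L.2
    simp only [NNReal.val_eq_coe] at this
    linarith
  have h5 := mul_le_mul_of_nonneg_left h4 (Metric.diam_nonneg (s := X))
  rw [← neg_sub (distMean μ) y, inner_neg_right]
  linarith

/-- A finitely supported distribution with nonnegative weights is an EVI solution as soon as its
weighted regret is small. -/
theorem isEVISol_of_weights {ι : Type*} (s : Finset ι) (w : ι → ℝ) (x : ι → Euc d)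
    (hw : ∀ i ∈ s, 0 ≤ w i) (hpos : 0 < ∑ i ∈ s, w i) (hx : ∀ i ∈ s, w i ≠ 0 → x i ∈ X)
    (h : ∀ y ∈ X, ∑ i ∈ s, w i * ⟪F (x i), x i - y⟫ ≤ ε * ∑ i ∈ s, w i) :
    ∃ μ : Measure (Euc d), IsEVISol F X ε μ ∧
      distMean μ = (∑ i ∈ s, w i)⁻¹ • ∑ i ∈ s, w i • x i := by
  set W := ∑ i ∈ s, w i
  let μ : Measure (Euc d) := ∑ i ∈ s, ENNReal.ofReal (w i / W) • Measure.dirac (x i)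
  have hint : ∀ {E : Type} [NormedAddCommGroup E] (f : Euc d → E), ∀ i ∈ s,
      Integrable f (ENNReal.ofReal (w i / W) • Measure.dirac (x i)) := fun f i _ =>
    (integrable_dirac (by simp)).smul_measure (by simp)
  have hval : ∀ {E : Type} [NormedAddCommGroup E] [NormedSpace ℝ E] [CompleteSpace E]
      (f : Euc d → E), ∫ z, f z ∂μ = ∑ i ∈ s, (w i / W) • f (x i) := fun f => by
    rw [integral_finsetSum_measure (hint f)]
    refine Finset.sum_congr rfl fun i hi => ?_
    rw [integral_smul_measure, integral_dirac,
      ENNReal.toReal_ofReal (div_nonneg (hw i hi) hpos.le)]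
  refine ⟨μ, ⟨⟨?_⟩, ?_, fun y _ => ?_, fun y hy => ?_⟩, ?_⟩
  · simp only [μ, Measure.coe_finsetSum, Finset.sum_apply, Measure.smul_apply, measure_univ,
      smul_eq_mul, mul_one]
    rw [← ENNReal.ofReal_sum_of_nonneg fun i hi => div_nonneg (hw i hi) hpos.le,
      ← Finset.sum_div, div_self hpos.ne', ENNReal.ofReal_one]
  · rw [ae_iff]
    simp only [μ, Measure.coe_finsetSum, Finset.sum_apply, Measure.smul_apply, smul_eq_mul]
    refine Finset.sum_eq_zero fun i hi => ?_
    -- An atom of weight zero may lie outside `X`, as the rejected query points of the algorithm do.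
    by_cases h0 : w i = 0
    · simp [h0]
    · rw [Measure.dirac_apply]
      simp [hx i hi h0]
  · exact integrable_finsetSum_measure.2 (hint _)
  · rw [hval]
    have : ∑ i ∈ s, (w i / W) • ⟪F (x i), x i - y⟫
        = W⁻¹ * ∑ i ∈ s, w i * ⟪F (x i), x i - y⟫ := by
      rw [Finset.mul_sum]
      exact Finset.sum_congr rfl fun i _ => by rw [smul_eq_mul]; ring
    rw [this, inv_mul_le_iff₀ hpos, mul_comm W]
    exact h y hy
  · rw [distMean, hval, Finset.smul_sum]
    exact Finset.sum_congr rfl fun i _ => by rw [smul_smul, div_eq_inv_mul]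

end VI

/-! ### The ellipsoid method with accuracy certificates -/

/-- Data of the ellipsoid method: the cutting direction as a function of the query point, and the
initial ball. -/
structure EllipsoidMethod (d : ℕ) where
  cut : Euc d → Euc d
  ctr : Euc d
  rad : ℝ

namespace EllipsoidMethod

variable {d : ℕ}

/-- Factor by which the squared semi-axes orthogonal to a cut grow. -/
noncomputable def growth (d : ℕ) : ℝ := 4 * d * d / (4 * d * d - 1)

/-- Relative displacement of the centre. -/
noncomputable def shift (d : ℕ) : ℝ := 1 / (2 * d + 1)

/-- The centre and the (rescaled) matrix of the current ellipsoid. -/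
noncomputable def state (E : EllipsoidMethod d) : ℕ → Euc d × (Euc d →L[ℝ] Euc d)
  | 0 => (E.ctr, (E.rad * E.rad) • ContinuousLinearMap.id ℝ (Euc d))
  | t + 1 =>
    let x := (E.state t).1
    let Q := (E.state t).2
    let v := Q (E.cut x)
    let ν := ⟪E.cut x, v⟫
    (x - (shift d * √(growth d ^ t / ν)) • v, Q - (2 * shift d / ν) • (innerSL ℝ v).smulRight v)

/-- The ellipsoid of step `t` has centre `x t` and matrix `growth d ^ t • Q t`, so the half-width of
its projection on `h` is `√(growth d ^ t * ⟪h, Q t h⟫)` up to the factor `‖h‖`. With the scalar kept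
apart, each cut is a rank-one correction of `Q`, and records of old cuts never need rescaling. -/
noncomputable def x (E : EllipsoidMethod d) (t : ℕ) : Euc d := (E.state t).1
noncomputable def Q (E : EllipsoidMethod d) (t : ℕ) : Euc d →L[ℝ] Euc d := (E.state t).2
noncomputable def g (E : EllipsoidMethod d) (t : ℕ) : Euc d := E.cut (E.x t)
noncomputable def v (E : EllipsoidMethod d) (t : ℕ) : Euc d := E.Q t (E.g t)
noncomputable def ν (E : EllipsoidMethod d) (t : ℕ) : ℝ := ⟪E.g t, E.v t⟫

theorem x_zero (E : EllipsoidMethod d) : E.x 0 = E.ctr := rfl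

theorem x_succ (E : EllipsoidMethod d) (t : ℕ) :
    E.x (t + 1) = E.x t - (shift d * √(growth d ^ t / E.ν t)) • E.v t := rfl

theorem Q_zero (E : EllipsoidMethod d) (h : Euc d) : E.Q 0 h = (E.rad * E.rad) • h := rfl

theorem Q_succ (E : EllipsoidMethod d) (t : ℕ) (h : Euc d) :
    E.Q (t + 1) h = E.Q t h - (2 * shift d * ⟪E.v t, h⟫ / E.ν t) • E.v t := by
  have : E.Q (t + 1) h = E.Q t h - (2 * shift d / E.ν t) • (⟪E.v t, h⟫ • E.v t) := rfl
  rw [this, smul_smul]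
  congr 2
  ring

theorem inner_Q_comm (E : EllipsoidMethod d) (t : ℕ) (h k : Euc d) :
    ⟪E.Q t h, k⟫ = ⟪h, E.Q t k⟫ := by
  induction t with
  | zero => simp [Q_zero, inner_smul_left, inner_smul_right]
  | succ t ih =>
    simp only [Q_succ, inner_sub_left, inner_sub_right, inner_smul_left, inner_smul_right, ih,
      conj_trivial, real_inner_comm (E.v t) h]
    ring

theorem inner_Q_succ (E : EllipsoidMethod d) (t : ℕ) (h : Euc d) :
    ⟪h, E.Q (t + 1) h⟫ = ⟪h, E.Q t h⟫ - 2 * shift d * ⟪h, E.v t⟫ ^ 2 / E.ν t := by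
  rw [Q_succ, inner_sub_right, inner_smul_right, real_inner_comm h (E.v t)]
  ring

theorem inner_Q_g (E : EllipsoidMethod d) (t : ℕ) (h : Euc d) :
    ⟪E.g t, E.Q t h⟫ = ⟪h, E.v t⟫ := by
  rw [← inner_Q_comm, real_inner_comm]; rfl

theorem inner_Q_sub_smul (E : EllipsoidMethod d) (t : ℕ) (h : Euc d) (l : ℝ) :
    ⟪h - l • E.g t, E.Q t (h - l • E.g t)⟫
      = ⟪h, E.Q t h⟫ - 2 * l * ⟪h, E.v t⟫ + l ^ 2 * E.ν t := by
  rw [map_sub, map_smul, inner_sub_left, inner_sub_right, inner_sub_right, inner_smul_left,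
    inner_smul_left, inner_smul_right, inner_smul_right, inner_Q_g]
  change _ - l * ⟪h, E.v t⟫ - (l * _ - l * (l * E.ν t)) = _
  ring

theorem shift_pos (d : ℕ) : 0 < shift d := by unfold shift; positivity

theorem shift_le (hd : 1 ≤ d) : shift d ≤ 1 / 3 := by
  have : (1 : ℝ) ≤ d := by exact_mod_cast hd
  unfold shift
  gcongr
  linarith

theorem growth_ge_one (hd : 1 ≤ d) : 1 ≤ growth d := by
  have : (1 : ℝ) ≤ d := by exact_mod_cast hd
  unfold growth
  rw [one_le_div (by nlinarith)]
  linarith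

theorem inner_Q_nonneg_of_pos (E : EllipsoidMethod d) (t : ℕ)
    (hpos : ∀ h : Euc d, h ≠ 0 → 0 < ⟪h, E.Q t h⟫) (h : Euc d) : 0 ≤ ⟪h, E.Q t h⟫ := by
  by_cases h0 : h = 0
  · simp [h0]
  · exact (hpos h h0).le

/-- Cauchy–Schwarz for the form of `Q t`, obtained by evaluating the form at the component of `h`
that is conjugate to `g t`. -/
theorem inner_v_sq_le (E : EllipsoidMethod d) (t : ℕ)
    (hpos : ∀ h : Euc d, h ≠ 0 → 0 < ⟪h, E.Q t h⟫) (hν : 0 < E.ν t) (h : Euc d) :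
    ⟪h, E.v t⟫ ^ 2 / E.ν t ≤ ⟪h, E.Q t h⟫ := by
  have h1 := E.inner_Q_nonneg_of_pos t hpos (h - (⟪h, E.v t⟫ / E.ν t) • E.g t)
  rw [inner_Q_sub_smul] at h1
  have h2 : ⟪h, E.Q t h⟫ - 2 * (⟪h, E.v t⟫ / E.ν t) * ⟪h, E.v t⟫
      + (⟪h, E.v t⟫ / E.ν t) ^ 2 * E.ν t = ⟪h, E.Q t h⟫ - ⟪h, E.v t⟫ ^ 2 / E.ν t := by
    field_simp; ring
  linarith

/-- The matrices stay positive definite. -/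
theorem inner_Q_pos (E : EllipsoidMethod d) (hR : 0 < E.rad) (hd : 1 ≤ d) (t : ℕ)
    (hν : ∀ s < t, 0 < E.ν s) : ∀ h : Euc d, h ≠ 0 → 0 < ⟪h, E.Q t h⟫ := by
  induction t with
  | zero =>
    intro h h0
    rw [Q_zero, inner_smul_right, real_inner_self_eq_norm_sq]
    have := norm_pos_iff.2 h0
    positivity
  | succ t ih =>
    intro h h0
    have ih' := ih fun s hs => hν s (by omega)
    -- By Cauchy–Schwarz a cut removes at most the share `2 * shift d ≤ 2/3` of the quadratic form.
    have h1 := E.inner_v_sq_le t ih' (hν t (by omega)) h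
    have h2 := ih' h h0
    have h3 : 0 ≤ ⟪h, E.v t⟫ ^ 2 / E.ν t := div_nonneg (sq_nonneg _) (hν t (by omega)).le
    rw [inner_Q_succ, mul_div_assoc]
    have := shift_le hd
    have := shift_pos d
    nlinarith

/-- The criterion for the end of the cutting phase. -/
def Stops (E : EllipsoidMethod d) (ρ : ℝ) (t : ℕ) : Prop :=
  growth d ^ t * E.ν t ≤ ρ * ρ * ⟪E.g t, E.g t⟫

/-- The criterion says that the half-width along the cut is at most `ρ`. It also holds when the cut
is zero, so no division by a vanishing `ν` occurs before the end. -/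
theorem ν_pos_of_not_stops (E : EllipsoidMethod d) (hd : 1 ≤ d) {ρ : ℝ} {t : ℕ}
    (h : ¬ E.Stops ρ t) : 0 < E.ν t := by
  unfold Stops at h
  push Not at h
  have h1 : 0 ≤ ρ * ρ * ⟪E.g t, E.g t⟫ := mul_nonneg (mul_self_nonneg _) real_inner_self_nonneg
  exact pos_of_mul_pos_right (h1.trans_lt h)
    (pow_nonneg (zero_le_one.trans (growth_ge_one hd)) _)

/-! #### The certificate -/

/-- The elementary inequality behind the certificate: `s` is the normalized component of a
functional along the cut, `P` its squared norm. -/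
theorem sqrt_add_shift_mul_le (hd : 1 ≤ d) {P s : ℝ} (hP : s ^ 2 ≤ P) :
    √(P - max s 0 ^ 2) + shift d * s ≤ √(growth d * (P - 2 * shift d * s ^ 2)) := by
  have hd' : (1 : ℝ) ≤ d := by exact_mod_cast hd
  -- The parameters are those of the central-cut update in dimension `N = 2d` instead of `d`. Thus
  -- `N² - 1` is positive even for `d = 1`, and no separate bisection rule is needed.
  obtain ⟨N, hN⟩ : ∃ N : ℝ, N = 2 * d := ⟨_, rfl⟩
  have hN2 : 2 ≤ N := by linarith
  have e1 : shift d = 1 / (N + 1) := by rw [hN]; rfl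
  have e2 : growth d = N ^ 2 / (N ^ 2 - 1) := by rw [hN, growth]; ring
  have hN1 : 0 < N ^ 2 - 1 := by nlinarith
  rw [e1, e2]
  rcases le_total 0 s with hs | hs
  · rw [max_eq_left hs]
    apply Real.le_sqrt_of_sq_le
    have hp := Real.sq_sqrt (sub_nonneg.2 hP)
    set p := √(P - s ^ 2)
    have hPp : P = p ^ 2 + s ^ 2 := by linarith
    rw [hPp]
    -- The difference of the squares of the two sides is itself a square over a positive number.
    have : N ^ 2 / (N ^ 2 - 1) * (p ^ 2 + s ^ 2 - 2 * (1 / (N + 1)) * s ^ 2)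
        - (p + 1 / (N + 1) * s) ^ 2 = (p - s * (N - 1)) ^ 2 / (N ^ 2 - 1) := by
      have : N + 1 ≠ 0 := by linarith
      field_simp
      ring
    have : 0 ≤ (p - s * (N - 1)) ^ 2 / (N ^ 2 - 1) := by positivity
    linarith
  · rw [max_eq_right hs]
    have hz := Real.sq_sqrt ((sq_nonneg s).trans hP)
    have hz0 := Real.sqrt_nonneg P
    rw [zero_pow two_ne_zero, sub_zero]
    set z := √P
    -- For `s ≤ 0` the multiplier is zero. The difference of squares factors, and `s² ≤ P` makes
    -- both factors nonnegative.
    have hzs : -s ≤ z := (abs_le_of_sq_le_sq' (by rw [hz, neg_sq]; exact hP) hz0).2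
    apply Real.le_sqrt_of_sq_le
    rw [← hz]
    have : N ^ 2 / (N ^ 2 - 1) * (z ^ 2 - 2 * (1 / (N + 1)) * s ^ 2) - (z + 1 / (N + 1) * s) ^ 2
        = (z + s) * (z + (2 * N - 1) * -s) / (N ^ 2 - 1) := by
      have : N + 1 ≠ 0 := by linarith
      field_simp
      ring
    have : 0 ≤ (z + s) * (z + (2 * N - 1) * -s) / (N ^ 2 - 1) := by
      apply div_nonneg _ hN1.le
      apply mul_nonneg (by linarith)
      apply add_nonneg hz0
      apply mul_nonneg <;> linarith
    linarith

/-- One backward step: how the bound of a functional changes when the cut is undone. -/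
theorem sqrt_inner_Q_sub_smul_le (E : EllipsoidMethod d) (hd : 1 ≤ d) (t : ℕ)
    (hpos : ∀ h : Euc d, h ≠ 0 → 0 < ⟪h, E.Q t h⟫) (hν : 0 < E.ν t) (h : Euc d) {l : ℝ}
    (hl : l = max ⟪h, E.v t⟫ 0 / E.ν t) :
    √(growth d ^ t * ⟪h - l • E.g t, E.Q t (h - l • E.g t)⟫) + ⟪h, E.x t - E.x (t + 1)⟫
      ≤ √(growth d ^ (t + 1) * ⟪h, E.Q (t + 1) h⟫) := by
  have hA : 0 < growth d ^ t := pow_pos (zero_lt_one.trans_le (growth_ge_one hd)) t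
  set a := growth d ^ t with ha
  set b := ⟪h, E.v t⟫ with hb
  have hs2 : √(a / E.ν t) ^ 2 = a / E.ν t := Real.sq_sqrt (by positivity)
  have hsb : (√(a / E.ν t) * b) ^ 2 = a * (b ^ 2 / E.ν t) := by rw [mul_pow, hs2]; ring
  have hP : (√(a / E.ν t) * b) ^ 2 ≤ a * ⟪h, E.Q t h⟫ := by
    rw [hsb]
    exact mul_le_mul_of_nonneg_left (E.inner_v_sq_le t hpos hν h) hA.le
  have key := sqrt_add_shift_mul_le hd hP
  have hmax : max (√(a / E.ν t) * b) 0 ^ 2 = a * (max b 0 ^ 2 / E.ν t) := by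
    have : max (√(a / E.ν t) * b) 0 = √(a / E.ν t) * max b 0 := by
      rw [mul_max_of_nonneg _ _ (Real.sqrt_nonneg _), mul_zero]
    rw [this, mul_pow, hs2]; ring
  -- The multiplier `l` minimizes the form of `h - l • g` over `l ≥ 0`: it is the free minimizer,
  -- clipped at zero.
  have e1 : ⟪h - l • E.g t, E.Q t (h - l • E.g t)⟫
      = ⟪h, E.Q t h⟫ - max b 0 ^ 2 / E.ν t := by
    rw [inner_Q_sub_smul, ← hb, hl]
    rcases le_total b 0 with h0 | h0
    · simp [max_eq_right h0]
    · rw [max_eq_left h0]; field_simp; ring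
  have e2 : ⟪h, E.x t - E.x (t + 1)⟫ = shift d * (√(a / E.ν t) * b) := by
    rw [x_succ, sub_sub_cancel, inner_smul_right, mul_assoc]
  rw [e1, e2, inner_Q_succ, ← hb, (pow_succ _ _ : growth d ^ (t + 1) = a * growth d)]
  rw [hmax, hsb] at key
  calc _ = √(a * ⟪h, E.Q t h⟫ - a * (max b 0 ^ 2 / E.ν t)) + shift d * (√(a / E.ν t) * b) := by
        rw [mul_sub]
    _ ≤ _ := key
    _ = _ := by congr 1; ring

/-- The functional carried by the backward phase that starts at step `t`, after `i` steps. -/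
noncomputable def dual (E : EllipsoidMethod d) (t : ℕ) : ℕ → Euc d
  | 0 => -E.g t
  | i + 1 => E.dual t i
      - (max ⟪E.dual t i, E.v (t - (i + 1))⟫ 0 / E.ν (t - (i + 1))) • E.g (t - (i + 1))

/-- The weight that the certificate of step `t` gives to step `t - i`. -/
noncomputable def weight (E : EllipsoidMethod d) (t : ℕ) : ℕ → ℝ
  | 0 => 1
  | i + 1 => max ⟪E.dual t i, E.v (t - (i + 1))⟫ 0 / E.ν (t - (i + 1))

theorem weight_zero (E : EllipsoidMethod d) (t : ℕ) : E.weight t 0 = 1 := rfl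

theorem weight_succ (E : EllipsoidMethod d) (t i : ℕ) : E.weight t (i + 1)
    = max ⟪E.dual t i, E.v (t - (i + 1))⟫ 0 / E.ν (t - (i + 1)) := rfl

theorem dual_zero (E : EllipsoidMethod d) (t : ℕ) : E.dual t 0 = -E.g t := rfl

theorem dual_succ (E : EllipsoidMethod d) (t i : ℕ) :
    E.dual t (i + 1) = E.dual t i - E.weight t (i + 1) • E.g (t - (i + 1)) := rfl

theorem weight_nonneg (E : EllipsoidMethod d) {t : ℕ} (hν : ∀ s < t, 0 < E.ν s) {i : ℕ}
    (hi : i ≤ t) : 0 ≤ E.weight t i := by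
  cases i with
  | zero => exact zero_le_one
  | succ i => exact div_nonneg (le_max_right _ _) (hν _ (by omega)).le

/-- The left side does not increase from `i` to `i + 1`. Subtracting a multiple of the cut from the
functional moves this multiple into the sum, and the backward step pays for the change of centre and
matrix. At `i = 0` equality holds. -/
theorem certificate_aux (E : EllipsoidMethod d) (hd : 1 ≤ d) (hR : 0 < E.rad) {t : ℕ}
    (hν : ∀ s < t, 0 < E.ν s) (y : Euc d) (i : ℕ) (hi : i ≤ t) :
    ∑ k ∈ Finset.range (i + 1), E.weight t k * ⟪E.g (t - k), E.x (t - k) - y⟫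
      - ⟪E.dual t i, y - E.x (t - i)⟫
      + √(growth d ^ (t - i) * ⟪E.dual t i, E.Q (t - i) (E.dual t i)⟫)
      ≤ √(growth d ^ t * E.ν t) := by
  induction i with
  | zero =>
    have : ⟪E.g t, E.x t - y⟫ = - ⟪E.g t, y - E.x t⟫ := by
      rw [← inner_neg_right, neg_sub]
    simp [weight_zero, dual_zero, this, ν, v]
  | succ i ih =>
    have ih' := ih (by omega)
    obtain ⟨s, hs⟩ : ∃ s, t = s + (i + 1) := ⟨t - (i + 1), by omega⟩
    have e1 : t - (i + 1) = s := by omega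
    have e2 : t - i = s + 1 := by omega
    have key := E.sqrt_inner_Q_sub_smul_le hd s (E.inner_Q_pos hR hd s fun j hj => hν j (by omega))
      (hν s (by omega)) (E.dual t i) (by rw [E.weight_succ, e1] : E.weight t (i + 1) = _)
    rw [Finset.sum_range_succ, dual_succ, e1]
    rw [e2] at ih'
    have e3 : ⟪E.dual t i - E.weight t (i + 1) • E.g s, y - E.x s⟫
        = ⟪E.dual t i, y - E.x (s + 1)⟫ - ⟪E.dual t i, E.x s - E.x (s + 1)⟫
          + E.weight t (i + 1) * ⟪E.g s, E.x s - y⟫ := by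
      rw [inner_sub_left, inner_smul_left, ← inner_sub_right, ← neg_sub y (E.x s),
        inner_neg_right]
      simp
      ring
    linarith

/-- The accuracy certificate: the weighted sum of all cuts is small on the whole initial ball. -/
theorem certificate (E : EllipsoidMethod d) (hd : 1 ≤ d) (hR : 0 < E.rad) {t : ℕ}
    (hν : ∀ s < t, 0 < E.ν s) {y : Euc d} (hy : ‖y - E.ctr‖ ≤ E.rad) :
    ∑ k ∈ Finset.range (t + 1), E.weight t k * ⟪E.g (t - k), E.x (t - k) - y⟫
      ≤ √(growth d ^ t * E.ν t) := by
  have h := E.certificate_aux hd hR hν y t le_rfl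
  rw [Nat.sub_self, pow_zero, one_mul, Q_zero, inner_smul_right, real_inner_self_eq_norm_sq,
    x_zero] at h
  -- The first ellipsoid is a ball. The remaining square root is the maximum of the last functional
  -- on it, so it absorbs the linear term.
  have h1 : √(E.rad * E.rad * ‖E.dual t t‖ ^ 2) = E.rad * ‖E.dual t t‖ := by
    rw [← pow_two, ← mul_pow, Real.sqrt_sq (by positivity)]
  have h2 : ⟪E.dual t t, y - E.ctr⟫ ≤ ‖E.dual t t‖ * ‖y - E.ctr‖ := real_inner_le_norm _ _
  have h3 : ‖E.dual t t‖ * ‖y - E.ctr‖ ≤ ‖E.dual t t‖ * E.rad := by gcongr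
  linarith

end EllipsoidMethod

/-- Every eigenvalue is at most the trace. The factor lost against the inequality of the means only
enters a logarithm. -/
theorem Matrix.PosSemidef.det_le_trace_pow {n : Type*} [Fintype n] [DecidableEq n]
    {A : Matrix n n ℝ} (hA : A.PosSemidef) : A.det ≤ A.trace ^ Fintype.card n := by
  rw [hA.isHermitian.det_eq_prod_eigenvalues, hA.isHermitian.trace_eq_sum_eigenvalues]
  simp only [RCLike.ofReal_real_eq_id, id]
  calc ∏ i, hA.isHermitian.eigenvalues i
      ≤ ∏ _i : n, ∑ j, hA.isHermitian.eigenvalues j :=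
        Finset.prod_le_prod (fun i _ => hA.eigenvalues_nonneg i) fun i _ =>
          Finset.single_le_sum (f := fun j => hA.isHermitian.eigenvalues j)
            (fun j _ => hA.eigenvalues_nonneg j) (Finset.mem_univ i)
    _ = _ := by simp

namespace EllipsoidMethod

variable {d : ℕ}

/-! #### The number of iterations -/

/-- The inverse of the matrix of the current ellipsoid. -/
noncomputable def invMatrix (E : EllipsoidMethod d) : ℕ → Matrix (Fin d) (Fin d) ℝ
  | 0 => (E.rad * E.rad)⁻¹ • (1 : Matrix (Fin d) (Fin d) ℝ)
  | t + 1 => E.invMatrix t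
      + (2 / (2 * d - 1) / E.ν t) • Matrix.vecMulVec (E.g t).ofLp (E.g t).ofLp

theorem dotProduct_ofLp (h k : Euc d) : h.ofLp ⬝ᵥ k.ofLp = ⟪h, k⟫ := by
  rw [PiLp.inner_apply, dotProduct]
  exact Finset.sum_congr rfl fun i _ => by simp [mul_comm]

/-- Sherman–Morrison: removing the share `a = 2 * shift d` adds the multiple `a / (1 - a) = 2 / (2d
- 1)` of `g gᵀ / ν` to the inverse. -/
theorem invMatrix_mulVec (E : EllipsoidMethod d) (hd : 1 ≤ d) (hR : 0 < E.rad) {t : ℕ}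
    (hν : ∀ s < t, 0 < E.ν s) (h : Euc d) :
    (E.invMatrix t).mulVec (E.Q t h).ofLp = h.ofLp := by
  have hd' : (1 : ℝ) ≤ d := by exact_mod_cast hd
  induction t generalizing h with
  | zero =>
    simp only [invMatrix, Q_zero, Matrix.smul_mulVec, Matrix.one_mulVec, WithLp.ofLp_smul]
    rw [smul_smul, inv_mul_cancel₀ (by positivity), one_smul]
  | succ t ih =>
    have ih' := ih fun s hs => hν s (by omega)
    have hv : (E.invMatrix t).mulVec (E.v t).ofLp = (E.g t).ofLp := ih' (E.g t)
    have hν' := (hν t (by omega)).ne'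
    have hvm : ∀ k : Euc d, (Matrix.vecMulVec (E.g t).ofLp (E.g t).ofLp).mulVec k.ofLp
        = ⟪E.g t, k⟫ • (E.g t).ofLp := fun k => by
      rw [Matrix.vecMulVec_mulVec, dotProduct_ofLp]; simp
    have hgv : ⟪E.g t, E.v t⟫ = E.ν t := rfl
    have hQ : ⟪E.g t, E.Q t h⟫ = ⟪E.v t, h⟫ := by rw [inner_Q_g, real_inner_comm]
    rw [invMatrix, Matrix.add_mulVec, Q_succ, WithLp.ofLp_sub, WithLp.ofLp_smul,
      Matrix.mulVec_sub, Matrix.mulVec_smul, ih', hv, Matrix.smul_mulVec, Matrix.mulVec_sub,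
      Matrix.mulVec_smul, hvm, hvm, hgv, hQ, smul_smul, ← sub_smul, smul_smul, sub_add,
      ← sub_smul]
    have : 2 * shift d * ⟪E.v t, h⟫ / E.ν t - 2 / (2 * d - 1) / E.ν t *
        (⟪E.v t, h⟫ - 2 * shift d * ⟪E.v t, h⟫ / E.ν t * E.ν t) = 0 := by
      have h1 : (2 * d - 1 : ℝ) ≠ 0 := by linarith
      have h2 : (2 * d + 1 : ℝ) ≠ 0 := by linarith
      unfold shift
      field_simp
      ring
    rw [this, zero_smul, sub_zero]

/-- By the matrix determinant lemma each rank-one term multiplies the determinant by `1 + 2 / (2d -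
1)`, whatever the cut is, since `⟪g, v⟫ = ν`. -/
theorem det_invMatrix (E : EllipsoidMethod d) (hd : 1 ≤ d) (hR : 0 < E.rad) {t : ℕ}
    (hν : ∀ s < t, 0 < E.ν s) :
    (E.invMatrix t).det = (1 + 2 / (2 * d - 1)) ^ t * ((E.rad * E.rad)⁻¹) ^ d := by
  have hd' : (1 : ℝ) ≤ d := by exact_mod_cast hd
  induction t with
  | zero => simp [invMatrix]
  | succ t ih =>
    have hν₁ : ∀ s < t, 0 < E.ν s := fun s hs => hν s (by omega)
    have ih' := ih hν₁
    have hv : (E.invMatrix t).mulVec (E.v t).ofLp = (E.g t).ofLp :=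
      E.invMatrix_mulVec hd hR hν₁ (E.g t)
    have hk : (0 : ℝ) ≤ 2 / (2 * d - 1) := div_nonneg zero_le_two (by linarith)
    have hdet : IsUnit (E.invMatrix t).det := by
      rw [ih', isUnit_iff_ne_zero]; positivity
    have hinv : (E.invMatrix t)⁻¹.mulVec (E.g t).ofLp = (E.v t).ofLp := by
      rw [← hv, Matrix.mulVec_mulVec, Matrix.nonsing_inv_mul _ hdet, Matrix.one_mulVec]
    have hν' := (hν t (by omega)).ne'
    rw [invMatrix, ← Matrix.smul_vecMulVec, Matrix.vecMulVec_eq Unit,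
      Matrix.det_add_replicateCol_mul_replicateRow hdet, ih', Matrix.mul_assoc,
      ← Matrix.replicateCol_mulVec, Matrix.mulVec_smul, hinv, Matrix.det_unique,
      Matrix.add_apply, Matrix.one_apply_eq, Matrix.replicateRow_mul_replicateCol_apply,
      dotProduct_smul, dotProduct_ofLp]
    have hgv : ⟪E.g t, E.v t⟫ = E.ν t := rfl
    rw [hgv, smul_eq_mul, div_mul_cancel₀ _ hν']
    ring

theorem posSemidef_invMatrix (E : EllipsoidMethod d) (hd : 1 ≤ d) {t : ℕ}
    (hν : ∀ s < t, 0 < E.ν s) : (E.invMatrix t).PosSemidef := by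
  have hd' : (1 : ℝ) ≤ d := by exact_mod_cast hd
  induction t with
  | zero => exact Matrix.PosSemidef.one.smul (inv_nonneg.2 (mul_self_nonneg _))
  | succ t ih =>
    refine (ih fun s hs => hν s (by omega)).add (Matrix.PosSemidef.smul ?_ ?_)
    · simpa using Matrix.posSemidef_vecMulVec_self_star (E.g t).ofLp
    · exact div_nonneg (div_nonneg zero_le_two (by linarith)) (hν t (by omega)).le

/-- A cut adds at most `2‖g‖² / ν` to the trace, and the failure of the stopping criterion bounds
`‖g‖² / ν` by `growth d ^ t / ρ²`. -/
theorem trace_invMatrix_le (E : EllipsoidMethod d) (hd : 1 ≤ d) {ρ : ℝ} (hρ : 0 < ρ) {t : ℕ}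
    (hs : ∀ s < t, ¬ E.Stops ρ s) : (E.invMatrix t).trace
      ≤ d * (E.rad * E.rad)⁻¹ + 2 * t * growth d ^ t * (ρ * ρ)⁻¹ := by
  have hd' : (1 : ℝ) ≤ d := by exact_mod_cast hd
  have hA := growth_ge_one hd
  induction t with
  | zero => simp [invMatrix, Matrix.trace_smul, mul_comm]
  | succ t ih =>
    have hν := E.ν_pos_of_not_stops hd (hs t (by omega))
    have h1 := hs t (by omega)
    unfold Stops at h1
    push Not at h1
    have h2 : ⟪E.g t, E.g t⟫ / E.ν t ≤ growth d ^ t * (ρ * ρ)⁻¹ := by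
      rw [div_le_iff₀ hν, mul_right_comm, ← div_eq_mul_inv, le_div_iff₀ (by positivity)]
      linarith
    have hk : (2 / (2 * d - 1) : ℝ) ≤ 2 := by
      rw [div_le_iff₀ (by linarith)]; linarith
    have h3 : growth d ^ t ≤ growth d ^ (t + 1) := pow_le_pow_right₀ hA (by omega)
    rw [invMatrix, Matrix.trace_add, Matrix.trace_smul, Matrix.trace_vecMulVec, dotProduct_ofLp]
    have h4 : (2 / (2 * d - 1) / E.ν t) • ⟪E.g t, E.g t⟫
        ≤ 2 * (growth d ^ (t + 1) * (ρ * ρ)⁻¹) := by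
      rw [smul_eq_mul, div_mul_eq_mul_div, mul_div_assoc]
      have : 0 ≤ ⟪E.g t, E.g t⟫ / E.ν t := div_nonneg real_inner_self_nonneg hν.le
      refine mul_le_mul hk (h2.trans ?_) this zero_le_two
      gcongr
    have h5 : 2 * t * growth d ^ t * (ρ * ρ)⁻¹ ≤ 2 * t * growth d ^ (t + 1) * (ρ * ρ)⁻¹ := by
      gcongr
    have h6 := ih fun s hs' => hs s (by omega)
    push_cast
    linarith

/-- The net gain per step once the rescaling is taken into account. It follows from `growth d ≤ exp
(1 / (4d² - 1))` and `1 + 2 / (2d - 1) ≥ exp (2 / (2d + 1))`, as the exponents differ by enough. -/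
theorem exp_le_ratio (hd : 1 ≤ d) :
    Real.exp (1 / (4 * d)) * growth d ^ d ≤ 1 + 2 / (2 * d - 1) := by
  have hd' : (1 : ℝ) ≤ d := by exact_mod_cast hd
  have h0 : (0 : ℝ) < 4 * d * d - 1 := by nlinarith
  have h1 : growth d ≤ Real.exp (1 / (4 * d * d - 1)) := by
    have := Real.add_one_le_exp (1 / (4 * d * d - 1) : ℝ)
    refine le_trans (le_of_eq ?_) this
    rw [growth, div_add_one h0.ne']
    congr 1
    ring
  have h2 : growth d ^ d ≤ Real.exp (d * (1 / (4 * d * d - 1))) := by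
    rw [Real.exp_nat_mul]
    exact pow_le_pow_left₀ (zero_le_one.trans (growth_ge_one hd)) h1 d
  have h3 : 1 + 2 / (2 * (d : ℝ) - 1) = (1 - 2 / (2 * (d : ℝ) + 1))⁻¹ := by
    have h1 : 2 * (d : ℝ) - 1 ≠ 0 := by linarith
    have h2 : 2 * (d : ℝ) + 1 ≠ 0 := by linarith
    rw [one_add_div h1, one_sub_div h2, inv_div]
    congr 1 <;> ring
  have h4 : Real.exp (2 / (2 * d + 1)) ≤ 1 + 2 / (2 * d - 1) := by
    have h5 := Real.add_one_le_exp (-(2 / (2 * d + 1)) : ℝ)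
    have h6 : (0 : ℝ) < 1 - 2 / (2 * d + 1) := by
      rw [sub_pos, div_lt_one (by linarith)]; linarith
    rw [h3, ← neg_neg (2 / (2 * d + 1) : ℝ), Real.exp_neg, neg_neg]
    exact inv_anti₀ h6 (by linarith)
  calc Real.exp (1 / (4 * d)) * growth d ^ d
      ≤ Real.exp (1 / (4 * d)) * Real.exp (d * (1 / (4 * d * d - 1))) := by gcongr
    _ ≤ Real.exp (2 / (2 * d + 1)) := by
        rw [← Real.exp_add, Real.exp_le_exp, ← sub_nonneg]
        have : (2 / (2 * d + 1) - (1 / (4 * d) + d * (1 / (4 * d * d - 1))) : ℝ)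
            = (8 * d * (d - 1) + 1) / (4 * d * (4 * d * d - 1)) := by
          have h7 : (2 * d - 1 : ℝ) ≠ 0 := by linarith
          have h8 : (4 * d * d - 1 : ℝ) = (2 * d - 1) * (2 * d + 1) := by ring
          rw [h8]
          field_simp
          ring
        rw [this]
        have : (0 : ℝ) ≤ d - 1 := by linarith
        positivity
    _ ≤ _ := h4

/-- The ellipsoid method does not run for long. -/
theorem iterations_le (E : EllipsoidMethod d) (hd : 1 ≤ d) (hR : 0 < E.rad) {ρ : ℝ} (hρ : 0 < ρ)
    {T : ℕ} (hs : ∀ s < T, ¬ E.Stops ρ s) :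
    (T : ℝ) ≤ 4 * d * d * Real.log (d + 2 * T * (E.rad * E.rad / (ρ * ρ))) := by
  have hd' : (1 : ℝ) ≤ d := by exact_mod_cast hd
  have hν : ∀ s < T, 0 < E.ν s := fun s h => E.ν_pos_of_not_stops hd (hs s h)
  have hA := growth_ge_one hd
  have h1 := (E.posSemidef_invMatrix hd hν).det_le_trace_pow
  have h0 := (E.posSemidef_invMatrix hd hν).trace_nonneg
  rw [E.det_invMatrix hd hR hν, Fintype.card_fin] at h1
  have h2 := pow_le_pow_left₀ h0 (E.trace_invMatrix_le hd hρ hs) d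
  set Y : ℝ := d + 2 * T * (E.rad * E.rad / (ρ * ρ)) with hY
  have hY0 : 0 < Y := by positivity
  have h3 : d * (E.rad * E.rad)⁻¹ + 2 * T * growth d ^ T * (ρ * ρ)⁻¹
      ≤ (E.rad * E.rad)⁻¹ * (growth d ^ T * Y) := by
    have e : (E.rad * E.rad)⁻¹ * (growth d ^ T * Y) = d * (E.rad * E.rad)⁻¹ * growth d ^ T
        + 2 * T * growth d ^ T * (ρ * ρ)⁻¹ := by rw [hY]; field_simp
    rw [e]
    have : d * (E.rad * E.rad)⁻¹ ≤ d * (E.rad * E.rad)⁻¹ * growth d ^ T :=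
      le_mul_of_one_le_right (by positivity) (one_le_pow₀ hA)
    linarith
  have h4 : (1 + 2 / (2 * d - 1) : ℝ) ^ T ≤ (growth d ^ T * Y) ^ d := by
    have h5 := h1.trans (h2.trans (pow_le_pow_left₀ (by positivity) h3 d))
    rw [mul_pow ((E.rad * E.rad)⁻¹), mul_comm] at h5
    exact le_of_mul_le_mul_left h5 (by positivity)
  -- The powers of `growth d` cancel on both sides. What remains is `exp (T / (4d)) ≤ Y ^ d`.
  have h6 := (pow_le_pow_left₀ (by positivity) (exp_le_ratio hd) T).trans h4
  rw [mul_pow, mul_pow, ← pow_mul, ← pow_mul, mul_comm d T, mul_comm] at h6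
  have h7 := le_of_mul_le_mul_left h6 (by positivity)
  rw [← Real.exp_nat_mul] at h7
  have h8 := Real.log_le_log (Real.exp_pos _) h7
  rw [Real.log_exp, Real.log_pow] at h8
  have h9 : (T : ℝ) = 4 * d * (T * (1 / (4 * d))) := by field_simp
  rw [h9]
  calc 4 * d * (T * (1 / (4 * d))) ≤ 4 * d * (d * Real.log Y) := by gcongr
    _ = _ := by ring

/-! #### The certificate solves the expected variational inequality -/

/-- Numerical choice of the final width. -/
noncomputable def finalWidth (ε r R M : ℝ) : ℝ := r * ε / (2 * ε + R * M)

/-- The certificate bounds the regret by `n`, so the total weight `W` of the query points in `X`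
must satisfy `n ≤ ε * W`. If the last query point is in `X`, its own weight `1` suffices. Otherwise
the certificate at the centre of the balls forces `W` to be large: the last cut separates by a
margin `r‖g‖`, and only the points in `X` can compensate for it, each by at most `R * M` per unit of
weight. -/
theorem weights_solve (E : EllipsoidMethod d) (hd : 1 ≤ d) {X : Set (Euc d)}
    {F : Euc d → Euc d} {ε r M ρ : ℝ} (hε : 0 < ε) (hr : 0 < r) (hrR : r ≤ E.rad)
    (hX₁ : Metric.closedBall E.ctr r ⊆ X) (hX₂ : X ⊆ Metric.closedBall E.ctr E.rad)
    (hF : ∀ x ∈ X, ‖F x‖ ≤ M) (hin : ∀ x ∈ X, E.cut x = F x)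
    (hout : ∀ x ∉ X, E.cut x ≠ 0 ∧ ∀ y ∈ X, ⟪E.cut x, y⟫ ≤ ⟪E.cut x, x⟫)
    (hρ : ρ = finalWidth ε r E.rad M) {t : ℕ} (hs : ∀ s < t, ¬ E.Stops ρ s)
    (ht : E.Stops ρ t) (f : ℕ → ℝ) (hf₁ : ∀ s, E.x s ∈ X → f s = 1)
    (hf₀ : ∀ s, E.x s ∉ X → f s = 0) :
    0 < ∑ k ∈ Finset.range (t + 1), E.weight t k * f (t - k) ∧
    ∀ y ∈ X, ∑ k ∈ Finset.range (t + 1),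
        E.weight t k * f (t - k) * ⟪F (E.x (t - k)), E.x (t - k) - y⟫
      ≤ ε * ∑ k ∈ Finset.range (t + 1), E.weight t k * f (t - k) := by
  have hν : ∀ s < t, 0 < E.ν s := fun s h => E.ν_pos_of_not_stops hd (hs s h)
  have hR : 0 < E.rad := hr.trans_le hrR
  have hc : E.ctr ∈ X := hX₁ (Metric.mem_closedBall_self hr.le)
  have hM : 0 ≤ M := (norm_nonneg _).trans (hF _ hc)
  have hw : ∀ k ∈ Finset.range (t + 1), 0 ≤ E.weight t k := fun k hk =>
    E.weight_nonneg hν (by simpa [Nat.lt_succ_iff] using hk)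
  have hf : ∀ s, 0 ≤ f s := fun s => by
    by_cases h : E.x s ∈ X
    · rw [hf₁ s h]; exact zero_le_one
    · rw [hf₀ s h]
  have hden : 0 < 2 * ε + E.rad * M := by positivity
  have hρ0 : 0 < ρ := by rw [hρ, finalWidth]; positivity
  have hρe : ρ * (2 * ε + E.rad * M) = r * ε := by
    rw [hρ, finalWidth, div_mul_cancel₀ _ hden.ne']
  set n := √(growth d ^ t * E.ν t) with hn
  have hn0 : 0 ≤ n := Real.sqrt_nonneg _
  have hng : n ≤ ρ * ‖E.g t‖ := by
    rw [hn]
    apply Real.sqrt_le_iff.2 ⟨by positivity, ht.trans (le_of_eq _)⟩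
    rw [real_inner_self_eq_norm_sq]; ring
  have hsum : ∀ y ∈ X, ∑ k ∈ Finset.range (t + 1),
      E.weight t k * ⟪E.g (t - k), E.x (t - k) - y⟫ ≤ n := fun y hy =>
    E.certificate hd hR hν (by simpa [dist_eq_norm] using hX₂ hy)
  -- Terms of rejected points are nonnegative on `X`, so they may be dropped from the sum.
  have hterm : ∀ y ∈ X, ∀ s, f s * ⟪F (E.x s), E.x s - y⟫ ≤ ⟪E.g s, E.x s - y⟫ := by
    intro y hy s
    by_cases h : E.x s ∈ X
    · rw [hf₁ s h, one_mul, g, hin _ h]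
    · rw [hf₀ s h, zero_mul, g, inner_sub_right]
      linarith [(hout _ h).2 y hy]
  have hreg : ∀ y ∈ X, ∑ k ∈ Finset.range (t + 1),
      E.weight t k * f (t - k) * ⟪F (E.x (t - k)), E.x (t - k) - y⟫ ≤ n := fun y hy => by
    refine le_trans (Finset.sum_le_sum fun k hk => ?_) (hsum y hy)
    rw [mul_assoc]
    exact mul_le_mul_of_nonneg_left (hterm y hy _) (hw k hk)
  set W := ∑ k ∈ Finset.range (t + 1), E.weight t k * f (t - k) with hW
  suffices h : 0 < W ∧ n ≤ ε * W from ⟨h.1, fun y hy => (hreg y hy).trans h.2⟩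
  by_cases hx : E.x t ∈ X
  · have h1 : 1 ≤ W := by
      have := Finset.single_le_sum (f := fun k => E.weight t k * f (t - k))
        (fun k hk => mul_nonneg (hw k hk) (hf _)) (Finset.mem_range.2 (Nat.succ_pos t))
      simpa [weight_zero, hf₁ t hx] using this
    refine ⟨by linarith, ?_⟩
    have h2 : ‖E.g t‖ ≤ M := by rw [g, hin _ hx]; exact hF _ hx
    -- Here `n ≤ ρ‖g‖ ≤ ρM`, and `r ≤ R` makes the chosen width small enough.
    have h3 : ρ * M ≤ ε := by
      rw [hρ, finalWidth, div_mul_eq_mul_div, div_le_iff₀ hden]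
      have : r * M ≤ E.rad * M := by gcongr
      nlinarith
    have h4 : ρ * ‖E.g t‖ ≤ ρ * M := by gcongr
    nlinarith
  · obtain ⟨hg0, hsep⟩ := hout _ hx
    change E.g t ≠ 0 at hg0
    change ∀ y ∈ X, ⟪E.g t, y⟫ ≤ ⟪E.g t, E.x t⟫ at hsep
    have hgn : 0 < ‖E.g t‖ := norm_pos_iff.2 hg0
    have h1 : r * ‖E.g t‖ ≤ ⟪E.g t, E.x t - E.ctr⟫ := by
      -- The point of the inner ball farthest in the direction of the cut shows that the cut has
      -- margin `r‖g‖` at the centre.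
      have hmem : E.ctr + (r / ‖E.g t‖) • E.g t ∈ X := hX₁ <| by
        rw [mem_closedBall_iff_norm, add_sub_cancel_left, norm_smul,
          Real.norm_of_nonneg (by positivity), div_mul_cancel₀ _ hgn.ne']
      have := hsep _ hmem
      rw [inner_add_right, inner_smul_right, real_inner_self_eq_norm_sq] at this
      have e : r / ‖E.g t‖ * ‖E.g t‖ ^ 2 = r * ‖E.g t‖ := by field_simp
      rw [inner_sub_right]
      linarith
    have h2 : ∑ k ∈ Finset.range (t + 1), -(E.weight t k * f (t - k)) * (E.rad * M)
        + r * ‖E.g t‖ ≤ n := by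
      refine le_trans ?_ (hsum _ hc)
      rw [Finset.sum_range_succ', Finset.sum_range_succ', weight_zero, Nat.sub_zero, hf₀ t hx,
        mul_zero, neg_zero, zero_mul, add_zero, one_mul]
      refine add_le_add (Finset.sum_le_sum fun k hk => ?_) h1
      have hk' : k + 1 ∈ Finset.range (t + 1) := by
        simpa using hk
      rw [neg_mul, mul_assoc, ← mul_neg]
      refine mul_le_mul_of_nonneg_left (le_trans ?_ (hterm _ hc _)) (hw _ hk')
      by_cases h : E.x (t - (k + 1)) ∈ X
      · rw [hf₁ _ h, one_mul, one_mul]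
        have h5 := (abs_le.1 (abs_real_inner_le_norm (F (E.x (t - (k + 1))))
          (E.x (t - (k + 1)) - E.ctr))).1
        have h6 : ‖E.x (t - (k + 1)) - E.ctr‖ ≤ E.rad := by
          simpa [dist_eq_norm] using hX₂ h
        have h7 : ‖F (E.x (t - (k + 1)))‖ * ‖E.x (t - (k + 1)) - E.ctr‖ ≤ M * E.rad := by
          gcongr; exact hF _ h
        linarith
      · rw [hf₀ _ h]; simp
    rw [← Finset.sum_mul, Finset.sum_neg_distrib, ← hW] at h2
    set p := E.rad * M
    have hp : 0 ≤ p := mul_nonneg hR.le hM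
    -- The summand `2 * ε` in the denominator of the width gives this strict inequality. Hence `n <
    -- r‖g‖` and the weight cannot vanish.
    have hρr : ρ < r := by
      by_contra hcon
      push Not at hcon
      nlinarith
    have h3 : ρ * ‖E.g t‖ < r * ‖E.g t‖ := by gcongr
    have h4 : 0 < W * p := by linarith
    have hWp : 0 < W := pos_of_mul_pos_left h4 hp
    have hpp : 0 < p := pos_of_mul_pos_right h4 hWp.le
    refine ⟨hWp, ?_⟩
    have h5 : n * (2 * ε + p) ≤ r * ε * ‖E.g t‖ := by
      rw [← hρe]
      calc n * (2 * ε + p) ≤ ρ * ‖E.g t‖ * (2 * ε + p) := by gcongr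
        _ = _ := by ring
    -- From `n(2ε + p) ≤ εr‖g‖` and `r‖g‖ ≤ n + Wp` one gets `np ≤ ε(Wp - n)`.
    have h6 : n * p ≤ ε * W * p := by nlinarith
    exact le_of_mul_le_mul_right h6 hpp

end EllipsoidMethod

/-! ### Reasoning about programs -/

/-- Program `p` halts from memory `s` within `T` steps, and the final memory satisfies `Q`. -/
def Runs {d : ℕ} (O : Oracles d) (p : Prog) (s : Store) (T : ℕ) (Q : Store → Prop) : Prop :=
  ∃ t s', Exec O p s t s' ∧ t ≤ T ∧ Q s'

namespace Runs

variable {d : ℕ} {O : Oracles d} {p q : Prog} {s : Store} {T T' : ℕ} {Q Q' : Store → Prop}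

theorem mono (h : Runs O p s T Q) (hT : T ≤ T') (hQ : ∀ s', Q s' → Q' s') :
    Runs O p s T' Q' := by
  obtain ⟨t, s', h1, h2, h3⟩ := h
  exact ⟨t, s', h1, h2.trans hT, hQ _ h3⟩

theorem skip (h : Q s) : Runs O .skip s 1 Q := ⟨1, s, .skip s, le_rfl, h⟩

theorem instr (i : Instr) (h : Q (i.apply O s)) : Runs O (.instr i) s (i.cost d) Q :=
  ⟨_, _, .instr i s, le_rfl, h⟩

theorem seq (h : Runs O p s T fun s' => Runs O q s' T' Q) : Runs O (.seq p q) s (T + T') Q := by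
  obtain ⟨t, s', h1, h2, t', s'', h3, h4, h5⟩ := h
  exact ⟨_, _, .seq h1 h3, by omega, h5⟩

theorem ite {b : Test} (h₁ : b.holds s → Runs O p s T Q) (h₂ : ¬ b.holds s → Runs O q s T Q) :
    Runs O (.ite b p q) s (T + 1) Q := by
  by_cases h : b.holds s
  · obtain ⟨t, s', h1, h2, h3⟩ := h₁ h
    exact ⟨_, _, .iteTrue h h1, by omega, h3⟩
  · obtain ⟨t, s', h1, h2, h3⟩ := h₂ h
    exact ⟨_, _, .iteFalse h h1, by omega, h3⟩

/-- A loop with an invariant that counts the iterations. -/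
theorem loop {b : Test} (I : ℕ → Store → Prop) (n : ℕ) (h₀ : I 0 s)
    (hstep : ∀ i < n, ∀ s, I i s → b.holds s ∧ Runs O p s T (I (i + 1)))
    (hend : ∀ s, I n s → ¬ b.holds s ∧ Q s) : Runs O (.loop b p) s (n * (T + 1) + 1) Q := by
  suffices h : ∀ k i s, i + k = n → I i s → Runs O (.loop b p) s (k * (T + 1) + 1) Q from
    h n 0 s (by omega) h₀
  intro k
  induction k with
  | zero =>
    intro i s hi hI
    obtain rfl : i = n := by omega
    exact ⟨_, _, .loopFalse (hend s hI).1, by omega, (hend s hI).2⟩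
  | succ k ih =>
    intro i s hi hI
    obtain ⟨hb, t, s', h1, h2, h3⟩ := hstep i (by omega) s hI
    obtain ⟨t', s'', h4, h5, h6⟩ := ih (i + 1) s' (by omega) h3
    refine ⟨_, _, .loopTrue hb h1 h4, ?_, h6⟩
    rw [Nat.succ_mul]
    omega

end Runs

/-- Straight-line code. -/
def Prog.block : List Instr → Prog
  | [] => .skip
  | i :: l => .seq (.instr i) (block l)

/-- Effect of straight-line code. -/
noncomputable def Store.exec {d : ℕ} (O : Oracles d) (s : Store) : List Instr → Store
  | [] => s
  | i :: l => Store.exec O (i.apply O s) l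

theorem Runs.block {d : ℕ} {O : Oracles d} {s : Store} {Q : Store → Prop} (l : List Instr)
    (h : Q (s.exec O l)) : Runs O (.block l) s ((l.map (Instr.cost d)).sum + 1) Q := by
  induction l generalizing s with
  | nil => exact Runs.skip h
  | cons i l ih =>
    rw [List.map_cons, List.sum_cons, add_assoc]
    exact Runs.seq (Runs.instr i (ih h))

/-! ### Memory layout and vector arithmetic -/

namespace Store

theorem readVec_apply (s : Store) {d : ℕ} (p : ℕ) (i : Fin d) :
    s.readVec d p i = s.real (p + i) := rfl

theorem readVec_congr {s s' : Store} {d p p' : ℕ}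
    (h : ∀ i < d, s'.real (p' + i) = s.real (p + i)) : s'.readVec d p' = s.readVec d p := by
  ext i
  exact h i i.2

/-- Memory organization of the program: some registers with fixed content. Registers `20` to `35`
point to the cells for scalars, which follow the input. -/
structure Layout (d : ℕ) (s : Store) : Prop where
  dim : s.nat 0 = d
  one : s.nat 4 = 1
  zero : s.nat 5 = 0
  stride : s.nat 6 = 3 * d + 2
  base : s.nat 7 = 20 + d
  scal : ∀ j < 16, s.nat (20 + j) = 4 + d + j

/-- The registers with fixed content. -/
def Fixed (k : ℕ) : Prop := k = 0 ∨ 4 ≤ k ∧ k ≤ 7 ∨ 20 ≤ k ∧ k < 36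

/-- A frame rule. This and the similar lemmas below carry an invariant across a piece of code that
leaves the relevant registers and cells unchanged. -/
theorem Layout.congr {d : ℕ} {s s' : Store} (h : s.Layout d)
    (hn : ∀ k, Fixed k → s'.nat k = s.nat k) : s'.Layout d where
  dim := by rw [hn 0 (by simp [Fixed]), h.dim]
  one := by rw [hn 4 (by simp [Fixed]), h.one]
  zero := by rw [hn 5 (by simp [Fixed]), h.zero]
  stride := by rw [hn 6 (by simp [Fixed]), h.stride]
  base := by rw [hn 7 (by simp [Fixed]), h.base]
  scal j hj := by rw [hn _ (by unfold Fixed; omega), h.scal j hj]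

/-- The `j`-th scalar cell. -/
def sc (s : Store) (d j : ℕ) : ℝ := s.real (4 + d + j)

end Store

namespace Prog

/-- Replace the vector `a` at register `ra` by `α a + β b`, with `b` at register `rb` and `α`, `β`
the scalars number `ja`, `jb`. -/
def linComb (ja jb ra rb : ℕ) : Prog :=
  .seq (.block [.natAdd 1 0 5, .natAdd 2 ra 5, .natAdd 3 rb 5])
    (.loop (.natLe 4 1) (.block [
      .realMul (.ind 22) (.ind (20 + jb)) (.ind 3),
      .realMul (.ind 2) (.ind (20 + ja)) (.ind 2),
      .realAdd (.ind 2) (.ind 2) (.ind 22),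
      .natAdd 2 2 4, .natAdd 3 3 4, .natSub 1 1 4]))

/-- Store the inner product of the vectors at registers `ra` and `rb` in scalar number `3`. -/
def dot (ra rb : ℕ) : Prog :=
  .seq (.block [.natAdd 1 0 5, .natAdd 2 ra 5, .natAdd 3 rb 5, .realConst (.ind 23) 0])
    (.loop (.natLe 4 1) (.block [
      .realMul (.ind 22) (.ind 2) (.ind 3),
      .realAdd (.ind 23) (.ind 23) (.ind 22),
      .natAdd 2 2 4, .natAdd 3 3 4, .natSub 1 1 4]))

end Prog

/-- A vector at address `p` avoids the cells for scalars. -/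
def OffScalars (d p : ℕ) : Prop := p ≤ 4 ∨ 20 + d ≤ p

/-- Scalar `2` is the workspace, hence excluded as a coefficient. Coefficient `0` discards the old
content of the target, so the same routine also copies and scales. -/
theorem runs_linComb {d : ℕ} (O : Oracles d) (s : Store) (ja jb ra rb : ℕ) (hs : s.Layout d)
    (hja : ja < 16 ∧ ja ≠ 2) (hjb : jb < 16 ∧ jb ≠ 2) (hra : 4 ≤ ra) (hrb : 4 ≤ rb)
    (ha : OffScalars d (s.nat ra)) (hb : OffScalars d (s.nat rb))
    (hab : s.nat ra + d ≤ s.nat rb ∨ s.nat rb + d ≤ s.nat ra) :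
    Runs O (.linComb ja jb ra rb) s (12 * (d + 1)) fun s' =>
      (∀ k, 4 ≤ k ∨ k = 0 → s'.nat k = s.nat k) ∧
      (∀ q, q ≠ 6 + d → ¬ (s.nat ra ≤ q ∧ q < s.nat ra + d) → s'.real q = s.real q) ∧
      s'.readVec d (s.nat ra) =
        s.sc d ja • s.readVec d (s.nat ra) + s.sc d jb • s.readVec d (s.nat rb) := by
  unfold OffScalars at ha hb
  refine (Runs.seq (Runs.block _ (Runs.loop (T := 7) (n := d) (fun i s' => s'.nat 1 = d - i ∧
      s'.nat 2 = s.nat ra + i ∧ s'.nat 3 = s.nat rb + i ∧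
      (∀ k, 4 ≤ k ∨ k = 0 → s'.nat k = s.nat k) ∧
      (∀ q, q ≠ 6 + d → ¬ (s.nat ra ≤ q ∧ q < s.nat ra + i) → s'.real q = s.real q) ∧
      ∀ j < i, s'.real (s.nat ra + j) =
        s.sc d ja * s.real (s.nat ra + j) + s.sc d jb * s.real (s.nat rb + j)) ?_ ?_ ?_))).mono
    ?_ (fun s' h => h)
  · have h0 : ∀ k, 4 ≤ k ∨ k = 0 → k ≠ 1 ∧ k ≠ 2 ∧ k ≠ 3 := by omega
    simp +contextual [Store.exec, Instr.apply, Store.setNat, hs.dim,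
      hs.zero, h0, show ra ≠ 1 by omega, show rb ≠ 1 by omega, show rb ≠ 2 by omega]
  · rintro i hi s' ⟨h1, h2, h3, h4, h5, h6⟩
    have hs' : s'.Layout d := hs.congr fun k hk => h4 k (by unfold Store.Fixed at hk; omega)
    refine ⟨?_, (Runs.block _ ?_).mono (T' := 7) (by simp [Instr.cost]) fun _ h => h⟩
    · simp only [Test.holds, hs'.one, h1]; omega
    have e22 := hs'.scal 2 (by omega)
    have ea := hs'.scal ja hja.1
    have eb := hs'.scal jb hjb.1
    norm_num at e22
    have hea : s'.real (4 + d + ja) = s.sc d ja := h5 _ (by omega) (by omega)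
    have heb : s'.real (4 + d + jb) = s.sc d jb := h5 _ (by omega) (by omega)
    -- Only the first `i` entries of the target have been overwritten, and the source is disjoint
    -- from the target.
    have hra' : s'.real (s.nat ra + i) = s.real (s.nat ra + i) := h5 _ (by omega) (by omega)
    have hrb' : s'.real (s.nat rb + i) = s.real (s.nat rb + i) := h5 _ (by omega) (by omega)
    simp only [Store.exec, Instr.apply, Store.setNat, Store.setReal, Store.val, Store.loc,
      Function.update_apply, h1, h2, h3, hs'.one, e22, ea, eb]
    refine ⟨by simp; omega, by simp; omega, by simp; omega, ?_, ?_, ?_⟩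
    · intro k hk
      rw [if_neg (by omega), if_neg (by omega), if_neg (by omega), h4 k hk]
    · intro q hq hq'
      rw [if_neg (by omega), if_neg (by omega), if_neg (by omega), h5 q hq (by omega)]
    · intro j hj
      by_cases hji : j = i
      · subst hji
        simp only [if_true]
        rw [if_neg (by omega), if_neg (by omega), if_neg (by omega), hea, heb, hra', hrb']
      · rw [if_neg (by omega), if_neg (by omega), if_neg (by omega), h6 j (by omega)]
  · rintro s' ⟨h1, h2, h3, h4, h5, h6⟩
    refine ⟨?_, h4, h5, ?_⟩
    · simp only [Test.holds, h4 4 (by omega), hs.one, h1]; omega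
    · ext i
      simpa [Store.readVec_apply] using h6 i i.2
  · simp [Instr.cost]; omega

theorem runs_dot {d : ℕ} (O : Oracles d) (s : Store) (ra rb : ℕ) (hs : s.Layout d)
    (hra : 4 ≤ ra) (hrb : 4 ≤ rb)
    (ha : OffScalars d (s.nat ra)) (hb : OffScalars d (s.nat rb)) :
    Runs O (.dot ra rb) s (12 * (d + 1)) fun s' =>
      (∀ k, 4 ≤ k ∨ k = 0 → s'.nat k = s.nat k) ∧
      (∀ q, q ≠ 6 + d → q ≠ 7 + d → s'.real q = s.real q) ∧
      s'.sc d 3 = ⟪s.readVec d (s.nat ra), s.readVec d (s.nat rb)⟫ := by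
  unfold OffScalars at ha hb
  refine (Runs.seq (Runs.block _ (Runs.loop (T := 7) (n := d) (fun i s' => s'.nat 1 = d - i ∧
      s'.nat 2 = s.nat ra + i ∧ s'.nat 3 = s.nat rb + i ∧
      (∀ k, 4 ≤ k ∨ k = 0 → s'.nat k = s.nat k) ∧
      (∀ q, q ≠ 6 + d → q ≠ 7 + d → s'.real q = s.real q) ∧
      s'.real (7 + d) = ∑ j ∈ Finset.range i, s.real (s.nat ra + j) * s.real (s.nat rb + j))
      ?_ ?_ ?_))).mono ?_ (fun s' h => h)
  · have h0 : ∀ k, 4 ≤ k ∨ k = 0 → k ≠ 1 ∧ k ≠ 2 ∧ k ≠ 3 := by omega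
    have e23 := hs.scal 3 (by omega)
    norm_num at e23
    have e : 4 + d + 3 = 7 + d := by omega
    rw [e] at e23
    simp +contextual [Store.exec, Instr.apply, Store.setNat, Store.setReal, Store.loc,
      hs.dim, e23,
      hs.zero, h0, show ra ≠ 1 by omega, show rb ≠ 1 by omega, show rb ≠ 2 by omega]
  · rintro i hi s' ⟨h1, h2, h3, h4, h5, h6⟩
    have hs' : s'.Layout d := hs.congr fun k hk => h4 k (by unfold Store.Fixed at hk; omega)
    refine ⟨?_, (Runs.block _ ?_).mono (T' := 7) (by simp [Instr.cost]) fun _ h => h⟩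
    · simp only [Test.holds, hs'.one, h1]; omega
    have e22 := hs'.scal 2 (by omega)
    have e23 := hs'.scal 3 (by omega)
    norm_num at e22 e23
    have hra' : s'.real (s.nat ra + i) = s.real (s.nat ra + i) := h5 _ (by omega) (by omega)
    have hrb' : s'.real (s.nat rb + i) = s.real (s.nat rb + i) := h5 _ (by omega) (by omega)
    simp only [Store.exec, Instr.apply, Store.setNat, Store.setReal, Store.val, Store.loc,
      Function.update_apply, h1, h2, h3, hs'.one, e22, e23]
    refine ⟨by simp; omega, by simp; omega, by simp; omega, ?_, ?_, ?_⟩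
    · intro k hk
      rw [if_neg (by omega), if_neg (by omega), if_neg (by omega), h4 k hk]
    · intro q hq hq'
      rw [if_neg (by omega), if_neg (by omega), h5 q hq hq']
    · simp only [if_true]
      rw [if_pos (by omega), if_neg (by omega), Finset.sum_range_succ, ← h6, hra', hrb']
      congr 2
      omega
  · rintro s' ⟨h1, h2, h3, h4, h5, h6⟩
    refine ⟨?_, h4, h5, ?_⟩
    · simp only [Test.holds, h4 4 (by omega), hs.one, h1]; omega
    · rw [PiLp.inner_apply, Store.sc, show 4 + d + 3 = 7 + d by omega, h6, Finset.sum_range]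
      exact Finset.sum_congr rfl fun i _ => by simp [Store.readVec_apply, mul_comm]
  · simp [Instr.cost]; omega

namespace Runs

variable {d : ℕ} {O : Oracles d} {p q : Prog} {s : Store} {T T' : ℕ} {Q : Store → Prop}

theorem block_seq (l : List Instr) (h : Runs O q (s.exec O l) T' Q)
    (hT : (l.map (Instr.cost d)).sum + 1 + T' ≤ T) : Runs O (.seq (.block l) q) s T Q :=
  (Runs.seq (Runs.block l h)).mono hT fun _ h => h

theorem seq_of {P : Store → Prop} {T₁ T₂ : ℕ} (h : Runs O p s T₁ P)
    (h' : ∀ s', P s' → Runs O q s' T₂ Q) (hT : T₁ + T₂ ≤ T) : Runs O (.seq p q) s T Q :=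
  (Runs.seq (h.mono le_rfl h')).mono hT fun _ h => h

theorem block_le (l : List Instr) (h : Q (s.exec O l))
    (hT : (l.map (Instr.cost d)).sum + 1 ≤ T) : Runs O (.block l) s T Q :=
  (Runs.block l h).mono hT fun _ h => h

end Runs

namespace Store

theorem writeVec_nat (s : Store) {d : ℕ} (p : ℕ) (v : Euc d) : (s.writeVec p v).nat = s.nat := rfl

theorem writeVec_real_of_not (s : Store) {d p : ℕ} (v : Euc d) {q : ℕ}
    (h : ¬ (p ≤ q ∧ q < p + d)) : (s.writeVec p v).real q = s.real q := dif_neg h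

theorem readVec_writeVec (s : Store) {d p : ℕ} (v : Euc d) :
    (s.writeVec p v).readVec d p = v := by
  ext i
  have h : p ≤ p + (i : ℕ) ∧ p + (i : ℕ) < p + d := ⟨by omega, by have := i.2; omega⟩
  simp [readVec_apply, writeVec, h]

end Store

/-! ### The program of the ellipsoid method -/

/-- The cutting direction that the oracles give at `x`. -/
def Oracles.answer {d : ℕ} (O : Oracles d) (x : Euc d) : Euc d :=
  match O.sep x with
  | none => O.map x
  | some g => g

/-- `1` if the separation oracle accepts `x`, and `0` otherwise. -/
def Oracles.flag {d : ℕ} (O : Oracles d) (x : Euc d) : ℝ :=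
  match O.sep x with
  | none => 1
  | some _ => 0

/-- The ellipsoid method for given oracles and a given initial ball. -/
def Oracles.method {d : ℕ} (O : Oracles d) (c : Euc d) (R : ℝ) : EllipsoidMethod d :=
  ⟨O.answer, c, R⟩

/-- Address of the `t`-th record. A record consists of a query point, a cutting direction, its
image under the matrix of the ellipsoid, their inner product, and a flag. -/
def recAddr (d t : ℕ) : ℕ := 20 + d + t * (3 * d + 2)

theorem recAddr_zero (d : ℕ) : recAddr d 0 = 20 + d := by simp [recAddr]

theorem recAddr_succ (d t : ℕ) : recAddr d (t + 1) = recAddr d t + (3 * d + 2) := by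
  unfold recAddr; ring

theorem recAddr_le (d t : ℕ) : 20 + d ≤ recAddr d t := Nat.le_add_right _ _

theorem recAddr_add_le {d j t : ℕ} (h : j < t) : recAddr d j + (3 * d + 2) ≤ recAddr d t := by
  rw [← recAddr_succ]
  unfold recAddr
  gcongr
  omega

namespace Prog

/-- Query the oracles at the current point. -/
def query : Prog :=
  .seq (.instr (.querySep 18 (.ind 10) (.ind 8)))
    (.ite (.natLe 4 18)
      (.block [.queryMap (.ind 10) (.ind 8), .realConst (.ind 13) 1])
      (.block [.realConst (.ind 13) 0]))

/-- Account for one former cut in the product of the matrix and the current cutting direction. -/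
def project : Prog :=
  .seq (.block [.natAdd 14 9 0, .natAdd 15 14 0, .natAdd 16 15 0]) <|
  .seq (.dot 15 10) <|
  .seq (.block [.realMul (.ind 24) (.ind 27) (.ind 23), .realDiv (.ind 24) (.ind 24) (.ind 16),
    .realSub (.ind 24) (.ind 20) (.ind 24)]) <|
  .seq (.linComb 1 4 11 15) (.block [.natAdd 9 9 6, .natAdd 38 9 4])

/-- Complete the current record and decide whether to stop. -/
def compute : Prog :=
  .seq (.block [.natAdd 10 8 0, .natAdd 11 10 0, .natAdd 12 11 0, .natAdd 13 12 4]) <|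
  .seq query <|
  .seq (.linComb 0 10 11 10) <|
  .seq (.block [.natAdd 9 7 5, .natAdd 38 9 4]) <|
  .seq (.loop (.natLe 38 8) project) <|
  .seq (.dot 10 11) <|
  .seq (.block [.realAdd (.ind 12) (.ind 23) (.ind 20)]) <|
  .seq (.dot 10 10) <|
  .seq (.block [.realMul (.ind 24) (.ind 25) (.ind 12), .realMul (.ind 23) (.ind 29) (.ind 23)])
    (.ite (.realLe (.ind 24) (.ind 23)) (.block [.natConst 19 0]) (.block [.natConst 19 1]))

/-- Move to the centre of the next ellipsoid. -/
def advance : Prog :=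
  .seq (.block [.natAdd 39 8 6]) <|
  .seq (.linComb 0 1 39 8) <|
  .seq (.block [.realDiv (.ind 24) (.ind 25) (.ind 12), .realSqrt (.ind 24) (.ind 24),
    .realMul (.ind 24) (.ind 26) (.ind 24), .realSub (.ind 24) (.ind 20) (.ind 24)]) <|
  .seq (.linComb 1 4 39 11)
    (.block [.realMul (.ind 25) (.ind 25) (.ind 28), .natAdd 8 8 6])

end Prog

/-- The scalar cells with constants. -/
def ConstCell (j : ℕ) : Prop := j ≤ 1 ∨ 6 ≤ j ∧ j ≤ 10 ∨ j = 12

/-- The memory is organized, and the constants of the method are in place. -/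
structure Ready {d : ℕ} (E : EllipsoidMethod d) (ρ : ℝ) (s : Store) : Prop where
  layout : s.Layout d
  c0 : s.sc d 0 = 0
  c1 : s.sc d 1 = 1
  c6 : s.sc d 6 = EllipsoidMethod.shift d
  c7 : s.sc d 7 = 2 * EllipsoidMethod.shift d
  c8 : s.sc d 8 = EllipsoidMethod.growth d
  c9 : s.sc d 9 = ρ * ρ
  c10 : s.sc d 10 = E.rad * E.rad
  c12 : s.sc d 12 = -1

theorem Ready.congr {d : ℕ} {E : EllipsoidMethod d} {ρ : ℝ} {s s' : Store} (h : Ready E ρ s)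
    (hn : ∀ k, Store.Fixed k → s'.nat k = s.nat k)
    (hr : ∀ j, ConstCell j → s'.real (4 + d + j) = s.real (4 + d + j)) : Ready E ρ s' where
  layout := h.layout.congr hn
  c0 := (hr 0 (by simp [ConstCell])).trans h.c0
  c1 := (hr 1 (by simp [ConstCell])).trans h.c1
  c6 := (hr 6 (by simp [ConstCell])).trans h.c6
  c7 := (hr 7 (by simp [ConstCell])).trans h.c7
  c8 := (hr 8 (by simp [ConstCell])).trans h.c8
  c9 := (hr 9 (by simp [ConstCell])).trans h.c9
  c10 := (hr 10 (by simp [ConstCell])).trans h.c10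
  c12 := (hr 12 (by simp [ConstCell])).trans h.c12

/-- The record of step `t` is stored at address `p`. -/
structure HasRec {d : ℕ} (O : Oracles d) (E : EllipsoidMethod d) (s : Store) (p t : ℕ) : Prop where
  x : s.readVec d p = E.x t
  g : s.readVec d (p + d) = E.g t
  v : s.readVec d (p + d + d) = E.v t
  ν : s.real (p + d + d + d) = E.ν t
  flag : s.real (p + d + d + d + 1) = O.flag (E.x t)

theorem HasRec.congr {d : ℕ} {O : Oracles d} {E : EllipsoidMethod d} {s s' : Store} {p t : ℕ}
    (h : HasRec O E s p t)
    (hr : ∀ q, p ≤ q → q < p + (3 * d + 2) → s'.real q = s.real q) : HasRec O E s' p t where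
  x := (Store.readVec_congr fun i hi => hr _ (by omega) (by omega)).trans h.x
  g := (Store.readVec_congr fun i hi => hr _ (by omega) (by omega)).trans h.g
  v := (Store.readVec_congr fun i hi => hr _ (by omega) (by omega)).trans h.v
  ν := (hr _ (by omega) (by omega)).trans h.ν
  flag := (hr _ (by omega) (by omega)).trans h.flag

/-- The registers with the addresses of the parts of the current record. -/
structure CurAddr (d p : ℕ) (s : Store) : Prop where
  x : s.nat 8 = p
  g : s.nat 10 = p + d
  v : s.nat 11 = p + d + d
  ν : s.nat 12 = p + d + d + d
  flag : s.nat 13 = p + d + d + d + 1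

theorem CurAddr.congr {d p : ℕ} {s s' : Store} (h : CurAddr d p s)
    (hn : ∀ k, k = 8 ∨ 10 ≤ k ∧ k ≤ 13 → s'.nat k = s.nat k) : CurAddr d p s' where
  x := (hn _ (by omega)).trans h.x
  g := (hn _ (by omega)).trans h.g
  v := (hn _ (by omega)).trans h.v
  ν := (hn _ (by omega)).trans h.ν
  flag := (hn _ (by omega)).trans h.flag

/-- Before the computations of step `t`. -/
structure BeforeStep {d : ℕ} (O : Oracles d) (E : EllipsoidMethod d) (ρ : ℝ) (t : ℕ) (s : Store) :
    Prop where
  ready : Ready E ρ s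
  cur : s.nat 8 = recAddr d t
  scale : s.sc d 5 = EllipsoidMethod.growth d ^ t
  recs : ∀ j < t, HasRec O E s (recAddr d j) j
  x : s.readVec d (recAddr d t) = E.x t

/-- During the computations of step `t`, after the oracle query. -/
structure DuringStep {d : ℕ} (O : Oracles d) (E : EllipsoidMethod d) (ρ : ℝ) (t : ℕ) (s : Store) :
    Prop where
  ready : Ready E ρ s
  cur : CurAddr d (recAddr d t) s
  scale : s.sc d 5 = EllipsoidMethod.growth d ^ t
  recs : ∀ j < t, HasRec O E s (recAddr d j) j
  x : s.readVec d (recAddr d t) = E.x t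
  g : s.readVec d (recAddr d t + d) = E.g t
  flag : s.real (recAddr d t + d + d + d + 1) = O.flag (E.x t)

open Classical in
/-- After the computations of step `t`. -/
structure AfterStep {d : ℕ} (O : Oracles d) (E : EllipsoidMethod d) (ρ : ℝ) (t : ℕ) (s : Store) :
    Prop where
  ready : Ready E ρ s
  cur : CurAddr d (recAddr d t) s
  scale : s.sc d 5 = EllipsoidMethod.growth d ^ t
  recs : ∀ j ≤ t, HasRec O E s (recAddr d j) j
  cont : s.nat 19 = if E.Stops ρ t then 0 else 1

/-- The code of a step may change three temporary scalars and, in the current record, the image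
vector and the inner product. -/
theorem DuringStep.congr {d : ℕ} {O : Oracles d} {E : EllipsoidMethod d} {ρ : ℝ} {t : ℕ}
    {s s' : Store} (h : DuringStep O E ρ t s)
    (hn : ∀ k, k ≤ 8 ∨ 10 ≤ k ∧ k ≤ 13 ∨ 20 ≤ k ∧ k < 36 → 4 ≤ k ∨ k = 0 → s'.nat k = s.nat k)
    (hr : ∀ q, q ≠ 6 + d → q ≠ 7 + d → q ≠ 8 + d →
      ¬ (recAddr d t + d + d ≤ q ∧ q ≤ recAddr d t + d + d + d) → s'.real q = s.real q) :
    DuringStep O E ρ t s' := by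
  have hp := recAddr_le d t
  refine ⟨h.ready.congr (fun k hk => ?_) (fun j hj => ?_), h.cur.congr fun k hk => ?_,
    Eq.trans (hr _ (by omega) (by omega) (by omega) (by omega)) h.scale,
    fun j hj => (h.recs j hj).congr fun q hq hq' => ?_,
    (Store.readVec_congr fun i hi => ?_).trans h.x, (Store.readVec_congr fun i hi => ?_).trans h.g,
    Eq.trans (hr _ (by omega) (by omega) (by omega) (by omega)) h.flag⟩
  · unfold Store.Fixed at hk; exact hn _ (by omega) (by omega)
  · unfold ConstCell at hj; exact hr _ (by omega) (by omega) (by omega) (by omega)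
  · exact hn _ (by omega) (by omega)
  · have := recAddr_add_le (d := d) hj
    have := recAddr_le d j
    exact hr _ (by omega) (by omega) (by omega) (by omega)
  · exact hr _ (by omega) (by omega) (by omega) (by omega)
  · exact hr _ (by omega) (by omega) (by omega) (by omega)

theorem runs_query {d : ℕ} (O : Oracles d) (s : Store) (p : ℕ) (hs : s.Layout d)
    (hc : CurAddr d p s) :
    Runs O .query s (2 * d + 6) fun s' =>
      (∀ k, k ≠ 18 → s'.nat k = s.nat k) ∧
      (∀ q, ¬ (p + d ≤ q ∧ q < p + d + d) → q ≠ p + d + d + d + 1 → s'.real q = s.real q) ∧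
      s'.readVec d (p + d) = O.answer (s.readVec d p) ∧
      s'.real (p + d + d + d + 1) = O.flag (s.readVec d p) := by
  refine (Runs.seq (Runs.instr _ (Runs.ite (T := d + 3) ?_ ?_))).mono
    (by simp only [Instr.cost]; omega) fun s' h => h
  · intro hb
    refine Runs.block_le _ ?_ (by simp [Instr.cost])
    simp only [Instr.apply, Store.loc, hc.x, hc.g] at hb ⊢
    cases h : O.sep (s.readVec d p) with
    -- Impossible here: a rejected point sets the flag to `0`, so the test `1 ≤ flag` fails.
    | some g => simp [Test.holds, h, Store.setNat, Store.writeVec, hs.one] at hb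
    | none =>
      simp only [Store.exec, Instr.apply, Store.loc, Store.setNat, Store.setReal,
        Store.writeVec_nat, Function.update_apply, hc.x, hc.g, hc.flag,
        Nat.reduceEqDiff, if_false, if_true]
      refine ⟨fun k hk => by simp [hk], fun q hq hq' => ?_, ?_, ?_⟩
      · rw [if_neg hq', Store.writeVec_real_of_not _ _ hq]
      · rw [Oracles.answer, h]
        exact (Store.readVec_congr
          (s := (s.setNat 18 1).writeVec (p + d) (O.map (s.readVec d p)))
          fun i hi => Function.update_of_ne (by omega) _ _).trans (Store.readVec_writeVec _ _)
      · simp [Oracles.flag, h]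
  · intro hb
    refine Runs.block_le _ ?_ (by simp [Instr.cost])
    simp only [Instr.apply, Store.loc, hc.x, hc.g] at hb ⊢
    cases h : O.sep (s.readVec d p) with
    | none => simp [Test.holds, h, Store.setNat, hs.one] at hb
    | some g =>
      simp only [Store.exec, Instr.apply, Store.loc, Store.setNat, Store.setReal,
        Store.writeVec_nat, Function.update_apply, hc.flag,
        Nat.reduceEqDiff, if_false]
      refine ⟨fun k hk => by simp [hk], fun q hq hq' => ?_, ?_, ?_⟩
      · rw [if_neg hq', Store.writeVec_real_of_not _ _ hq]
      · rw [Oracles.answer, h]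
        exact (Store.readVec_congr (s := s.writeVec (p + d) g)
          fun i hi => Function.update_of_ne (by omega) _ _).trans (Store.readVec_writeVec _ _)
      · simp [Oracles.flag, h]

/-- Applying the next matrix to the current cut `g t` only requires subtracting a multiple of the
recorded vector `v j`. The matrix itself is never formed. -/
theorem runs_project {d : ℕ} (O : Oracles d) (E : EllipsoidMethod d) (ρ : ℝ) {t j : ℕ}
    (hj : j < t) (s : Store) (hs : DuringStep O E ρ t s) (h9 : s.nat 9 = recAddr d j)
    (hv : s.readVec d (recAddr d t + d + d) = E.Q j (E.g t)) :
    Runs O .project s (40 * (d + 1)) fun s' => DuringStep O E ρ t s' ∧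
      s'.nat 9 = recAddr d (j + 1) ∧ s'.nat 38 = recAddr d (j + 1) + 1 ∧
      s'.readVec d (recAddr d t + d + d) = E.Q (j + 1) (E.g t) := by
  have hp := recAddr_le d j
  have hpt := recAddr_add_le (d := d) hj
  refine Runs.block_seq (T' := 33 * (d + 1)) _ ?_ (by simp [Instr.cost]; omega)
  obtain ⟨s₁, e₁⟩ : ∃ s₁, s₁ = s.exec O
    [.natAdd 14 9 0, .natAdd 15 14 0, .natAdd 16 15 0] := ⟨_, rfl⟩
  rw [← e₁]
  have r₁ : s₁.real = s.real := by rw [e₁]; rfl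
  have n₁ : ∀ k, k < 14 ∨ 16 < k → s₁.nat k = s.nat k := fun k hk => by
    rw [e₁]
    simp only [Store.exec, Instr.apply, Store.setNat, Function.update_apply]
    rw [if_neg (by omega), if_neg (by omega), if_neg (by omega)]
  have n15 : s₁.nat 15 = recAddr d j + d + d := by
    rw [e₁]; simp [Store.exec, Instr.apply, Store.setNat, h9, hs.ready.layout.dim]
  have n16 : s₁.nat 16 = recAddr d j + d + d + d := by
    rw [e₁]; simp [Store.exec, Instr.apply, Store.setNat, h9, hs.ready.layout.dim]
  have d₁ : DuringStep O E ρ t s₁ := hs.congr (fun k hk hk' => n₁ k (by omega)) (by simp [r₁])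
  have v₁ : s₁.readVec d (recAddr d t + d + d) = E.Q j (E.g t) := by
    rw [← hv]; exact Store.readVec_congr fun i _ => by rw [r₁]
  clear e₁
  refine Runs.seq_of (T₂ := 21 * (d + 1)) (runs_dot O s₁ 15 10 d₁.ready.layout (by omega) (by omega)
    (Or.inr (by omega)) (Or.inr (by rw [d₁.cur.g]; omega))) ?_ (by omega)
  rintro s₂ ⟨n₂, r₂, a₂⟩
  have d₂ : DuringStep O E ρ t s₂ := d₁.congr (fun k _ hk' => n₂ k hk')
    (fun q hq hq' _ _ => r₂ q hq hq')
  rw [n15, d₁.cur.g, (d₁.recs j hj).v, d₁.g] at a₂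
  have v₂ : s₂.readVec d (recAddr d t + d + d) = E.Q j (E.g t) := by
    rw [← v₁]; exact Store.readVec_congr fun i _ => r₂ _ (by omega) (by omega)
  refine Runs.block_seq (T' := 17 * (d + 1)) _ ?_ (by simp [Instr.cost]; omega)
  obtain ⟨s₃, e₃⟩ : ∃ s₃, s₃ = s₂.exec O [.realMul (.ind 24) (.ind 27) (.ind 23),
    .realDiv (.ind 24) (.ind 24) (.ind 16), .realSub (.ind 24) (.ind 20) (.ind 24)] := ⟨_, rfl⟩
  rw [← e₃]
  have n₃ : s₃.nat = s₂.nat := by rw [e₃]; rfl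
  have q16 : s₂.nat 16 = recAddr d j + d + d + d := by rw [n₂ _ (by omega), n16]
  have L₂ := d₂.ready.layout
  have q20 : s₂.nat 20 = 4 + d + 0 := L₂.scal 0 (by omega)
  have q23 : s₂.nat 23 = 4 + d + 3 := L₂.scal 3 (by omega)
  have q24 : s₂.nat 24 = 4 + d + 4 := L₂.scal 4 (by omega)
  have q27 : s₂.nat 27 = 4 + d + 7 := L₂.scal 7 (by omega)
  have r₃ : ∀ q, q ≠ 8 + d → s₃.real q = s₂.real q := fun q hq => by
    rw [e₃]
    simp only [Store.exec, Instr.apply, Store.setReal, Store.val, Store.loc,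
      Function.update_apply, q24]
    rw [if_neg (by omega), if_neg (by omega), if_neg (by omega)]
  have c₃ : s₃.sc d 4 = -(2 * EllipsoidMethod.shift d * ⟪E.v j, E.g t⟫ / E.ν j) := by
    have h7 := d₂.ready.c7
    have h0 := d₂.ready.c0
    have hν := (d₂.recs j hj).ν
    simp only [Store.sc] at h7 h0 a₂ ⊢
    rw [e₃]
    simp only [Store.exec, Instr.apply, Store.setReal, Store.val, Store.loc,
      Function.update_apply, q16, q20, q23, q24, q27, if_true]
    rw [if_neg (by omega), if_neg (by omega), if_neg (by omega), h0, h7, a₂, hν, zero_sub]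
  have d₃ : DuringStep O E ρ t s₃ := d₂.congr (fun k _ _ => by rw [n₃]) fun q _ _ hq _ => r₃ q hq
  have v₃ : s₃.readVec d (recAddr d t + d + d) = E.Q j (E.g t) := by
    rw [← v₂]; exact Store.readVec_congr fun i _ => r₃ _ (by omega)
  clear e₃
  have n15' : s₃.nat 15 = recAddr d j + d + d := by rw [n₃, n₂ _ (by omega), n15]
  refine Runs.seq_of (T₂ := 5) (runs_linComb O s₃ 1 4 11 15 d₃.ready.layout (by omega) (by omega)
    (by omega) (by omega) (Or.inr (by rw [d₃.cur.v]; omega)) (Or.inr (by omega))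
    (by rw [d₃.cur.v, n15']; omega)) ?_ (by omega)
  rintro s₄ ⟨n₄, r₄, v₄⟩
  rw [d₃.cur.v] at r₄ v₄
  rw [n15', d₃.ready.c1, c₃, v₃, (d₃.recs j hj).v, one_smul, neg_smul, ← sub_eq_add_neg,
    ← EllipsoidMethod.Q_succ] at v₄
  have d₄ : DuringStep O E ρ t s₄ := d₃.congr (fun k _ hk' => n₄ k hk')
    (fun q hq _ _ hq' => r₄ q hq (by omega))
  refine Runs.block_le _ ?_ (by simp [Instr.cost])
  have L₄ := d₄.ready.layout
  have h9' : s₄.nat 9 = recAddr d j := by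
    rw [n₄ _ (by omega), n₃, n₂ _ (by omega), n₁ _ (by omega), h9]
  refine ⟨d₄.congr (fun k hk hk' => ?_) fun q _ _ _ _ => rfl, ?_, ?_, v₄⟩
  · simp only [Store.exec, Instr.apply, Store.setNat, Function.update_apply]
    rw [if_neg (by omega), if_neg (by omega)]
  · simp [Store.exec, Instr.apply, Store.setNat, L₄.stride, h9', recAddr_succ]
  · simp [Store.exec, Instr.apply, Store.setNat, L₄.stride, L₄.one, h9', recAddr_succ]

open Classical in
theorem runs_compute {d : ℕ} (O : Oracles d) (E : EllipsoidMethod d) (hE : E.cut = O.answer)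
    (ρ : ℝ) {t : ℕ} (s : Store) (hs : BeforeStep O E ρ t s) :
    Runs O .compute s (80 * ((t + 1) * (d + 1))) (AfterStep O E ρ t) := by
  have hp := recAddr_le d t
  set p := recAddr d t with hpdef
  -- The first summand pays for replaying the `t` former cuts, the second for everything else.
  have hT : 80 * ((t + 1) * (d + 1)) = t * (80 * (d + 1)) + 80 * (d + 1) := by ring
  rw [hT]
  refine Runs.block_seq (T' := t * (80 * (d + 1)) + 75 * (d + 1)) _ ?_
    (by simp [Instr.cost]; omega)
  obtain ⟨s₁, e₁⟩ : ∃ s₁, s₁ = s.exec O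
    [.natAdd 10 8 0, .natAdd 11 10 0, .natAdd 12 11 0, .natAdd 13 12 4] := ⟨_, rfl⟩
  rw [← e₁]
  have r₁ : s₁.real = s.real := by rw [e₁]; rfl
  have n₁ : ∀ k, k < 10 ∨ 13 < k → s₁.nat k = s.nat k := fun k hk => by
    rw [e₁]
    simp only [Store.exec, Instr.apply, Store.setNat, Function.update_apply]
    rw [if_neg (by omega), if_neg (by omega), if_neg (by omega), if_neg (by omega)]
  have c₁ : CurAddr d p s₁ := by
    have h0 := hs.ready.layout.dim
    have h4 := hs.ready.layout.one
    have h8 := hs.cur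
    constructor <;> rw [e₁] <;> simp [Store.exec, Instr.apply, Store.setNat, h0, h4, h8, hpdef]
  have R₁ : Ready E ρ s₁ := hs.ready.congr
    (fun k hk => n₁ k (by unfold Store.Fixed at hk; omega)) (by simp [r₁])
  have x₁ : s₁.readVec d p = E.x t := by
    rw [← hs.x]; exact Store.readVec_congr fun i _ => by rw [r₁]
  clear e₁
  refine Runs.seq_of (T₂ := t * (80 * (d + 1)) + 69 * (d + 1)) (runs_query O s₁ p R₁.layout c₁) ?_
    (by omega)
  rintro s₂ ⟨n₂, r₂, g₂, f₂⟩
  rw [x₁] at g₂ f₂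
  have d₂ : DuringStep O E ρ t s₂ := by
    refine ⟨R₁.congr (fun k hk => n₂ k ?_) fun j hj => r₂ _ ?_ ?_, c₁.congr fun k hk => n₂ k ?_, ?_,
      fun j hj => (hs.recs j hj).congr fun q hq hq' => ?_,
      (Store.readVec_congr fun i hi => r₂ _ ?_ ?_).trans x₁, ?_, f₂⟩
    · unfold Store.Fixed at hk; omega
    · unfold ConstCell at hj; omega
    · unfold ConstCell at hj; omega
    · omega
    · refine Eq.trans (r₂ _ (by omega) (by omega)) ?_
      rw [r₁]; exact hs.scale
    · have := recAddr_add_le (d := d) hj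
      rw [r₂ _ (by omega) (by omega), r₁]
    · omega
    · omega
    · rw [g₂, EllipsoidMethod.g, hE]
  refine Runs.seq_of (T₂ := t * (80 * (d + 1)) + 57 * (d + 1))
    (runs_linComb O s₂ 0 10 11 10 d₂.ready.layout (by omega) (by omega)
    (by omega) (by omega) (Or.inr (by rw [d₂.cur.v]; omega)) (Or.inr (by rw [d₂.cur.g]; omega))
    (by rw [d₂.cur.v, d₂.cur.g]; omega)) ?_ (by omega)
  rintro s₃ ⟨n₃, r₃, v₃⟩
  rw [d₂.cur.v] at r₃ v₃
  -- The replay starts from the initial ball, whose matrix is `R²` times the identity.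
  rw [d₂.cur.g, d₂.ready.c0, d₂.ready.c10, d₂.g, zero_smul, zero_add,
    ← EllipsoidMethod.Q_zero] at v₃
  have d₃ : DuringStep O E ρ t s₃ := d₂.congr (fun k _ hk' => n₃ k hk')
    (fun q hq _ _ hq' => r₃ q hq (by omega))
  refine Runs.block_seq (T' := t * (80 * (d + 1)) + 54 * (d + 1)) _ ?_
    (by simp [Instr.cost]; omega)
  obtain ⟨s₄, e₄⟩ : ∃ s₄, s₄ = s₃.exec O [.natAdd 9 7 5, .natAdd 38 9 4] := ⟨_, rfl⟩
  rw [← e₄]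
  have L₃ := d₃.ready.layout
  have r₄ : s₄.real = s₃.real := by rw [e₄]; rfl
  have d₄ : DuringStep O E ρ t s₄ := d₃.congr (fun k hk hk' => by
    rw [e₄]
    simp only [Store.exec, Instr.apply, Store.setNat, Function.update_apply]
    rw [if_neg (by omega), if_neg (by omega)]) (by simp [r₄])
  have h9 : s₄.nat 9 = recAddr d 0 := by
    rw [e₄]; simp [Store.exec, Instr.apply, Store.setNat, L₃.base, L₃.zero, recAddr_zero]
  have h38 : s₄.nat 38 = recAddr d 0 + 1 := by
    rw [e₄]
    simp [Store.exec, Instr.apply, Store.setNat, L₃.base, L₃.zero, L₃.one, recAddr_zero]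
  have v₄ : s₄.readVec d (p + d + d) = E.Q 0 (E.g t) := by
    rw [← v₃]; exact Store.readVec_congr fun i _ => by rw [r₄]
  clear e₄
  -- After `j` rounds the vector is `Q j` applied to `g t`. Register `38` holds the pointer plus
  -- one, which turns the test `≤` into a strict comparison with the address of the current record.
  refine Runs.seq_of (T₂ := 53 * (d + 1)) (Runs.loop (T := 40 * (d + 1)) (n := t)
    (fun j s' => DuringStep O E ρ t s' ∧
      s'.nat 9 = recAddr d j ∧ s'.nat 38 = recAddr d j + 1 ∧
      s'.readVec d (p + d + d) = E.Q j (E.g t)) ⟨d₄, h9, h38, v₄⟩ ?_ (Q := fun s' =>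
        DuringStep O E ρ t s' ∧ s'.readVec d (p + d + d) = E.v t) ?_) ?_ ?_
  · rintro j hj s' ⟨h1, h2, h3, h4⟩
    refine ⟨?_, runs_project O E ρ hj s' h1 h2 h4⟩
    have := recAddr_add_le (d := d) hj
    simp only [Test.holds, h1.cur.x, h3]
    omega
  · rintro s' ⟨h1, h2, h3, h4⟩
    refine ⟨?_, h1, h4⟩
    simp only [Test.holds, h1.cur.x, h3]
    omega
  · rintro s₅ ⟨d₅, v₅⟩
    refine Runs.seq_of (T₂ := 41 * (d + 1)) (runs_dot O s₅ 10 11 d₅.ready.layout (by omega)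
      (by omega) (Or.inr (by rw [d₅.cur.g]; omega)) (Or.inr (by rw [d₅.cur.v]; omega))) ?_
      (by omega)
    rintro s₆ ⟨n₆, r₆, a₆⟩
    rw [d₅.cur.g, d₅.cur.v, d₅.g, v₅] at a₆
    have d₆ : DuringStep O E ρ t s₆ := d₅.congr (fun k _ hk' => n₆ k hk')
      (fun q hq hq' _ _ => r₆ q hq hq')
    have v₆ : s₆.readVec d (p + d + d) = E.v t := by
      rw [← v₅]; exact Store.readVec_congr fun i _ => r₆ _ (by omega) (by omega)
    refine Runs.block_seq (T' := 39 * (d + 1)) _ ?_ (by simp [Instr.cost]; omega)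
    obtain ⟨s₇, e₇⟩ : ∃ s₇, s₇ = s₆.exec O [.realAdd (.ind 12) (.ind 23) (.ind 20)] := ⟨_, rfl⟩
    rw [← e₇]
    have L₆ := d₆.ready.layout
    have q20 : s₆.nat 20 = 4 + d + 0 := L₆.scal 0 (by omega)
    have q23 : s₆.nat 23 = 4 + d + 3 := L₆.scal 3 (by omega)
    have r₇ : ∀ q, q ≠ p + d + d + d → s₇.real q = s₆.real q := fun q hq => by
      rw [e₇]
      simp only [Store.exec, Instr.apply, Store.setReal, Store.loc, d₆.cur.ν]
      exact Function.update_of_ne hq _ _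
    have ν₇ : s₇.real (p + d + d + d) = E.ν t := by
      have h0 := d₆.ready.c0
      simp only [Store.sc] at h0 a₆
      rw [e₇]
      simp only [Store.exec, Instr.apply, Store.setReal, Store.val, Store.loc, d₆.cur.ν, q20, q23]
      rw [Function.update_self, h0, a₆, add_zero]
      rfl
    have d₇ : DuringStep O E ρ t s₇ := d₆.congr (fun k _ hk' => by rw [e₇]; rfl)
      (fun q _ _ _ hq => r₇ q (by omega))
    have v₇ : s₇.readVec d (p + d + d) = E.v t := by
      rw [← v₆]; exact Store.readVec_congr fun i hi => r₇ _ (by omega)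
    clear e₇
    refine Runs.seq_of (T₂ := 27 * (d + 1)) (runs_dot O s₇ 10 10 d₇.ready.layout (by omega)
      (by omega) (Or.inr (by rw [d₇.cur.g]; omega)) (Or.inr (by rw [d₇.cur.g]; omega))) ?_
      (by omega)
    rintro s₈ ⟨n₈, r₈, a₈⟩
    rw [d₇.cur.g, d₇.g] at a₈
    have d₈ : DuringStep O E ρ t s₈ := d₇.congr (fun k _ hk' => n₈ k hk')
      (fun q hq hq' _ _ => r₈ q hq hq')
    have v₈ : s₈.readVec d (p + d + d) = E.v t := by
      rw [← v₇]; exact Store.readVec_congr fun i _ => r₈ _ (by omega) (by omega)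
    have ν₈ : s₈.real (p + d + d + d) = E.ν t := by rw [r₈ _ (by omega) (by omega), ν₇]
    refine Runs.block_seq (T' := 24 * (d + 1)) _ ?_ (by simp [Instr.cost]; omega)
    obtain ⟨s₉, e₉⟩ : ∃ s₉, s₉ = s₈.exec O [.realMul (.ind 24) (.ind 25) (.ind 12),
      .realMul (.ind 23) (.ind 29) (.ind 23)] := ⟨_, rfl⟩
    rw [← e₉]
    have L₈ := d₈.ready.layout
    have q23 : s₈.nat 23 = 4 + d + 3 := L₈.scal 3 (by omega)
    have q24 : s₈.nat 24 = 4 + d + 4 := L₈.scal 4 (by omega)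
    have q25 : s₈.nat 25 = 4 + d + 5 := L₈.scal 5 (by omega)
    have q29 : s₈.nat 29 = 4 + d + 9 := L₈.scal 9 (by omega)
    have r₉ : ∀ q, q ≠ 7 + d → q ≠ 8 + d → s₉.real q = s₈.real q := fun q hq hq' => by
      rw [e₉]
      simp only [Store.exec, Instr.apply, Store.setReal, Store.val, Store.loc,
        Function.update_apply, q23, q24]
      rw [if_neg (by omega), if_neg (by omega)]
    have n₉ : s₉.nat = s₈.nat := by rw [e₉]; rfl
    have h9 := d₈.ready.c9
    have h5 := d₈.scale
    simp only [Store.sc] at h9 h5 a₈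
    have u₄ : s₉.real (4 + d + 4) = EllipsoidMethod.growth d ^ t * E.ν t := by
      rw [e₉]
      simp only [Store.exec, Instr.apply, Store.setReal, Store.val, Store.loc,
        Function.update_apply, q23, q24, q25, d₈.cur.ν, if_true]
      rw [if_neg (by omega), h5, ← hpdef, ν₈]
    have u₃ : s₉.real (4 + d + 3) = ρ * ρ * ⟪E.g t, E.g t⟫ := by
      rw [e₉]
      simp only [Store.exec, Instr.apply, Store.setReal, Store.val, Store.loc,
        Function.update_apply, q23, q24, q29, if_true]
      rw [if_neg (by omega), if_neg (by omega), a₈, h9]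
    have d₉ : DuringStep O E ρ t s₉ := d₈.congr (fun k _ _ => by rw [n₉])
      (fun q _ hq hq' _ => r₉ q hq hq')
    have rec₉ : HasRec O E s₉ p t := by
      refine ⟨d₉.x, d₉.g, ?_, ?_, d₉.flag⟩
      · rw [← v₈]; exact Store.readVec_congr fun i _ => r₉ _ (by omega) (by omega)
      · rw [r₉ _ (by omega) (by omega), ν₈]
    have htest : (Test.realLe (.ind 24) (.ind 23)).holds s₉ ↔ E.Stops ρ t := by
      simp only [Test.holds, Store.val, Store.loc, n₉, q23, q24, u₃, u₄]
      rfl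
    have hfin : ∀ b : ℕ, b = (if E.Stops ρ t then 0 else 1) →
        AfterStep O E ρ t (s₉.setNat 19 b) := fun b hb => by
      have d' : DuringStep O E ρ t (s₉.setNat 19 b) := d₉.congr
        (fun k hk _ => Function.update_of_ne (by omega) _ _) fun q _ _ _ _ => rfl
      refine ⟨d'.ready, d'.cur, d'.scale, fun j hj => ?_, ?_⟩
      · rcases hj.lt_or_eq with h | rfl
        · exact d'.recs j h
        · exact rec₉.congr fun q _ _ => rfl
      · exact (Function.update_self 19 b s₉.nat).trans hb
    refine (Runs.ite (T := 2) (fun h => Runs.block_le _ (hfin 0 ?_) (by simp [Instr.cost]))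
      (fun h => Runs.block_le _ (hfin 1 ?_) (by simp [Instr.cost]))).mono (by omega) fun _ h => h
    · rw [if_pos (htest.1 h)]
    · rw [if_neg fun h' => h (htest.2 h')]
  · have : t * (40 * (d + 1) + 1) ≤ t * (80 * (d + 1)) := by gcongr; omega
    omega

theorem runs_advance {d : ℕ} (O : Oracles d) (E : EllipsoidMethod d) (ρ : ℝ) {t : ℕ} (s : Store)
    (hs : AfterStep O E ρ t s) :
    Runs O .advance s (40 * (d + 1)) (BeforeStep O E ρ (t + 1)) := by
  have hp := recAddr_le d t
  have hp' := recAddr_succ d t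
  set p := recAddr d t with hpdef
  set p' := recAddr d (t + 1) with hpdef'
  refine Runs.block_seq (T' := 38 * (d + 1)) _ ?_ (by simp [Instr.cost]; omega)
  obtain ⟨s₁, e₁⟩ : ∃ s₁, s₁ = s.exec O [.natAdd 39 8 6] := ⟨_, rfl⟩
  rw [← e₁]
  have n₁ : ∀ k, k ≠ 39 → s₁.nat k = s.nat k := fun k hk => by
    rw [e₁]; exact Function.update_of_ne hk _ _
  have h39 : s₁.nat 39 = p' := by
    rw [e₁, hp', hpdef]
    simp [Store.exec, Instr.apply, Store.setNat, hs.ready.layout.stride, hs.cur.x]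
  have r₁ : s₁.real = s.real := by rw [e₁]; rfl
  clear e₁
  have R₁ : Ready E ρ s₁ := hs.ready.congr
    (fun k hk => n₁ k (by unfold Store.Fixed at hk; omega)) (by simp [r₁])
  have c₁ : CurAddr d p s₁ := hs.cur.congr fun k hk => n₁ k (by omega)
  have rec₁ : ∀ j ≤ t, HasRec O E s₁ (recAddr d j) j := fun j hj =>
    (hs.recs j hj).congr fun q _ _ => by rw [r₁]
  have hrec : ∀ j ≤ t, recAddr d j + (3 * d + 2) ≤ p' := fun j hj =>
    recAddr_add_le (by omega)
  have a₁ : s₁.sc d 5 = EllipsoidMethod.growth d ^ t := by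
    rw [← hs.scale]; unfold Store.sc; rw [r₁]
  refine Runs.seq_of (T₂ := 26 * (d + 1)) (runs_linComb O s₁ 0 1 39 8 R₁.layout (by omega)
    (by omega) (by omega) (by omega) (Or.inr (by omega)) (Or.inr (by rw [c₁.x]; omega))
    (by rw [c₁.x, h39]; omega)) ?_ (by omega)
  rintro s₂ ⟨n₂, r₂, v₂⟩
  rw [h39] at r₂ v₂
  -- The coefficients `0` and `1` copy the old centre into the next record. The displacement is
  -- added afterwards.
  rw [c₁.x, R₁.c0, R₁.c1, (rec₁ t le_rfl).x, zero_smul, zero_add, one_smul] at v₂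
  have R₂ : Ready E ρ s₂ := R₁.congr
    (fun k hk => n₂ k (by unfold Store.Fixed at hk; omega))
    (fun j hj => r₂ _ (by unfold ConstCell at hj; omega) (by unfold ConstCell at hj; omega))
  have c₂ : CurAddr d p s₂ := c₁.congr fun k hk => n₂ k (by omega)
  have rec₂ : ∀ j ≤ t, HasRec O E s₂ (recAddr d j) j := fun j hj =>
    (rec₁ j hj).congr fun q hq hq' => by
      have := hrec j hj
      have := recAddr_le d j
      exact r₂ _ (by omega) (by omega)
  have a₂ : s₂.sc d 5 = EllipsoidMethod.growth d ^ t := by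
    rw [← a₁]; exact r₂ _ (by omega) (by omega)
  refine Runs.block_seq (T' := 21 * (d + 1)) _ ?_ (by simp [Instr.cost]; omega)
  obtain ⟨s₃, e₃⟩ : ∃ s₃, s₃ = s₂.exec O [.realDiv (.ind 24) (.ind 25) (.ind 12),
    .realSqrt (.ind 24) (.ind 24), .realMul (.ind 24) (.ind 26) (.ind 24),
    .realSub (.ind 24) (.ind 20) (.ind 24)] := ⟨_, rfl⟩
  rw [← e₃]
  have L₂ := R₂.layout
  have q20 : s₂.nat 20 = 4 + d + 0 := L₂.scal 0 (by omega)
  have q24 : s₂.nat 24 = 4 + d + 4 := L₂.scal 4 (by omega)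
  have q25 : s₂.nat 25 = 4 + d + 5 := L₂.scal 5 (by omega)
  have q26 : s₂.nat 26 = 4 + d + 6 := L₂.scal 6 (by omega)
  have n₃ : s₃.nat = s₂.nat := by rw [e₃]; rfl
  have r₃ : ∀ q, q ≠ 8 + d → s₃.real q = s₂.real q := fun q hq => by
    rw [e₃]
    simp only [Store.exec, Instr.apply, Store.setReal, Store.val, Store.loc,
      Function.update_apply, q24]
    rw [if_neg (by omega), if_neg (by omega), if_neg (by omega), if_neg (by omega)]
  have u₃ : s₃.sc d 4
      = -(EllipsoidMethod.shift d * √(EllipsoidMethod.growth d ^ t / E.ν t)) := by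
    have h0 := R₂.c0
    have h6 := R₂.c6
    have hν := (rec₂ t le_rfl).ν
    simp only [Store.sc] at h0 h6 a₂ ⊢
    rw [e₃]
    simp only [Store.exec, Instr.apply, Store.setReal, Store.val, Store.loc,
      Function.update_apply, q20, q24, q25, q26, c₂.ν, if_true]
    rw [if_neg (by omega), if_neg (by omega), if_neg (by omega), if_neg (by omega),
      if_neg (by omega), h0, h6, a₂, hpdef, hν, zero_sub]
  clear e₃
  have R₃ : Ready E ρ s₃ := R₂.congr (fun k _ => by rw [n₃])
    (fun j hj => r₃ _ (by unfold ConstCell at hj; omega))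
  have c₃ : CurAddr d p s₃ := c₂.congr fun k _ => by rw [n₃]
  have rec₃ : ∀ j ≤ t, HasRec O E s₃ (recAddr d j) j := fun j hj =>
    (rec₂ j hj).congr fun q hq hq' => by
      have := recAddr_le d j
      exact r₃ _ (by omega)
  have a₃ : s₃.sc d 5 = EllipsoidMethod.growth d ^ t := by
    rw [← a₂]; exact r₃ _ (by omega)
  have v₃ : s₃.readVec d p' = E.x t := by
    rw [← v₂]; exact Store.readVec_congr fun i _ => r₃ _ (by omega)
  have h39' : s₃.nat 39 = p' := by rw [n₃, n₂ _ (by omega), h39]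
  refine Runs.seq_of (T₂ := 9 * (d + 1)) (runs_linComb O s₃ 1 4 39 11 R₃.layout (by omega)
    (by omega) (by omega) (by omega) (Or.inr (by omega)) (Or.inr (by rw [c₃.v]; omega))
    (by rw [c₃.v, h39']; omega)) ?_ (by omega)
  rintro s₄ ⟨n₄, r₄, v₄⟩
  rw [h39'] at r₄ v₄
  rw [c₃.v, R₃.c1, u₃, v₃, (rec₃ t le_rfl).v, one_smul, neg_smul, ← sub_eq_add_neg,
    ← EllipsoidMethod.x_succ] at v₄
  have R₄ : Ready E ρ s₄ := R₃.congr
    (fun k hk => n₄ k (by unfold Store.Fixed at hk; omega))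
    (fun j hj => r₄ _ (by unfold ConstCell at hj; omega) (by unfold ConstCell at hj; omega))
  have rec₄ : ∀ j ≤ t, HasRec O E s₄ (recAddr d j) j := fun j hj =>
    (rec₃ j hj).congr fun q hq hq' => by
      have := hrec j hj
      have := recAddr_le d j
      exact r₄ _ (by omega) (by omega)
  have a₄ : s₄.sc d 5 = EllipsoidMethod.growth d ^ t := by
    rw [← a₃]; exact r₄ _ (by omega) (by omega)
  have h8 : s₄.nat 8 = p := by rw [n₄ _ (by omega), c₃.x]
  refine Runs.block_le _ ?_ (by simp [Instr.cost]; omega)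
  obtain ⟨s₅, e₅⟩ : ∃ s₅, s₅ = s₄.exec O
    [.realMul (.ind 25) (.ind 25) (.ind 28), .natAdd 8 8 6] := ⟨_, rfl⟩
  rw [← e₅]
  have L₄ := R₄.layout
  have q25 : s₄.nat 25 = 4 + d + 5 := L₄.scal 5 (by omega)
  have q28 : s₄.nat 28 = 4 + d + 8 := L₄.scal 8 (by omega)
  have n₅ : ∀ k, k ≠ 8 → s₅.nat k = s₄.nat k := fun k hk => by
    rw [e₅]; exact Function.update_of_ne hk _ _
  have r₅ : ∀ q, q ≠ 9 + d → s₅.real q = s₄.real q := fun q hq => by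
    rw [e₅]
    simp only [Store.exec, Instr.apply, Store.setReal, Store.setNat, Store.loc, q25]
    exact Function.update_of_ne (by omega) _ _
  refine ⟨R₄.congr (fun k hk => n₅ k (by unfold Store.Fixed at hk; omega))
    (fun j hj => r₅ _ (by unfold ConstCell at hj; omega)), ?_, ?_,
    fun j hj => (rec₄ j (by omega)).congr fun q hq _ => ?_, ?_⟩
  · rw [e₅, ← hpdef', hp']; simp [Store.exec, Instr.apply, Store.setNat, Store.setReal, h8,
      L₄.stride]
  · have h8' := R₄.c8
    simp only [Store.sc] at h8' a₄ ⊢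
    rw [e₅]
    simp only [Store.exec, Instr.apply, Store.setReal, Store.setNat, Store.val, Store.loc, q25, q28]
    rw [Function.update_self, a₄, h8', pow_succ]
  · have := recAddr_le d j
    exact r₅ _ (by omega)
  · rw [← v₄]
    exact Store.readVec_congr fun i hi => r₅ _ (by omega)

/-! ### The cutting phase and the backward phase -/

namespace Prog

/-- The cutting phase. -/
def forward : Prog := .seq compute (.loop (.natLe 4 19) (.seq advance compute))

/-- One step of the backward phase, first part: the weight of one cut. -/
def weigh : Prog :=
  .seq (.block [.natSub 9 9 6, .natAdd 14 9 0, .natAdd 15 14 0, .natAdd 16 15 0, .natAdd 17 16 4]) <|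
  .seq (.dot 36 15) <|
  .seq (.ite (.realLe (.ind 23) (.ind 20)) (.block [.realConst (.ind 23) 0]) (.block [])) <|
  .block [.realDiv (.ind 24) (.ind 23) (.ind 16), .realSub (.ind 23) (.ind 20) (.ind 24)]

/-- One step of the backward phase, second part: use the weight. -/
def unwind : Prog :=
  .seq (.linComb 1 3 36 14) <|
  .seq (.block [.realMul (.ind 24) (.ind 24) (.ind 17), .realAdd (.ind 31) (.ind 31) (.ind 24)])
    (.linComb 1 4 37 9)

/-- Begin the backward phase. -/
def turn : Prog :=
  .seq (.block [.natAdd 36 8 6, .natAdd 37 36 0, .natAdd 9 8 5, .natAdd 38 7 4,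
    .realAdd (.ind 24) (.ind 13) (.ind 20), .realAdd (.ind 31) (.ind 13) (.ind 20)]) <|
  .seq (.linComb 0 12 36 10) (.linComb 0 4 37 8)

/-- Normalize the weighted sum of the query points and write the output. -/
def finish : Prog :=
  .seq (.block [.realDiv (.ind 24) (.ind 21) (.ind 31), .natConst 36 0]) (.linComb 0 4 36 37)

/-- The backward phase. -/
def backward : Prog := .seq turn (.seq (.loop (.natLe 38 9) (.seq weigh unwind)) finish)

end Prog

/-- Step `i` replays `i` former cuts at a cost linear in `d`, whence the square of `t + 1`. -/
theorem runs_forward {d : ℕ} (O : Oracles d) (E : EllipsoidMethod d) (hE : E.cut = O.answer)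
    (ρ : ℝ) {t : ℕ} (hs : ∀ i < t, ¬ E.Stops ρ i) (ht : E.Stops ρ t) (s : Store)
    (h : BeforeStep O E ρ 0 s) :
    Runs O .forward s (300 * ((t + 1) * (t + 1) * (d + 1))) (AfterStep O E ρ t) := by
  have hT : 80 * ((0 + 1) * (d + 1)) + (t * (200 * ((t + 1) * (d + 1)) + 1) + 1)
      ≤ 300 * ((t + 1) * (t + 1) * (d + 1)) := by nlinarith
  refine Runs.seq_of (runs_compute O E hE ρ s h) (fun s₁ h₁ =>
    Runs.loop (T := 200 * ((t + 1) * (d + 1))) (AfterStep O E ρ) t h₁ ?_ ?_) hT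
  · intro i hi s' h'
    refine ⟨by simp [Test.holds, h'.cont, hs i hi, h'.ready.layout.one], ?_⟩
    refine Runs.seq_of (runs_advance O E ρ s' h') (runs_compute O E hE ρ) ?_
    have : (i + 1 + 1) * (d + 1) ≤ (t + 1) * (d + 1) := by gcongr; omega
    nlinarith
  · intro s' h'
    exact ⟨by simp [Test.holds, h'.cont, ht, h'.ready.layout.one], h'⟩

/-- What stays fixed in memory during the backward phase from step `t`. -/
structure BackBase {d : ℕ} (O : Oracles d) (E : EllipsoidMethod d) (ρ : ℝ) (t : ℕ) (s : Store) :
    Prop where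
  ready : Ready E ρ s
  recs : ∀ j ≤ t, HasRec O E s (recAddr d j) j
  h : s.nat 36 = recAddr d (t + 1)
  m : s.nat 37 = recAddr d (t + 1) + d
  limit : s.nat 38 = recAddr d 0 + 1

/-- The backward phase only writes temporary scalars, the total weight in cell `15 + d`, and cells
behind the last record, where the functional and the weighted sum are kept. -/
theorem BackBase.congr {d : ℕ} {O : Oracles d} {E : EllipsoidMethod d} {ρ : ℝ} {t : ℕ}
    {s s' : Store} (h : BackBase O E ρ t s)
    (hn : ∀ k, k ≠ 9 → ¬ (14 ≤ k ∧ k ≤ 17) → 4 ≤ k ∨ k = 0 → s'.nat k = s.nat k)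
    (hr : ∀ q, q ≠ 6 + d → q ≠ 7 + d → q ≠ 8 + d → q ≠ 15 + d →
      q < recAddr d (t + 1) → s'.real q = s.real q) : BackBase O E ρ t s' := by
  have hp := recAddr_le d (t + 1)
  refine ⟨h.ready.congr (fun k hk => ?_) (fun j hj => ?_),
    fun j hj => (h.recs j hj).congr fun q hq hq' => ?_,
    (hn _ (by omega) (by omega) (by omega)).trans h.h,
    (hn _ (by omega) (by omega) (by omega)).trans h.m,
    (hn _ (by omega) (by omega) (by omega)).trans h.limit⟩
  · unfold Store.Fixed at hk; exact hn _ (by omega) (by omega) (by omega)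
  · unfold ConstCell at hj; exact hr _ (by omega) (by omega) (by omega) (by omega) (by omega)
  · have := recAddr_add_le (d := d) (show j < t + 1 by omega)
    have := recAddr_le d j
    exact hr _ (by omega) (by omega) (by omega) (by omega) (by omega)

/-- The total weight of the query points in the domain, over the last `i + 1` steps. -/
noncomputable def partialWeight {d : ℕ} (O : Oracles d) (E : EllipsoidMethod d) (t i : ℕ) : ℝ :=
  ∑ k ∈ Finset.range (i + 1), E.weight t k * O.flag (E.x (t - k))

/-- The weighted sum of the query points in the domain, over the last `i + 1` steps. -/
noncomputable def partialSum {d : ℕ} (O : Oracles d) (E : EllipsoidMethod d) (t i : ℕ) : Euc d :=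
  ∑ k ∈ Finset.range (i + 1), (E.weight t k * O.flag (E.x (t - k))) • E.x (t - k)

/-- After `i` steps of the backward phase from step `t`. -/
structure BackStep {d : ℕ} (O : Oracles d) (E : EllipsoidMethod d) (ρ : ℝ) (t i : ℕ) (s : Store) :
    Prop extends BackBase O E ρ t s where
  ptr : s.nat 9 = recAddr d (t - i)
  dual : s.readVec d (recAddr d (t + 1)) = E.dual t i
  weight : s.sc d 11 = partialWeight O E t i
  sum : s.readVec d (recAddr d (t + 1) + d) = partialSum O E t i

/-- The last step has weight `1`, so the total weight starts at its flag and the weighted sum at the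
flag times the last query point. -/
theorem runs_turn {d : ℕ} (O : Oracles d) (E : EllipsoidMethod d) (ρ : ℝ) {t : ℕ} (s : Store)
    (hs : AfterStep O E ρ t s) : Runs O .turn s (40 * (d + 1)) (BackStep O E ρ t 0) := by
  have hp := recAddr_le d t
  have hp' := recAddr_succ d t
  refine Runs.block_seq (T' := 30 * (d + 1)) _ ?_ (by simp [Instr.cost]; omega)
  obtain ⟨s₁, e₁⟩ : ∃ s₁, s₁ = s.exec O [.natAdd 36 8 6, .natAdd 37 36 0, .natAdd 9 8 5,
    .natAdd 38 7 4, .realAdd (.ind 24) (.ind 13) (.ind 20),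
    .realAdd (.ind 31) (.ind 13) (.ind 20)] := ⟨_, rfl⟩
  rw [← e₁]
  have L := hs.ready.layout
  have q20 : s.nat 20 = 4 + d + 0 := L.scal 0 (by omega)
  have q24 : s.nat 24 = 4 + d + 4 := L.scal 4 (by omega)
  have q31 : s.nat 31 = 4 + d + 11 := L.scal 11 (by omega)
  have n₁ : ∀ k, k ≠ 36 → k ≠ 37 → k ≠ 9 → k ≠ 38 → s₁.nat k = s.nat k := fun k h1 h2 h3 h4 => by
    rw [e₁]
    simp only [Store.exec, Instr.apply, Store.setNat, Store.setReal, Function.update_apply]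
    rw [if_neg h4, if_neg h3, if_neg h2, if_neg h1]
  have r₁ : ∀ q, q ≠ 8 + d → q ≠ 15 + d → s₁.real q = s.real q := fun q hq hq' => by
    rw [e₁]
    simp [Store.exec, Instr.apply, Store.setNat, Store.setReal, Store.loc,
      Function.update_apply, q24, q31]
    rw [if_neg (by omega), if_neg (by omega)]
  have h0 : s.real (4 + d) = 0 := hs.ready.c0
  have hf := (hs.recs t le_rfl).flag
  have h13 := hs.cur.flag
  have w₁ : s₁.sc d 11 = O.flag (E.x t) := by
    rw [e₁]
    simp [Store.sc, Store.exec, Instr.apply, Store.setNat, Store.setReal, Store.val, Store.loc,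
      Function.update_apply, q24, q31, q20, h13]
    simp [hf, h0]
  have u₁ : s₁.sc d 4 = O.flag (E.x t) := by
    rw [e₁]
    simp [Store.sc, Store.exec, Instr.apply, Store.setNat, Store.setReal, Store.val, Store.loc,
      Function.update_apply, q24, q31, q20, h13]
    rw [hf, h0, add_zero]
  have b₁ : BackBase O E ρ t s₁ := by
    refine ⟨hs.ready.congr (fun k hk => ?_) (fun j hj => ?_),
      fun j hj => (hs.recs j hj).congr fun q hq hq' => ?_, ?_, ?_, ?_⟩
    · unfold Store.Fixed at hk; exact n₁ k (by omega) (by omega) (by omega) (by omega)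
    · unfold ConstCell at hj; exact r₁ _ (by omega) (by omega)
    · have := recAddr_le d j
      exact r₁ _ (by omega) (by omega)
    · rw [e₁, hp']
      simp [Store.exec, Instr.apply, Store.setNat, Store.setReal, hs.cur.x, L.stride]
    · rw [e₁, hp']
      simp [Store.exec, Instr.apply, Store.setNat, Store.setReal, hs.cur.x, L.stride, L.dim]
    · rw [e₁, recAddr_zero]
      simp [Store.exec, Instr.apply, Store.setNat, Store.setReal, L.base, L.one]
  have h9 : s₁.nat 9 = recAddr d t := by
    rw [e₁]
    simp [Store.exec, Instr.apply, Store.setNat, Store.setReal, hs.cur.x, L.zero]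
  have c₁ : CurAddr d (recAddr d t) s₁ :=
    hs.cur.congr fun k hk => n₁ k (by omega) (by omega) (by omega) (by omega)
  clear e₁
  refine Runs.seq_of (T₂ := 12 * (d + 1)) (runs_linComb O s₁ 0 12 36 10 b₁.ready.layout (by omega)
    (by omega) (by omega) (by omega) (Or.inr (by rw [b₁.h]; omega))
    (Or.inr (by rw [c₁.g]; omega)) (by rw [c₁.g, b₁.h]; omega)) ?_ (by omega)
  rintro s₂ ⟨n₂, r₂, v₂⟩
  rw [b₁.h] at r₂ v₂
  rw [c₁.g, b₁.ready.c0, b₁.ready.c12, (b₁.recs t le_rfl).g, zero_smul, zero_add, neg_one_smul,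
    ← EllipsoidMethod.dual_zero] at v₂
  have b₂ : BackBase O E ρ t s₂ := b₁.congr (fun k _ _ hk => n₂ k hk)
    (fun q hq _ _ _ hq' => r₂ q hq (by omega))
  have c₂ : CurAddr d (recAddr d t) s₂ := c₁.congr fun k hk => n₂ k (by omega)
  have u₂ : s₂.sc d 4 = O.flag (E.x t) := by
    rw [← u₁]; exact r₂ _ (by omega) (by omega)
  refine (runs_linComb O s₂ 0 4 37 8 b₂.ready.layout (by omega)
    (by omega) (by omega) (by omega) (Or.inr (by rw [b₂.m]; omega))
    (Or.inr (by rw [c₂.x]; omega)) (by rw [c₂.x, b₂.m]; omega)).mono le_rfl ?_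
  rintro s₃ ⟨n₃, r₃, v₃⟩
  rw [b₂.m] at r₃ v₃
  rw [c₂.x, b₂.ready.c0, u₂, (b₂.recs t le_rfl).x, zero_smul, zero_add] at v₃
  refine ⟨b₂.congr (fun k _ _ hk => n₃ k hk) (fun q hq _ _ _ hq' => r₃ q hq (by omega)), ?_, ?_,
    ?_, ?_⟩
  · rw [n₃ _ (by omega), n₂ _ (by omega), h9, Nat.sub_zero]
  · rw [← v₂]; exact Store.readVec_congr fun i hi => r₃ _ (by omega) (by omega)
  · refine (r₃ _ (by omega) (by omega)).trans ((r₂ _ (by omega) (by omega)).trans (w₁.trans ?_))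
    simp [partialWeight, EllipsoidMethod.weight_zero]
  · rw [v₃]
    simp [partialSum, EllipsoidMethod.weight_zero]

/-- During step `i + 1` of the backward phase from step `t`, for the record at `p`. -/
structure Weighed {d : ℕ} (O : Oracles d) (E : EllipsoidMethod d) (ρ : ℝ) (t i p : ℕ) (s : Store) :
    Prop extends BackBase O E ρ t s where
  x : s.nat 9 = p
  g : s.nat 14 = p + d
  flag : s.nat 17 = p + d + d + d + 1
  dual : s.readVec d (recAddr d (t + 1)) = E.dual t i
  weight : s.sc d 11 = partialWeight O E t i
  sum : s.readVec d (recAddr d (t + 1) + d) = partialSum O E t i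
  coef : s.sc d 4 = E.weight t (i + 1)
  neg : s.sc d 3 = -E.weight t (i + 1)

theorem runs_weigh {d : ℕ} (O : Oracles d) (E : EllipsoidMethod d) (ρ : ℝ) {t i : ℕ}
    (hi : i < t) (s : Store) (hs : BackStep O E ρ t i s) :
    Runs O .weigh s (30 * (d + 1)) (Weighed O E ρ t i (recAddr d (t - (i + 1)))) := by
  obtain ⟨j, hj⟩ : ∃ j, j = t - (i + 1) := ⟨_, rfl⟩
  have hti : t - i = j + 1 := by omega
  have hp := recAddr_le d j
  have hp' := recAddr_add_le (d := d) (show j < t + 1 by omega)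
  have hjt : j ≤ t := by omega
  rw [← hj]
  refine Runs.block_seq (T' := 24 * (d + 1)) _ ?_ (by simp [Instr.cost]; omega)
  obtain ⟨s₁, e₁⟩ : ∃ s₁, s₁ = s.exec O [.natSub 9 9 6, .natAdd 14 9 0, .natAdd 15 14 0,
    .natAdd 16 15 0, .natAdd 17 16 4] := ⟨_, rfl⟩
  rw [← e₁]
  have L := hs.ready.layout
  have r₁ : s₁.real = s.real := by rw [e₁]; rfl
  have h9 : s₁.nat 9 = recAddr d j ∧ s₁.nat 14 = recAddr d j + d ∧
      s₁.nat 15 = recAddr d j + d + d ∧ s₁.nat 16 = recAddr d j + d + d + d ∧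
      s₁.nat 17 = recAddr d j + d + d + d + 1 := by
    have h := hs.ptr
    rw [hti, recAddr_succ] at h
    rw [e₁]
    simp [Store.exec, Instr.apply, Store.setNat, h, L.stride, L.dim, L.one]
  have n₁ : ∀ k, k ≠ 9 → ¬ (14 ≤ k ∧ k ≤ 17) → 4 ≤ k ∨ k = 0 → s₁.nat k = s.nat k :=
    fun k hk hk' _ => by
      rw [e₁]
      simp only [Store.exec, Instr.apply, Store.setNat, Function.update_apply]
      rw [if_neg (by omega), if_neg (by omega), if_neg (by omega), if_neg (by omega),
        if_neg (by omega)]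
  clear e₁
  obtain ⟨n9, n14, n15, n16, n17⟩ := h9
  have b₁ : BackBase O E ρ t s₁ := hs.toBackBase.congr n₁ (by simp [r₁])
  refine Runs.seq_of (T₂ := 12 * (d + 1)) (runs_dot O s₁ 36 15 b₁.ready.layout (by omega)
    (by omega) (Or.inr (by rw [b₁.h]; omega)) (Or.inr (by omega))) ?_ (by omega)
  rintro s₂ ⟨n₂, r₂, a₂⟩
  have du₁ : s₁.readVec d (recAddr d (t + 1)) = E.dual t i := by
    rw [← hs.dual]; exact Store.readVec_congr fun i _ => by rw [r₁]
  rw [b₁.h, n15, du₁, (b₁.recs j hjt).v] at a₂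
  have b₂ : BackBase O E ρ t s₂ := b₁.congr (fun k _ _ hk => n₂ k hk)
    (fun q hq hq' _ _ _ => r₂ q hq hq')
  have L₂ := b₂.ready.layout
  have q20 : s₂.nat 20 = 4 + d + 0 := L₂.scal 0 (by omega)
  have q23 : s₂.nat 23 = 4 + d + 3 := L₂.scal 3 (by omega)
  have q24 : s₂.nat 24 = 4 + d + 4 := L₂.scal 4 (by omega)
  have q31 : s₂.nat 31 = 4 + d + 11 := L₂.scal 11 (by omega)
  have h0 := b₂.ready.c0
  simp only [Store.sc] at h0 a₂
  -- The conditional takes the positive part, which clips the multiplier at zero.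
  refine Runs.seq_of (T₁ := 3) (T₂ := 8 * (d + 1)) (P := fun s₃ => s₃.nat = s₂.nat ∧
    (∀ q, q ≠ 7 + d → s₃.real q = s₂.real q) ∧
    s₃.real (4 + d + 3) = max ⟪E.dual t i, E.v j⟫ 0)
    (Runs.ite (T := 2) (fun hb => Runs.block_le _ ?_ (by simp [Instr.cost]))
      (fun hb => Runs.block_le _ ?_ (by simp))) ?_ (by omega)
  · simp only [Test.holds, Store.val, Store.loc, q20, q23, h0, a₂] at hb
    refine ⟨rfl, fun q hq => ?_, ?_⟩
    · simp only [Store.exec, Instr.apply, Store.setReal, Store.loc, q23]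
      exact Function.update_of_ne (by omega) _ _
    · simp only [Store.exec, Instr.apply, Store.setReal, Store.loc, q23]
      rw [Function.update_self, max_eq_right hb, Rat.cast_zero]
  · simp only [Test.holds, Store.val, Store.loc, q20, q23, h0, a₂, not_le] at hb
    refine ⟨rfl, fun q _ => rfl, ?_⟩
    rw [max_eq_left hb.le]
    exact a₂
  rintro s₃ ⟨n₃, r₃, a₃⟩
  have b₃ : BackBase O E ρ t s₃ := b₂.congr (fun k _ _ _ => by rw [n₃])
    (fun q _ hq _ _ _ => r₃ q hq)
  refine Runs.block_le _ ?_ (by simp [Instr.cost]; omega)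
  obtain ⟨s₄, e₄⟩ : ∃ s₄, s₄ = s₃.exec O [.realDiv (.ind 24) (.ind 23) (.ind 16),
    .realSub (.ind 23) (.ind 20) (.ind 24)] := ⟨_, rfl⟩
  rw [← e₄]
  have n₄ : s₄.nat = s₃.nat := by rw [e₄]; rfl
  have q16 : s₂.nat 16 = recAddr d j + d + d + d := by rw [n₂ _ (by omega), n16]
  have h0' := b₃.ready.c0
  simp only [Store.sc] at h0'
  have hν := (b₃.recs j hjt).ν
  have hw : E.weight t (i + 1) = max ⟪E.dual t i, E.v j⟫ 0 / E.ν j := by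
    rw [EllipsoidMethod.weight_succ, hj]
  have r₄ : ∀ q, q ≠ 7 + d → q ≠ 8 + d → s₄.real q = s₃.real q := fun q hq hq' => by
    rw [e₄]
    simp only [Store.exec, Instr.apply, Store.setReal, Store.val, Store.loc,
      Function.update_apply, n₃, q23, q24]
    rw [if_neg (by omega), if_neg (by omega)]
  have u₄ : s₄.real (4 + d + 4) = E.weight t (i + 1) := by
    rw [e₄, hw]
    simp only [Store.exec, Instr.apply, Store.setReal, Store.val, Store.loc,
      Function.update_apply, n₃, q16, q23, q24, if_true]
    rw [if_neg (by omega), a₃, hν]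
  have t₄ : s₄.sc d 3 = -E.weight t (i + 1) := by
    rw [e₄, hw, Store.sc]
    simp only [Store.exec, Instr.apply, Store.setReal, Store.val, Store.loc,
      Function.update_apply, n₃, q16, q20, q23, q24, if_true]
    rw [if_neg (by omega), a₃, hν, h0', zero_sub]
  clear e₄
  have b₄ : BackBase O E ρ t s₄ := b₃.congr (fun k _ _ _ => by rw [n₄])
    (fun q _ hq hq' _ _ => r₄ q hq hq')
  have du₄ : s₄.readVec d (recAddr d (t + 1)) = E.dual t i := by
    rw [← du₁]
    exact Store.readVec_congr fun i _ => by
      rw [r₄ _ (by omega) (by omega), r₃ _ (by omega), r₂ _ (by omega) (by omega)]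
  have N₄ : ∀ k, 4 ≤ k ∨ k = 0 → s₄.nat k = s₁.nat k := fun k hk => by rw [n₄, n₃, n₂ k hk]
  refine ⟨b₄, by rw [N₄ _ (by omega), n9], by rw [N₄ _ (by omega), n14],
    by rw [N₄ _ (by omega), n17], du₄, ?_, ?_, u₄, t₄⟩
  · refine Eq.trans ?_ hs.weight
    unfold Store.sc
    rw [r₄ _ (by omega) (by omega), r₃ _ (by omega), r₂ _ (by omega) (by omega), r₁]
  · rw [← hs.sum]
    exact Store.readVec_congr fun i _ => by
      rw [r₄ _ (by omega) (by omega), r₃ _ (by omega), r₂ _ (by omega) (by omega), r₁]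

theorem runs_unwind {d : ℕ} (O : Oracles d) (E : EllipsoidMethod d) (ρ : ℝ) {t i : ℕ}
    (hi : i < t) (s₄ : Store) (hs : Weighed O E ρ t i (recAddr d (t - (i + 1))) s₄) :
    Runs O .unwind s₄ (29 * (d + 1)) (BackStep O E ρ t (i + 1)) := by
  obtain ⟨j, hj⟩ : ∃ j, j = t - (i + 1) := ⟨_, rfl⟩
  have hp := recAddr_le d j
  have hp' := recAddr_add_le (d := d) (show j < t + 1 by omega)
  have hjt : j ≤ t := by omega
  rw [← hj] at hs
  obtain ⟨b₄, n9, n14, n17, du₄, w₄, m₄, u₄, t₄⟩ := hs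
  refine Runs.seq_of (T₂ := 17 * (d + 1)) (runs_linComb O s₄ 1 3 36 14 b₄.ready.layout (by omega)
    (by omega) (by omega) (by omega) (Or.inr (by rw [b₄.h]; omega))
    (Or.inr (by rw [n14]; omega)) (by rw [n14, b₄.h]; omega)) ?_ (by omega)
  rintro s₅ ⟨n₅, r₅, v₅⟩
  rw [b₄.h] at r₅ v₅
  rw [n14, b₄.ready.c1, t₄, du₄, (b₄.recs j hjt).g, one_smul, neg_smul,
    ← sub_eq_add_neg, hj, ← EllipsoidMethod.dual_succ] at v₅
  have b₅ : BackBase O E ρ t s₅ := b₄.congr (fun k _ _ hk => n₅ k hk)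
    (fun q hq _ _ _ hq' => r₅ q hq (by omega))
  have u₅ : s₅.real (4 + d + 4) = E.weight t (i + 1) := by
    rw [← u₄]; exact r₅ _ (by omega) (by omega)
  have w₅ : s₅.real (4 + d + 11) = partialWeight O E t i := by
    rw [← w₄]; exact r₅ _ (by omega) (by omega)
  have m₅ : s₅.readVec d (recAddr d (t + 1) + d) = partialSum O E t i := by
    rw [← m₄]; exact Store.readVec_congr fun i _ => r₅ _ (by omega) (by omega)
  refine Runs.block_seq (T' := 12 * (d + 1)) _ ?_ (by simp [Instr.cost]; omega)
  obtain ⟨s₆, e₆⟩ : ∃ s₆, s₆ = s₅.exec O [.realMul (.ind 24) (.ind 24) (.ind 17),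
    .realAdd (.ind 31) (.ind 31) (.ind 24)] := ⟨_, rfl⟩
  rw [← e₆]
  have L₅ := b₅.ready.layout
  have q24' : s₅.nat 24 = 4 + d + 4 := L₅.scal 4 (by omega)
  have q31' : s₅.nat 31 = 4 + d + 11 := L₅.scal 11 (by omega)
  have q17 : s₅.nat 17 = recAddr d j + d + d + d + 1 := by rw [n₅ _ (by omega), n17]
  have n₆ : s₆.nat = s₅.nat := by rw [e₆]; rfl
  have r₆ : ∀ q, q ≠ 8 + d → q ≠ 15 + d → s₆.real q = s₅.real q := fun q hq hq' => by
    rw [e₆]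
    simp only [Store.exec, Instr.apply, Store.setReal, Store.val, Store.loc,
      Function.update_apply, q24', q31']
    rw [if_neg (by omega), if_neg (by omega)]
  have hf := (b₅.recs j hjt).flag
  have u₆ : s₆.sc d 4 = E.weight t (i + 1) * O.flag (E.x j) := by
    rw [e₆, Store.sc]
    simp only [Store.exec, Instr.apply, Store.setReal, Store.val, Store.loc,
      Function.update_apply, q17, q24', q31', if_true]
    rw [if_neg (by omega), u₅, hf]
  have w₆ : s₆.sc d 11 = partialWeight O E t (i + 1) := by
    rw [e₆, Store.sc, partialWeight, Finset.sum_range_succ, ← hj]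
    simp only [Store.exec, Instr.apply, Store.setReal, Store.val, Store.loc,
      Function.update_apply, q17, q24', q31', if_true]
    rw [if_neg (by omega), u₅, hf, w₅, partialWeight]
  clear e₆
  have b₆ : BackBase O E ρ t s₆ := b₅.congr (fun k _ _ _ => by rw [n₆])
    (fun q _ _ hq hq' _ => r₆ q hq hq')
  have m₆ : s₆.readVec d (recAddr d (t + 1) + d) = partialSum O E t i := by
    rw [← m₅]; exact Store.readVec_congr fun i _ => r₆ _ (by omega) (by omega)
  have q9 : s₆.nat 9 = recAddr d j := by rw [n₆, n₅ _ (by omega), n9]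
  refine (runs_linComb O s₆ 1 4 37 9 b₆.ready.layout (by omega)
    (by omega) (by omega) (by omega) (Or.inr (by rw [b₆.m]; omega))
    (Or.inr (by omega)) (by rw [q9, b₆.m]; omega)).mono le_rfl ?_
  rintro s₇ ⟨n₇, r₇, v₇⟩
  rw [b₆.m] at r₇ v₇
  rw [q9, b₆.ready.c1, u₆, m₆, (b₆.recs j hjt).x, one_smul] at v₇
  refine ⟨b₆.congr (fun k _ _ hk => n₇ k hk) (fun q hq _ _ _ hq' => r₇ q hq (by omega)), ?_, ?_,
    ?_, ?_⟩
  · rw [n₇ _ (by omega), q9, hj]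
  · rw [← v₅]
    exact Store.readVec_congr fun i hi => by
      rw [r₇ _ (by omega) (by omega), r₆ _ (by omega) (by omega)]
  · exact (r₇ _ (by omega) (by omega)).trans w₆
  · rw [v₇, partialSum, partialSum, Finset.sum_range_succ _ (i + 1), ← hj]

/-- The output overwrites the beginning of the input, which is no longer needed. Cells `0` to `d -
1` lie below the scalars, which begin at `4 + d`. -/
theorem runs_finish {d : ℕ} (O : Oracles d) (E : EllipsoidMethod d) (ρ : ℝ) {t : ℕ} (s : Store)
    (hs : BackStep O E ρ t t s) : Runs O .finish s (20 * (d + 1)) fun s' =>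
      s'.output d = (partialWeight O E t t)⁻¹ • partialSum O E t t := by
  have hp := recAddr_le d (t + 1)
  refine Runs.block_seq (T' := 12 * (d + 1)) _ ?_ (by simp [Instr.cost]; omega)
  obtain ⟨s₁, e₁⟩ : ∃ s₁, s₁ = s.exec O [.realDiv (.ind 24) (.ind 21) (.ind 31),
    .natConst 36 0] := ⟨_, rfl⟩
  rw [← e₁]
  have L := hs.ready.layout
  have q21 : s.nat 21 = 4 + d + 1 := L.scal 1 (by omega)
  have q24 : s.nat 24 = 4 + d + 4 := L.scal 4 (by omega)
  have q31 : s.nat 31 = 4 + d + 11 := L.scal 11 (by omega)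
  have n₁ : ∀ k, k ≠ 36 → s₁.nat k = s.nat k := fun k hk => by
    rw [e₁]; exact Function.update_of_ne hk _ _
  have h36 : s₁.nat 36 = 0 := by simp [e₁, Store.exec, Instr.apply, Store.setNat]
  have r₁ : ∀ q, q ≠ 8 + d → s₁.real q = s.real q := fun q hq => by
    rw [e₁]
    simp only [Store.exec, Instr.apply, Store.setReal, Store.setNat, Store.loc, q24]
    exact Function.update_of_ne (by omega) _ _
  have h1 := hs.ready.c1
  have h11 := hs.weight
  have u₁ : s₁.sc d 4 = (partialWeight O E t t)⁻¹ := by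
    simp only [Store.sc] at h1 h11 ⊢
    rw [e₁]
    simp only [Store.exec, Instr.apply, Store.setReal, Store.setNat, Store.val, Store.loc, q21,
      q24, q31]
    rw [Function.update_self, h1, h11, one_div]
  clear e₁
  have R₁ : Ready E ρ s₁ := hs.ready.congr
    (fun k hk => n₁ k (by unfold Store.Fixed at hk; omega))
    (fun j hj => r₁ _ (by unfold ConstCell at hj; omega))
  have h37 : s₁.nat 37 = recAddr d (t + 1) + d := by rw [n₁ _ (by omega), hs.m]
  have m₁ : s₁.readVec d (recAddr d (t + 1) + d) = partialSum O E t t := by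
    rw [← hs.sum]; exact Store.readVec_congr fun i _ => r₁ _ (by omega)
  refine (runs_linComb O s₁ 0 4 36 37 R₁.layout (by omega)
    (by omega) (by omega) (by omega) (Or.inl (by omega)) (Or.inr (by omega))
    (by rw [h36, h37]; omega)).mono le_rfl ?_
  rintro s₂ ⟨-, -, v₂⟩
  rw [h36, h37, R₁.c0, u₁, m₁, zero_smul, zero_add] at v₂
  exact v₂

theorem runs_backward {d : ℕ} (O : Oracles d) (E : EllipsoidMethod d) (ρ : ℝ) {t : ℕ} (s : Store)
    (hs : AfterStep O E ρ t s) : Runs O .backward s (130 * ((t + 1) * (d + 1))) fun s' =>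
      s'.output d = (partialWeight O E t t)⁻¹ • partialSum O E t t := by
  refine Runs.seq_of (T₂ := t * (60 * (d + 1) + 1) + 1 + 20 * (d + 1)) (runs_turn O E ρ s hs)
    (fun s₁ h₁ => Runs.seq_of (Runs.loop (T := 60 * (d + 1)) (BackStep O E ρ t) t h₁
      (Q := BackStep O E ρ t t) ?_ ?_) (runs_finish O E ρ) le_rfl) (by nlinarith)
  · intro i hi s' h'
    refine ⟨?_, Runs.seq_of (runs_weigh O E ρ hi s' h') (runs_unwind O E ρ hi) (by omega)⟩
    have := recAddr_add_le (d := d) (show 0 < t - i by omega)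
    simp only [Test.holds, h'.ptr, h'.limit]
    omega
  · intro s' h'
    refine ⟨?_, h'⟩
    simp only [Test.holds, h'.ptr, h'.limit, Nat.sub_self]
    omega

/-! ### Initialization and the complete program -/

namespace Prog

/-- Set up the registers with fixed content. -/
def setupRegisters : List Instr :=
  [.natConst 4 1, .natConst 1 4, .natAdd 20 0 1, .natAdd 21 20 4, .natAdd 22 21 4, .natAdd 23 22 4,
    .natAdd 24 23 4, .natAdd 25 24 4, .natAdd 26 25 4, .natAdd 27 26 4, .natAdd 28 27 4,
    .natAdd 29 28 4, .natAdd 30 29 4, .natAdd 31 30 4, .natAdd 32 31 4, .natAdd 33 32 4,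
    .natAdd 34 33 4, .natAdd 35 34 4, .natAdd 7 35 4, .natAdd 6 0 0, .natAdd 6 6 0, .natConst 1 2,
    .natAdd 6 6 1, .natAdd 1 0 5, .natAdd 8 7 5, .natConst 36 4]

/-- Set up the simplest scalars. -/
def setupScalars : List Instr :=
  [.realConst (.ind 21) 1, .realConst (.ind 32) (-1), .realConst (.ind 25) 1]

/-- Convert the dimension to a real number. -/
def setupDim : Prog :=
  .loop (.natLe 4 1) (.block [.realAdd (.ind 33) (.ind 33) (.ind 21), .natSub 1 1 4])

/-- Compute the final width. -/
def setupWidth : List Instr :=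
  [.realSqrt (.ind 23) (.ind 23), .realMul (.ind 24) (.dir 3) (.dir 2),
    .realAdd (.ind 23) (.ind 23) (.ind 24), .realMul (.ind 23) (.dir 2) (.ind 23),
    .realConst (.ind 34) 2, .realMul (.ind 24) (.ind 34) (.dir 0),
    .realAdd (.ind 23) (.ind 24) (.ind 23), .realMul (.ind 24) (.dir 1) (.dir 0),
    .realDiv (.ind 23) (.ind 24) (.ind 23)]

/-- Compute the squares of the final width and of the radius, and prepare the other constants. -/
def setupSquares : List Instr :=
  [.realMul (.ind 29) (.ind 23) (.ind 23),
    .realMul (.ind 30) (.dir 2) (.dir 2), .realMul (.ind 34) (.ind 34) (.ind 33),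
    .realAdd (.ind 35) (.ind 34) (.ind 21)]

/-- Compute the constants that depend on the dimension only. -/
def setupConstants : List Instr :=
  [.realDiv (.ind 26) (.ind 21) (.ind 35),
    .realAdd (.ind 27) (.ind 26) (.ind 26), .realMul (.ind 34) (.ind 34) (.ind 34),
    .realSub (.ind 35) (.ind 34) (.ind 21), .realDiv (.ind 28) (.ind 34) (.ind 35)]

/-- Prepare the memory. -/
def setup : Prog :=
  .seq (.block setupRegisters) <| .seq (.block setupScalars) <| .seq setupDim <|
  .seq (.instr (.queryMap (.ind 7) (.ind 36))) <| .seq (.dot 7 7) <|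
  .seq (.block setupWidth) <| .seq (.block setupSquares) <|
  .seq (.block setupConstants) (.linComb 0 1 7 36)

/-- The ellipsoid method. -/
def ellipsoid : Prog := .seq setup (.seq forward backward)

end Prog

/-- The memory during the preparation. -/
structure InSetup {d : ℕ} (ε r R L : ℝ) (c : Euc d) (s : Store) : Prop where
  layout : s.Layout d
  ε : s.real 0 = ε
  r : s.real 1 = r
  R : s.real 2 = R
  L : s.real 3 = L
  c : s.readVec d 4 = c
  ptr : s.nat 8 = 20 + d
  ctr : s.nat 36 = 4
  zero : s.real (4 + d) = 0

theorem InSetup.congr {d : ℕ} {ε r R L : ℝ} {c : Euc d} {s s' : Store}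
    (h : InSetup ε r R L c s) (hn : ∀ k, 4 ≤ k ∨ k = 0 → s'.nat k = s.nat k)
    (hr : ∀ q, q ≤ 4 + d → s'.real q = s.real q) : InSetup ε r R L c s' where
  layout := h.layout.congr fun k hk => hn k (by unfold Store.Fixed at hk; omega)
  ε := (hr _ (by omega)).trans h.ε
  r := (hr _ (by omega)).trans h.r
  R := (hr _ (by omega)).trans h.R
  L := (hr _ (by omega)).trans h.L
  c := (Store.readVec_congr fun i hi => hr _ (by omega)).trans h.c
  ptr := (hn _ (by omega)).trans h.ptr
  ctr := (hn _ (by omega)).trans h.ctr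
  zero := (hr _ (by omega)).trans h.zero

theorem inSetup_registers {d : ℕ} (O : Oracles d) (ε r R L : ℝ) (c : Euc d) :
    InSetup ε r R L c ((initialStore ε r R L c).exec O Prog.setupRegisters) ∧
      ((initialStore ε r R L c).exec O Prog.setupRegisters).nat 1 = d ∧
      ((initialStore ε r R L c).exec O Prog.setupRegisters).real
        = (initialStore ε r R L c).real := by
  obtain ⟨s, e⟩ : ∃ s, s = (initialStore ε r R L c).exec O Prog.setupRegisters := ⟨_, rfl⟩
  rw [← e]
  have hr : s.real = (initialStore ε r R L c).real := by rw [e]; rfl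
  have hn : ∀ k, k = 0 ∨ k = 1 ∨ k = 4 ∨ k = 5 ∨ k = 6 ∨ k = 7 ∨ k = 8 ∨ k = 36 → s.nat k =
      if k = 0 ∨ k = 1 then d else if k = 4 then 1 else if k = 5 then 0 else if k = 6 then 3 * d + 2
      else if k = 7 ∨ k = 8 then 20 + d else 4 := by
    intro k hk
    rw [e]
    rcases hk with rfl | rfl | rfl | rfl | rfl | rfl | rfl | rfl <;>
      simp [Prog.setupRegisters, Store.exec, Instr.apply, Store.setNat, initialStore] <;> omega
  have hs : ∀ j < 16, s.nat (20 + j) = 4 + d + j := by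
    intro j hj
    rw [e]
    interval_cases j <;>
      simp [Prog.setupRegisters, Store.exec, Instr.apply, Store.setNat, initialStore] <;> omega
  refine ⟨⟨⟨by simp [hn], by simp [hn], by simp [hn], by simp [hn], by simp [hn], hs⟩,
    by simp [hr, initialStore], by simp [hr, initialStore], by simp [hr, initialStore],
    by simp [hr, initialStore], ?_, by simp [hn], by simp [hn], ?_⟩, by simp [hn], hr⟩
  · ext i
    simp only [Store.readVec_apply, hr, initialStore]
    rw [if_neg (by omega), if_neg (by omega), if_neg (by omega), if_neg (by omega),
      dif_pos ⟨by omega, by omega⟩]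
    exact congrArg c.ofLp (Fin.ext (by simp))
  · rw [hr]
    simp only [initialStore]
    rw [if_neg (by omega), if_neg (by omega), if_neg (by omega), if_neg (by omega),
      dif_neg (by omega)]

/-- No instruction turns a natural number into a real one, so the dimension is counted up in a real
cell. -/
theorem runs_setupDim {d : ℕ} (O : Oracles d) {ε r R L : ℝ} {c : Euc d} (s : Store)
    (hs : InSetup ε r R L c s) (h1 : s.nat 1 = d) (hone : s.sc d 1 = 1) (hz : s.sc d 13 = 0) :
    Runs O Prog.setupDim s (5 * (d + 1)) fun s' =>
      InSetup ε r R L c s' ∧ (∀ q, q ≠ 17 + d → s'.real q = s.real q) ∧ s'.sc d 13 = d := by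
  refine (Runs.loop (T := 3) (n := d) (fun i s' => InSetup ε r R L c s' ∧
    s'.nat 1 = d - i ∧ (∀ q, q ≠ 17 + d → s'.real q = s.real q) ∧ s'.sc d 13 = i)
    ⟨hs, by rw [h1, Nat.sub_zero], fun _ _ => rfl, by rw [hz, Nat.cast_zero]⟩ ?_ ?_).mono
    (by omega) fun s' h => h
  · rintro i hi s' ⟨h2, h3, h4, h5⟩
    have hl := h2.layout
    refine ⟨by simp only [Test.holds, hl.one, h3]; omega,
      Runs.block_le _ ⟨h2.congr (fun k hk => ?_) fun q hq => ?_, ?_, fun q hq => ?_, ?_⟩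
        (by simp [Instr.cost])⟩
    · exact Function.update_of_ne (by omega) _ _
    · have e33 : s'.nat 33 = 4 + d + 13 := hl.scal 13 (by omega)
      simp only [Store.exec, Instr.apply, Store.setReal, Store.setNat, Store.loc, e33]
      exact Function.update_of_ne (by omega) _ _
    · simp [Store.exec, Instr.apply, Store.setReal, Store.setNat, hl.one, h3]
      omega
    · rw [← h4 q hq]
      have e33 : s'.nat 33 = 4 + d + 13 := hl.scal 13 (by omega)
      simp only [Store.exec, Instr.apply, Store.setReal, Store.setNat, Store.loc, e33]
      exact Function.update_of_ne (by omega) _ _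
    · have e33 : s'.nat 33 = 4 + d + 13 := hl.scal 13 (by omega)
      have e21 : s'.nat 21 = 4 + d + 1 := hl.scal 1 (by omega)
      have h6 : s'.real (4 + d + 1) = 1 := by rw [h4 _ (by omega)]; exact hone
      simp only [Store.sc] at h5 ⊢
      simp only [Store.exec, Instr.apply, Store.setReal, Store.setNat, Store.val, Store.loc, e33,
        e21]
      rw [Function.update_self, h5, h6, Nat.cast_succ]
  · rintro s' ⟨h2, h3, h4, h5⟩
    refine ⟨by simp only [Test.holds, h2.layout.one, h3]; omega, h2, h4, h5⟩

/-- With `w` the norm of `F c`, the number `w + L * R` bounds `F` on `X` by the Lipschitz condition.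
-/
theorem setupWidth_spec {d : ℕ} (O : Oracles d) {ε r R L w : ℝ} {c : Euc d} (s : Store)
    (hs : InSetup ε r R L c s) (h3 : s.sc d 3 = w ^ 2) (hw : 0 ≤ w) :
    InSetup ε r R L c (s.exec O Prog.setupWidth) ∧
      (s.exec O Prog.setupWidth).sc d 3 = EllipsoidMethod.finalWidth ε r R (w + L * R) ∧
      (s.exec O Prog.setupWidth).sc d 14 = 2 ∧
      ∀ q, q ≠ 7 + d → q ≠ 8 + d → q ≠ 18 + d → (s.exec O Prog.setupWidth).real q = s.real q := by
  obtain ⟨s', e⟩ : ∃ s', s' = s.exec O Prog.setupWidth := ⟨_, rfl⟩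
  rw [← e]
  have l := hs.layout
  have hn : s'.nat = s.nat := by rw [e]; rfl
  have q23 : s.nat 23 = 4 + d + 3 := l.scal 3 (by omega)
  have q24 : s.nat 24 = 4 + d + 4 := l.scal 4 (by omega)
  have q34 : s.nat 34 = 4 + d + 14 := l.scal 14 (by omega)
  have hr : ∀ q, q ≠ 7 + d → q ≠ 8 + d → q ≠ 18 + d → s'.real q = s.real q :=
    fun q hq hq' hq'' => by
      rw [e]
      simp only [Prog.setupWidth, Store.exec, Instr.apply, Store.setReal, Store.loc, q23, q24, q34]
      repeat rw [Function.update_of_ne (by omega)]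
  simp only [Store.sc] at h3 ⊢
  refine ⟨hs.congr (fun k _ => by rw [hn]) fun q hq => hr q (by omega) (by omega) (by omega),
    ?_, ?_, hr⟩
  · rw [e]
    simp [Prog.setupWidth, Store.exec, Instr.apply, Store.setReal, Store.val, Store.loc,
      q23, q24, q34, hs.ε, hs.r,
      hs.R, hs.L, h3, Real.sqrt_sq hw, EllipsoidMethod.finalWidth]
  · rw [e]
    simp [Prog.setupWidth, Store.exec, Instr.apply, Store.setReal, Store.val, Store.loc,
      q23, q24, q34]

theorem setupSquares_spec {d : ℕ} (O : Oracles d) {ε r R L ρ : ℝ} {c : Euc d} (s : Store)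
    (hs : InSetup ε r R L c s) (h1 : s.sc d 1 = 1)
    (h13 : s.sc d 13 = d) (h3 : s.sc d 3 = ρ) (h14 : s.sc d 14 = 2) :
    InSetup ε r R L c (s.exec O Prog.setupSquares) ∧
      (s.exec O Prog.setupSquares).sc d 9 = ρ * ρ ∧
      (s.exec O Prog.setupSquares).sc d 10 = R * R ∧
      (s.exec O Prog.setupSquares).sc d 14 = 2 * d ∧
      (s.exec O Prog.setupSquares).sc d 15 = 2 * d + 1 ∧
      ∀ q, q < 13 + d ∨ 14 + d < q ∧ q < 18 + d →
        (s.exec O Prog.setupSquares).real q = s.real q := by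
  obtain ⟨s', e⟩ : ∃ s', s' = s.exec O Prog.setupSquares := ⟨_, rfl⟩
  rw [← e]
  have l := hs.layout
  have hn : s'.nat = s.nat := by rw [e]; rfl
  have q21 : s.nat 21 = 4 + d + 1 := l.scal 1 (by omega)
  have q23 : s.nat 23 = 4 + d + 3 := l.scal 3 (by omega)
  have q29 : s.nat 29 = 4 + d + 9 := l.scal 9 (by omega)
  have q30 : s.nat 30 = 4 + d + 10 := l.scal 10 (by omega)
  have q33 : s.nat 33 = 4 + d + 13 := l.scal 13 (by omega)
  have q34 : s.nat 34 = 4 + d + 14 := l.scal 14 (by omega)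
  have q35 : s.nat 35 = 4 + d + 15 := l.scal 15 (by omega)
  have hr : ∀ q, q < 13 + d ∨ 14 + d < q ∧ q < 18 + d → s'.real q = s.real q := fun q hq => by
    rw [e]
    simp only [Prog.setupSquares, Store.exec, Instr.apply, Store.setReal, Store.loc,
      q29, q30, q34, q35]
    repeat rw [Function.update_of_ne (by omega)]
  simp only [Store.sc] at h1 h3 h13 h14 ⊢
  refine ⟨hs.congr (fun k _ => by rw [hn]) fun q hq => hr q (by omega), ?_, ?_, ?_, ?_, hr⟩ <;>
    rw [e] <;>
    simp [Prog.setupSquares, Store.exec, Instr.apply, Store.setReal, Store.val, Store.loc, q21,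
      q23, q29, q30, q33, q34, q35, h1, h3, h13, h14, hs.R]

theorem setupConstants_spec {d : ℕ} (O : Oracles d) {ε r R L ρ : ℝ} {c : Euc d} (s : Store)
    (hs : InSetup ε r R L c s) (h1 : s.sc d 1 = 1) (h5 : s.sc d 5 = 1) (h12 : s.sc d 12 = -1)
    (h9 : s.sc d 9 = ρ * ρ) (h10 : s.sc d 10 = R * R) (h14 : s.sc d 14 = 2 * d)
    (h15 : s.sc d 15 = 2 * d + 1) :
    InSetup ε r R L c (s.exec O Prog.setupConstants) ∧
      (s.exec O Prog.setupConstants).sc d 5 = 1 ∧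
      Ready (O.method c R) ρ (s.exec O Prog.setupConstants) := by
  obtain ⟨s', e⟩ : ∃ s', s' = s.exec O Prog.setupConstants := ⟨_, rfl⟩
  rw [← e]
  have l := hs.layout
  have hn : s'.nat = s.nat := by rw [e]; rfl
  have q21 : s.nat 21 = 4 + d + 1 := l.scal 1 (by omega)
  have q26 : s.nat 26 = 4 + d + 6 := l.scal 6 (by omega)
  have q27 : s.nat 27 = 4 + d + 7 := l.scal 7 (by omega)
  have q28 : s.nat 28 = 4 + d + 8 := l.scal 8 (by omega)
  have q34 : s.nat 34 = 4 + d + 14 := l.scal 14 (by omega)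
  have q35 : s.nat 35 = 4 + d + 15 := l.scal 15 (by omega)
  have hr : ∀ q, q < 10 + d ∨ 12 + d < q ∧ q < 18 + d → s'.real q = s.real q := fun q hq => by
    rw [e]
    simp only [Prog.setupConstants, Store.exec, Instr.apply, Store.setReal, Store.loc,
      q26, q27, q28, q34, q35]
    repeat rw [Function.update_of_ne (by omega)]
  have hs' : InSetup ε r R L c s' := hs.congr (fun k _ => by rw [hn]) fun q hq => hr q (by omega)
  simp only [Store.sc] at h1 h5 h9 h10 h12 h14 h15
  have h678 : s'.sc d 6 = 1 / (2 * d + 1) ∧ s'.sc d 7 = 1 / (2 * d + 1) + 1 / (2 * d + 1) ∧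
      s'.sc d 8 = 2 * d * (2 * d) / (2 * d * (2 * d) - 1) := by
    simp only [Store.sc]
    refine ⟨?_, ?_, ?_⟩ <;> rw [e] <;>
      simp [Prog.setupConstants, Store.exec, Instr.apply, Store.setReal, Store.val, Store.loc, q21,
        q26, q27, q28, q34, q35, h1, h14, h15]
  obtain ⟨h6, h7, h8⟩ := h678
  refine ⟨hs', (hr _ (by omega)).trans h5, ⟨hs'.layout, hs'.zero, (hr _ (by omega)).trans h1,
    h6, ?_, ?_, (hr _ (by omega)).trans h9, (hr _ (by omega)).trans h10,
    (hr _ (by omega)).trans h12⟩⟩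
  · rw [h7, EllipsoidMethod.shift]; ring
  · rw [h8, EllipsoidMethod.growth]; congr 1 <;> ring

theorem runs_setup {d : ℕ} (O : Oracles d) (ε r R L : ℝ) (c : Euc d) :
    Runs O Prog.setup (initialStore ε r R L c) (120 * (d + 1))
      (BeforeStep O (O.method c R)
        (EllipsoidMethod.finalWidth ε r R (‖O.map c‖ + L * R)) 0) := by
  obtain ⟨i₁, d₁, r₁⟩ := inSetup_registers O ε r R L c
  refine Runs.block_seq (T' := 90 * (d + 1)) _ ?_
    (by simp [Instr.cost, Prog.setupRegisters]; omega)
  generalize (initialStore ε r R L c).exec O Prog.setupRegisters = s₁ at i₁ d₁ r₁ ⊢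
  refine Runs.block_seq (T' := 86 * (d + 1)) _ ?_ (by simp [Instr.cost, Prog.setupScalars]; omega)
  obtain ⟨s₂, e₂⟩ : ∃ s₂, s₂ = s₁.exec O Prog.setupScalars := ⟨_, rfl⟩
  rw [← e₂]
  have l := i₁.layout
  have q21 : s₁.nat 21 = 4 + d + 1 := l.scal 1 (by omega)
  have q25 : s₁.nat 25 = 4 + d + 5 := l.scal 5 (by omega)
  have q32 : s₁.nat 32 = 4 + d + 12 := l.scal 12 (by omega)
  have n₂ : s₂.nat = s₁.nat := by rw [e₂]; rfl
  have r₂ : ∀ q, q ≠ 5 + d → q ≠ 9 + d → q ≠ 16 + d → s₂.real q = s₁.real q :=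
    fun q hq hq' hq'' => by
      rw [e₂]
      simp only [Prog.setupScalars, Store.exec, Instr.apply, Store.setReal, Store.loc, q21, q25,
        q32]
      repeat rw [Function.update_of_ne (by omega)]
  have u₂ : s₂.sc d 1 = 1 ∧ s₂.sc d 5 = 1 ∧ s₂.sc d 12 = -1 := by
    rw [e₂]
    simp [Store.sc, Prog.setupScalars, Store.exec, Instr.apply, Store.setReal, Store.loc, q21, q25,
      q32]
  clear e₂
  have z₂ : s₂.sc d 13 = 0 := by
    refine (r₂ _ (by omega) (by omega) (by omega)).trans ?_
    rw [r₁]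
    simp only [initialStore]
    rw [if_neg (by omega), if_neg (by omega), if_neg (by omega), if_neg (by omega),
      dif_neg (by omega)]
  have i₂ : InSetup ε r R L c s₂ := i₁.congr (fun k _ => by rw [n₂])
    fun q hq => r₂ q (by omega) (by omega) (by omega)
  obtain ⟨u1, u5, u12⟩ := u₂
  refine Runs.seq_of (T₂ := 81 * (d + 1)) (runs_setupDim O s₂ i₂ (by rw [n₂, d₁]) u1 z₂) ?_
    (by omega)
  rintro s₃ ⟨i₃, r₃, w₃⟩
  -- The value of `F` at the centre is parked where the first record will be. Register `36` points
  -- to `c` in the input. At the end `c` overwrites the value as the first query point.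
  refine Runs.seq_of (T₂ := 80 * (d + 1)) (P := fun s₄ => InSetup ε r R L c s₄ ∧
    s₄.readVec d (20 + d) = O.map c ∧ ∀ q, q < 20 + d → s₄.real q = s₃.real q)
    (Runs.instr _ ?_) ?_ (by simp only [Instr.cost]; omega)
  · simp only [Instr.apply, Store.loc, i₃.layout.base, i₃.ctr, i₃.c]
    have h : ∀ q, q < 20 + d → (s₃.writeVec (20 + d) (O.map c)).real q = s₃.real q :=
      fun q hq => s₃.writeVec_real_of_not _ (by omega)
    exact ⟨i₃.congr (fun k _ => rfl) fun q hq => h q (by omega), s₃.readVec_writeVec _, h⟩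
  rintro s₄ ⟨i₄, v₄, r₄⟩
  refine Runs.seq_of (T₂ := 68 * (d + 1)) (runs_dot O s₄ 7 7 i₄.layout (by omega) (by omega)
    (Or.inr i₄.layout.base.ge) (Or.inr i₄.layout.base.ge)) ?_ (by omega)
  rintro s₅ ⟨n₅, r₅, a₅⟩
  rw [i₄.layout.base, v₄, real_inner_self_eq_norm_sq] at a₅
  have i₅ : InSetup ε r R L c s₅ := i₄.congr n₅ fun q hq => r₅ q (by omega) (by omega)
  refine Runs.block_seq (T' := 58 * (d + 1)) _ ?_ (by simp [Instr.cost, Prog.setupWidth]; omega)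
  obtain ⟨i₆, a₆, t₆, r₆⟩ := setupWidth_spec O s₅ i₅ a₅ (norm_nonneg _)
  generalize s₅.exec O Prog.setupWidth = s₆ at i₆ a₆ t₆ r₆ ⊢
  refine Runs.block_seq (T' := 53 * (d + 1)) _ ?_ (by simp [Instr.cost, Prog.setupSquares]; omega)
  have keep : ∀ j, j = 1 ∨ j = 5 ∨ j = 12 → s₆.sc d j = s₂.sc d j := fun j hj => by
    unfold Store.sc
    rw [r₆ _ (by omega) (by omega) (by omega), r₅ _ (by omega) (by omega), r₄ _ (by omega),
      r₃ _ (by omega)]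
  have w₆ : s₆.sc d 13 = d := by
    rw [← w₃]
    unfold Store.sc
    rw [r₆ _ (by omega) (by omega) (by omega), r₅ _ (by omega) (by omega), r₄ _ (by omega)]
  obtain ⟨i₇, a₇, b₇, c₇, e₇, r₇⟩ := setupSquares_spec O s₆ i₆ ((keep 1 (by omega)).trans u1) w₆
    a₆ t₆
  generalize s₆.exec O Prog.setupSquares = s₇ at i₇ a₇ b₇ c₇ e₇ r₇ ⊢
  have keep' : ∀ j, j = 1 ∨ j = 5 ∨ j = 12 → s₇.sc d j = s₂.sc d j := fun j hj =>
    (r₇ _ (by omega)).trans (keep j hj)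
  refine Runs.block_seq (T' := 47 * (d + 1)) _ ?_
    (by simp [Instr.cost, Prog.setupConstants]; omega)
  obtain ⟨i₈, a₈, R₈⟩ := setupConstants_spec O s₇ i₇ ((keep' 1 (by omega)).trans u1)
    ((keep' 5 (by omega)).trans u5) ((keep' 12 (by omega)).trans u12) a₇ b₇ c₇ e₇
  generalize s₇.exec O Prog.setupConstants = s₈ at i₈ a₈ R₈ ⊢
  refine (runs_linComb O s₈ 0 1 7 36 i₈.layout (by omega) (by omega) (by omega) (by omega)
    (Or.inr i₈.layout.base.ge) (Or.inl i₈.ctr.le)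
    (by rw [i₈.ctr, i₈.layout.base]; omega)).mono (by omega) ?_
  rintro s₉ ⟨n₉, r₉, v₉⟩
  rw [i₈.layout.base] at r₉ v₉
  rw [i₈.ctr, R₈.c0, R₈.c1, i₈.c, zero_smul, zero_add, one_smul] at v₉
  refine ⟨R₈.congr (fun k hk => n₉ k (by unfold Store.Fixed at hk; omega))
    (fun j hj => r₉ _ (by unfold ConstCell at hj; omega) (by unfold ConstCell at hj; omega)), ?_,
    ?_, fun j hj => absurd hj (Nat.not_lt_zero j), ?_⟩
  · rw [n₉ _ (by omega), i₈.ptr, recAddr_zero]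
  · rw [pow_zero, ← a₈]
    exact r₉ _ (by omega) (by omega)
  · rw [recAddr_zero, v₉]; rfl

/-- The whole program computes the output of the ellipsoid method in polynomially many steps in
terms of the dimension and the number of iterations. -/
theorem runs_ellipsoid {d : ℕ} (O : Oracles d) (ε r R L : ℝ) (c : Euc d) {ρ : ℝ}
    (hρ : ρ = EllipsoidMethod.finalWidth ε r R (‖O.map c‖ + L * R)) {t : ℕ}
    (hs : ∀ i < t, ¬ (O.method c R).Stops ρ i) (ht : (O.method c R).Stops ρ t) :
    Runs O Prog.ellipsoid (initialStore ε r R L c) (600 * ((t + 1) * (t + 1) * (d + 1)))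
      fun s => s.output d
        = (partialWeight O (O.method c R) t t)⁻¹ • partialSum O (O.method c R) t t := by
  have hT : 120 * (d + 1) + (300 * ((t + 1) * (t + 1) * (d + 1)) + 130 * ((t + 1) * (d + 1)))
      ≤ 600 * ((t + 1) * (t + 1) * (d + 1)) := by
    have h1 : d + 1 ≤ (t + 1) * (d + 1) := Nat.le_mul_of_pos_left _ (Nat.succ_pos t)
    have h2 : (t + 1) * (d + 1) ≤ (t + 1) * ((t + 1) * (d + 1)) := by gcongr
    rw [← mul_assoc] at h2
    omega
  subst hρ
  exact Runs.seq_of (runs_setup O ε r R L c) (fun s₁ h₁ => Runs.seq_of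
    (runs_forward O _ rfl _ hs ht s₁ h₁) (fun s₂ h₂ => runs_backward O _ _ s₂ h₂) le_rfl) hT

/-! ### Explicit bounds on the number of iterations -/

namespace EllipsoidMethod

/-- Resolves an inequality with `T` on both sides. The logarithm of `d + 2T` is linearized with
slope `1 / (16d²)`, so that only `T / 2` remains on the right and can be absorbed. -/
theorem le_of_le_mul_log {d : ℕ} (hd : 1 ≤ d) {T K : ℝ} (hT : 0 ≤ T) (hK : 1 ≤ K)
    (h : T ≤ 4 * d * d * Real.log (d + 2 * T * K)) :
    T ≤ d / 2 + 128 * d ^ 4 + 8 * d ^ 2 * Real.log K := by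
  have hd' : (1 : ℝ) ≤ d := by exact_mod_cast hd
  have hy : (0 : ℝ) < d + 2 * T := by positivity
  have h1 : Real.log (d + 2 * T * K) ≤ Real.log (d + 2 * T) + Real.log K := by
    rw [← Real.log_mul hy.ne' (by positivity)]
    apply Real.log_le_log (by positivity)
    nlinarith
  have h2 : Real.log (d + 2 * T) ≤ (d + 2 * T) / (16 * d ^ 2) + 16 * d ^ 2 := by
    have h3 := Real.log_le_sub_one_of_pos (show 0 < (d + 2 * T) / (16 * d ^ 2) by positivity)
    have h4 := Real.log_le_sub_one_of_pos (show (0 : ℝ) < 16 * d ^ 2 by positivity)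
    rw [Real.log_div hy.ne' (by positivity)] at h3
    linarith
  have h5 : 4 * d * d * Real.log (d + 2 * T * K)
      ≤ 4 * d * d * ((d + 2 * T) / (16 * d ^ 2) + 16 * d ^ 2 + Real.log K) := by
    gcongr
    linarith
  have h6 : 4 * d * d * ((d + 2 * T) / (16 * d ^ 2) + 16 * d ^ 2 + Real.log K)
      = (d + 2 * T) / 4 + 64 * d ^ 4 + 4 * d ^ 2 * Real.log K := by
    field_simp
    ring
  linarith

/-- The cutting phase ends, after a number of steps that is bounded by the logarithm of the
condition number. -/
theorem exists_stops {d : ℕ} (E : EllipsoidMethod d) (hd : 1 ≤ d) {ρ : ℝ} (hρ : 0 < ρ)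
    (hR : ρ ≤ E.rad) : ∃ t, E.Stops ρ t ∧ (∀ s < t, ¬ E.Stops ρ s) ∧
      (t : ℝ) ≤ d / 2 + 128 * d ^ 4 + 16 * d ^ 2 * Real.log (E.rad / ρ) := by
  classical
  have hK : 1 ≤ E.rad * E.rad / (ρ * ρ) := by
    rw [one_le_div (by positivity)]
    exact mul_le_mul hR hR hρ.le (hρ.le.trans hR)
  have hlog : Real.log (E.rad * E.rad / (ρ * ρ)) = 2 * Real.log (E.rad / ρ) := by
    rw [mul_div_mul_comm, ← pow_two, Real.log_pow]
    norm_num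
  have key : ∀ T : ℕ, (∀ s < T, ¬ E.Stops ρ s) →
      (T : ℝ) ≤ d / 2 + 128 * d ^ 4 + 16 * d ^ 2 * Real.log (E.rad / ρ) := fun T hT => by
    have := le_of_le_mul_log hd (Nat.cast_nonneg T) hK
      (E.iterations_le hd (hρ.trans_le hR) hρ hT)
    rw [hlog] at this
    linarith
  -- If the criterion never held, the bound would apply to every natural number.
  have hex : ∃ t, E.Stops ρ t := by
    by_contra hcon
    push Not at hcon
    obtain ⟨T, hT⟩ := exists_nat_gt (d / 2 + 128 * d ^ 4 + 16 * d ^ 2 * Real.log (E.rad / ρ))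
    exact absurd (key T fun s _ => hcon s) (not_le.2 hT)
  exact ⟨Nat.find hex, Nat.find_spec hex, fun s hs => Nat.find_min hex hs,
    key _ fun s hs => Nat.find_min hex hs⟩

/-- The ratio equals `(R / r)(2 + R(M₀ + LR) / ε)`. It is dominated by twice a product of factors of
the form `1 + _`, with `1 + R` occurring three times. -/
theorem log_radius_div_finalWidth_le {ε r R M₀ L : ℝ} (hε : 0 < ε) (hr : 0 < r) (hR : 0 < R)
    (hM : 0 ≤ M₀) (hL : 0 ≤ L) :
    Real.log (R / finalWidth ε r R (M₀ + L * R)) ≤ 1 + 3 * Real.log (1 + R) + Real.log (1 + 1 / r)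
      + Real.log (1 + 1 / ε) + Real.log (1 + M₀) + Real.log (1 + L) := by
  have e : R / finalWidth ε r R (M₀ + L * R)
      = R * (1 / r) * (2 + R * (M₀ + L * R) * (1 / ε)) := by
    unfold finalWidth
    have : 0 < 2 * ε + R * (M₀ + L * R) := by positivity
    field_simp
  have h1 : M₀ + L * R + 1 ≤ (1 + M₀) * (1 + L) * (1 + R) := by
    have : 0 ≤ L + R + M₀ * L + M₀ * R + M₀ * (L * R) := by positivity
    linarith
  have h2 : 2 + R * (M₀ + L * R) * (1 / ε)
      ≤ 2 * ((1 + R) * ((1 + M₀) * (1 + L) * (1 + R)) * (1 + 1 / ε)) := by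
    have h3 : R * (M₀ + L * R) ≤ (1 + R) * ((1 + M₀) * (1 + L) * (1 + R)) := by
      gcongr <;> linarith
    have h4 : R * (M₀ + L * R) * (1 / ε)
        ≤ (1 + R) * ((1 + M₀) * (1 + L) * (1 + R)) * (1 / ε) := by gcongr
    have h5 : 1 ≤ (1 + R) * ((1 + M₀) * (1 + L) * (1 + R)) :=
      one_le_mul_of_one_le_of_one_le (by linarith) (one_le_mul_of_one_le_of_one_le
        (one_le_mul_of_one_le_of_one_le (by linarith) (by linarith)) (by linarith))
    have h6 : 0 < 1 / ε := by positivity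
    nlinarith
  have h7 : R / finalWidth ε r R (M₀ + L * R) ≤ (1 + R) * (1 + 1 / r) *
      (2 * ((1 + R) * ((1 + M₀) * (1 + L) * (1 + R)) * (1 + 1 / ε))) := by
    rw [e]
    gcongr <;> linarith
  have h8 : 0 < R / finalWidth ε r R (M₀ + L * R) := by rw [e]; positivity
  refine (Real.log_le_log h8 h7).trans ?_
  have h9 : Real.log 2 ≤ 1 := by linarith [Real.log_two_lt_d9]
  have a1 : (1 + R) ≠ 0 := by positivity
  have a2 : (1 + 1 / r) ≠ 0 := by positivity
  have a3 : (1 + 1 / ε) ≠ 0 := by positivity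
  have a4 : (1 + M₀) ≠ 0 := by positivity
  have a5 : (1 + L) ≠ 0 := by positivity
  have a6 : (2 : ℝ) ≠ 0 := two_ne_zero
  rw [Real.log_mul (by positivity) (by positivity), Real.log_mul a1 a2,
    Real.log_mul a6 (by positivity), Real.log_mul (by positivity) a3,
    Real.log_mul a1 (by positivity), Real.log_mul (by positivity) a1, Real.log_mul a4 a5]
  linarith

end EllipsoidMethod

/-! ### Correctness and running time of the program -/

theorem IsSeparationOracle.answer_of_mem {d : ℕ} {X : Set (Euc d)} {O : Oracles d}
    (h : IsSeparationOracle X O.sep) {x : Euc d} (hx : x ∈ X) :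
    O.answer x = O.map x ∧ O.flag x = 1 := by
  simp [Oracles.answer, Oracles.flag, (h x).1 hx]

theorem IsSeparationOracle.answer_of_not_mem {d : ℕ} {X : Set (Euc d)} {O : Oracles d}
    (h : IsSeparationOracle X O.sep) {x : Euc d} (hx : x ∉ X) :
    (O.answer x ≠ 0 ∧ ∀ y ∈ X, ⟪O.answer x, y⟫ ≤ ⟪O.answer x, x⟫) ∧ O.flag x = 0 := by
  obtain ⟨g, h1, h2⟩ := (h x).2 hx
  have e : O.answer x = g := by simp [Oracles.answer, h1]
  rw [e]
  exact ⟨h2, by simp [Oracles.flag, h1]⟩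

/-- The program solves the expected variational inequality. -/
theorem ellipsoid_spec {d : ℕ} {X : Set (Euc d)} {F : Euc d → Euc d} {ε : ℝ} {L : ℝ≥0} {c : Euc d}
    {r R : ℝ} {sep : Euc d → Option (Euc d)} (hF : LipschitzOnWith L F X) (hε : 0 < ε) (hr : 0 < r)
    (hX₁ : Metric.closedBall c r ⊆ X) (hX₂ : X ⊆ Metric.closedBall c R)
    (hsep : IsSeparationOracle X sep) :
    ∃ t : ℕ, Runs ⟨sep, F⟩ Prog.ellipsoid (initialStore ε r R L c)
        (600 * ((t + 1) * (t + 1) * (d + 1)))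
        (fun s => ∃ μ : Measure (Euc d), IsEVISol F X ε μ ∧ s.output d = distMean μ) ∧
      (t : ℝ) ≤ d / 2 + 128 * d ^ 4 + 16 * d ^ 2 * (1 + 3 * Real.log (1 + R)
        + Real.log (1 + 1 / r) + Real.log (1 + 1 / ε) + Real.log (1 + ‖F c‖)
        + Real.log (1 + L)) := by
  set O : Oracles d := ⟨sep, F⟩ with hO
  have hsep' : IsSeparationOracle X O.sep := hsep
  set E := O.method c R with hE
  obtain ⟨ρ, hρ⟩ : ∃ ρ, ρ = EllipsoidMethod.finalWidth ε r R (‖F c‖ + L * R) := ⟨_, rfl⟩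
  have hc : c ∈ X := hX₁ (Metric.mem_closedBall_self hr.le)
  have hnn : ∀ t, E.x t ∈ X → O.flag (E.x t) = 1 := fun t h => (hsep'.answer_of_mem h).2
  have hfin : ∀ t : ℕ, E.Stops ρ t → (∀ s < t, ¬ E.Stops ρ s) →
      (0 < partialWeight O E t t ∧ ∀ y ∈ X, ∑ k ∈ Finset.range (t + 1),
        E.weight t k * O.flag (E.x (t - k)) * ⟪F (E.x (t - k)), E.x (t - k) - y⟫
          ≤ ε * partialWeight O E t t) →
      (∀ k ∈ Finset.range (t + 1), 0 ≤ E.weight t k) →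
      Runs O Prog.ellipsoid (initialStore ε r R L c) (600 * ((t + 1) * (t + 1) * (d + 1)))
        (fun s => ∃ μ : Measure (Euc d), IsEVISol F X ε μ ∧ s.output d = distMean μ) := by
    intro t ht hs hw hw₀
    have hflag : ∀ x, 0 ≤ O.flag x := fun x => by
      by_cases hx : x ∈ X
      · rw [(hsep'.answer_of_mem hx).2]; exact zero_le_one
      · rw [(hsep'.answer_of_not_mem hx).2]
    have hmem : ∀ k, E.weight t k * O.flag (E.x (t - k)) ≠ 0 → E.x (t - k) ∈ X := fun k h0 => by
      by_contra hx
      exact h0 (by rw [(hsep'.answer_of_not_mem hx).2, mul_zero])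
    refine (runs_ellipsoid O ε r R L c hρ hs ht).mono le_rfl fun s h => ?_
    obtain ⟨μ, h1, h2⟩ := isEVISol_of_weights (F := F) (X := X) (ε := ε) (Finset.range (t + 1))
      (fun k => E.weight t k * O.flag (E.x (t - k))) (fun k => E.x (t - k))
      (fun k hk => mul_nonneg (hw₀ k hk) (hflag _)) hw.1 (fun k _ h0 => hmem k h0) hw.2
    exact ⟨μ, h1, h.trans h2.symm⟩
  -- In dimension `0` all inner products vanish and the method stops at its first query point, which
  -- is `c`. The analysis of the ellipsoids needs `d ≥ 1`.
  rcases Nat.eq_zero_or_pos d with rfl | hd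
  · have hin : ∀ a b : Euc 0, ⟪a, b⟫ = 0 := fun a b => by simp [PiLp.inner_apply]
    have hx : E.x 0 ∈ X := by rw [Subsingleton.elim (E.x 0) c]; exact hc
    have hw : partialWeight O E 0 0 = 1 := by
      simp [partialWeight, EllipsoidMethod.weight_zero, hnn 0 hx]
    have hR : 0 ≤ R := by simpa using dist_nonneg.trans (hX₂ hc)
    refine ⟨0, hfin 0 (by
        unfold EllipsoidMethod.Stops EllipsoidMethod.ν
        rw [hin, hin, mul_zero, mul_zero])
      (fun s hs => absurd hs (Nat.not_lt_zero s)) ⟨by rw [hw]; exact one_pos, fun y _ => ?_⟩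
      (fun k hk => ?_), by simp⟩
    · rw [hw, Finset.sum_eq_zero fun k _ => by rw [hin, mul_zero]]
      linarith
    · have : k = 0 := by simpa using hk
      rw [this, EllipsoidMethod.weight_zero]
      exact zero_le_one
  · have hrR : r ≤ R := by
      -- A boundary point of the inner ball compares the radii. It exists since there is a unit
      -- vector.
      have h1 : c + r • EuclideanSpace.single (⟨0, hd⟩ : Fin d) (1 : ℝ) ∈ Metric.closedBall c R :=
        hX₂ (hX₁ (by simp [norm_smul, abs_of_pos hr]))
      simpa [norm_smul, abs_of_pos hr] using h1
    have hR : 0 < R := hr.trans_le hrR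
    have hρ0 : 0 < ρ := by
      rw [hρ, EllipsoidMethod.finalWidth]
      positivity
    have hρR : ρ ≤ R := by
      rw [hρ, EllipsoidMethod.finalWidth, div_le_iff₀ (by positivity)]
      have h1 : r * ε ≤ R * ε := by gcongr
      have h2 : 0 ≤ R * ε := by positivity
      have h3 : 0 ≤ R * (R * (‖F c‖ + L * R)) := by positivity
      linarith
    obtain ⟨t, ht, hs, hle⟩ := E.exists_stops hd hρ0 hρR
    refine ⟨t, hfin t ht hs ?_ ?_, hle.trans ?_⟩
    · refine E.weights_solve hd hε hr hrR hX₁ hX₂ (fun x hx => ?_)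
        (fun x hx => (hsep'.answer_of_mem hx).1) (fun x hx => (hsep'.answer_of_not_mem hx).1) hρ
        hs ht (fun s => O.flag (E.x s)) hnn (fun s hx => (hsep'.answer_of_not_mem hx).2)
      have h1 := hF.dist_le_mul x hx c hc
      have h2 : dist x c ≤ R := hX₂ hx
      have h3 : ‖F x‖ ≤ ‖F c‖ + dist (F x) (F c) := by
        rw [dist_eq_norm]
        exact norm_le_norm_add_norm_sub' _ _
      have h4 : (L : ℝ) * dist x c ≤ L * R := by gcongr
      linarith
    · intro k hk
      exact E.weight_nonneg (fun s h => E.ν_pos_of_not_stops hd (hs s h))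
        (Nat.lt_succ_iff.1 (Finset.mem_range.1 hk))
    · rw [hρ]
      have := EllipsoidMethod.log_radius_div_finalWidth_le hε hr hR (norm_nonneg (F c)) L.2
      gcongr
      exact this

/-- The running time in terms of the input parameters. -/
theorem le_polynomial {n t d a b c e f : ℝ} (hd : 0 ≤ d) (ha : 0 ≤ a) (hb : 0 ≤ b) (hc : 0 ≤ c)
    (he : 0 ≤ e) (hf : 0 ≤ f)
    (ht : t ≤ d / 2 + 128 * d ^ 4 + 16 * d ^ 2 * (1 + 3 * b + c + a + f + e))
    (hn : n ≤ 600 * ((t + 1) * (t + 1) * (d + 1))) (ht₀ : 0 ≤ t) :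
    n ≤ ((600 * 181 ^ 2 : ℕ) : ℝ) * (1 + d + a + b + c + e + f) ^ 9 := by
  obtain ⟨Z, hZ⟩ : ∃ Z, Z = 1 + d + a + b + c + e + f := ⟨_, rfl⟩
  rw [← hZ]
  have hZ1 : 1 ≤ Z := by linarith
  have hdZ : d + 1 ≤ Z := by linarith
  -- The coefficients `1/2`, `128`, `16 * 3` and `1` add up to less than `181`. The fourth power
  -- comes from `128 * d ^ 4`, and the final exponent is `4 + 4 + 1`.
  have ht' : t + 1 ≤ 181 * Z ^ 4 := by
    have b1 : 1 + 3 * b + c + a + f + e ≤ 3 * Z := by linarith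
    have b2 : 16 * d ^ 2 * (1 + 3 * b + c + a + f + e) ≤ 16 * Z ^ 2 * (3 * Z) := by
      gcongr
      linarith
    have b3 : d ^ 4 ≤ Z ^ 4 := by gcongr; linarith
    have b4 : Z ^ 3 ≤ Z ^ 4 := pow_le_pow_right₀ hZ1 (by norm_num)
    have b5 : Z ^ 1 ≤ Z ^ 4 := pow_le_pow_right₀ hZ1 (by norm_num)
    have b6 : 1 ≤ Z ^ 4 := one_le_pow₀ hZ1
    have b7 : 16 * Z ^ 2 * (3 * Z) = 48 * Z ^ 3 := by ring
    rw [pow_one] at b5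
    linarith
  calc n ≤ 600 * ((t + 1) * (t + 1) * (d + 1)) := hn
    _ ≤ 600 * (181 * Z ^ 4 * (181 * Z ^ 4) * Z) := by gcongr
    _ = ((600 * 181 ^ 2 : ℕ) : ℝ) * Z ^ 9 := by
      rw [Nat.cast_mul, Nat.cast_pow, Nat.cast_ofNat, Nat.cast_ofNat]
      ring

theorem mainTheorem11 :
    -- the mean of every EVI solution is an approximate MVI and VI solution,
    -- and every approximate MVI solution is an approximate VI solution
    (∀ (d : ℕ) (X : Set (Euc d)) (F : Euc d → Euc d) (σ ε : ℝ) (L : ℝ≥0),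
      X.Nonempty → Convex ℝ X → IsCompact X → LipschitzOnWith L F X →
      0 ≤ σ → Hypomonotone σ F X → 0 < ε →
      (∀ μ : Measure (Euc d), IsEVISol F X ε μ →
        IsMVISol F X (ε + σ * Metric.diam X ^ 2) (distMean μ) ∧
        (ε ≤ L * Metric.diam X ^ 2 →
          IsVISol F X (2 * Metric.diam X * Real.sqrt (L * (ε + σ * Metric.diam X ^ 2)))
            (distMean μ))) ∧
      (ε + σ * Metric.diam X ^ 2 ≤ L * Metric.diam X ^ 2 →
        ∀ x : Euc d, IsMVISol F X (ε + σ * Metric.diam X ^ 2) x →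
          IsVISol F X (2 * Metric.diam X * Real.sqrt (L * (ε + σ * Metric.diam X ^ 2))) x)) ∧
    -- one program computes such a point in polynomial time
    (∃ (P : Prog) (C k : ℕ),
      ∀ (d : ℕ) (X : Set (Euc d)) (F : Euc d → Euc d) (σ ε : ℝ) (L : ℝ≥0)
        (c : Euc d) (r R : ℝ) (sep : Euc d → Option (Euc d)),
        Convex ℝ X → IsCompact X → LipschitzOnWith L F X →
        0 ≤ σ → Hypomonotone σ F X → 0 < ε →
        0 < r → Metric.closedBall c r ⊆ X → X ⊆ Metric.closedBall c R →
        IsSeparationOracle X sep →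
        ∃ (t : ℕ) (s : Store),
          Exec ⟨sep, F⟩ P (initialStore ε r R L c) t s ∧
          (t : ℝ) ≤ C * (1 + d + Real.log (1 + 1 / ε) + Real.log (1 + R) + Real.log (1 + 1 / r)
            + Real.log (1 + L) + Real.log (1 + ‖F c‖)) ^ k ∧
          (∃ μ : Measure (Euc d), IsEVISol F X ε μ ∧ s.output d = distMean μ) ∧
          IsMVISol F X (ε + σ * Metric.diam X ^ 2) (s.output d) ∧
          (ε ≤ L * Metric.diam X ^ 2 →
            IsVISol F X (2 * Metric.diam X * Real.sqrt (L * (ε + σ * Metric.diam X ^ 2)))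
              (s.output d))) := by
  refine ⟨fun d X F σ ε L _ hc hX hL hσ hF hε => ⟨fun μ hμ =>
    ⟨hμ.isMVISol_distMean hc hX hσ hF, fun hle =>
      hμ.isVISol_distMean hc hX hL hσ hF hε hle⟩, fun hle x hx =>
      hx.isVISol hc hX hL (by positivity) hle⟩, Prog.ellipsoid, 600 * 181 ^ 2, 9, ?_⟩
  intro d X F σ ε L c r R sep hc hX hL hσ hF hε hr hX₁ hX₂ hsep
  obtain ⟨t, ⟨n, s, h1, h2, μ, hμ, h3⟩, ht⟩ := ellipsoid_spec hL hε hr hX₁ hX₂ hsep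
  refine ⟨n, s, h1, ?_, ⟨μ, hμ, h3⟩, ?_, fun hle => ?_⟩
  · have hR : 0 ≤ R := by
      have h := hX₂ (hX₁ (Metric.mem_closedBall_self hr.le))
      simpa using h
    exact le_polynomial (Nat.cast_nonneg d) (Real.log_nonneg (by simp [hε.le]))
      (Real.log_nonneg (by linarith)) (Real.log_nonneg (by simp [hr.le]))
      (Real.log_nonneg (by simp)) (Real.log_nonneg (by simp)) ht (by exact_mod_cast h2)
      (Nat.cast_nonneg t)
  · rw [h3]; exact hμ.isMVISol_distMean hc hX hσ hF
  · rw [h3]; exact hμ.isVISol_distMean hc hX hL hσ hF hε hle
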